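/- Let $n\ge 3$. For $z\in\mathbb C^n$ let $\gamma(z)=\sqrt{z_1^2+\dots+z_n^2}$, with the branch of the square root for which $\operatorname{Re}\gamma\ge 0$, and let $$\phi(z)=\frac{1}{\omega_n}\,\frac{\gamma(z)^{2-n}}{2-n},\qquad \omega_n=\frac{2\pi^{n/2}}{\Gamma(n/2)},$$ be the holomorphic Newtonian potential. For $\varepsilon>0$ let $\phi_\varepsilon(z)=\theta(\operatorname{Re}\gamma(z)-\varepsilon)\,\phi(z)$, where $\theta$ is the Heaviside step function, and for fixed $y\in\mathbb R^n$ let $\tilde\delta_\varepsilon(x+iy)=\Delta_x\phi_\varepsilon(x+iy)$, the Laplacian being taken in the sense of distributions in $x\in\mathbb R^n$. Then for every $y\in\mathbb R^n$ the limit $$\langle\tilde\delta(\cdot+iy),f\rangle=\lim_{\varepsilon\to0^+}\langle\tilde\delta_\varepsilon(\cdot+iy),f\rangle$$ exists for every test function $f\in C_c^\infty(\mathbb R^n)$ and defines a distribution $\tilde\delta(\cdot+iy)$ on $\mathbb R^n$ (the singular source distribution). It extends the point source in the sense that $$\lim_{y\to0}\,\langle\tilde\delta(\cdot+iy),f\rangle=f(0)\qquad\text{for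 every } f\in C_c^\infty(\mathbb R^n),$$ that is, $\tilde\delta(x+iy)\to\delta(x)$ in the sense of distributions as $y\to0$. -/

import Mathlib

open Filter Topology MeasureTheory
open scoped Distributions

/-- The complex length `γ(z) = √(z₁² + ⋯ + zₙ²)` of `z ∈ ℂⁿ`, with the branch of the root that has
`Re γ ≥ 0` (the principal one). -/
noncomputable def complexLength {n : ℕ} (z : Fin n → ℂ) : ℂ :=
  (∑ i, z i ^ 2) ^ (1 / 2 : ℂ)

/-- The point `x + iy` of `ℂⁿ`. -/
noncomputable def complexPoint {n : ℕ} (x y : EuclideanSpace ℝ (Fin n)) : Fin n → ℂ :=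
  fun i => (x i : ℂ) + Complex.I * (y i : ℂ)

/-- The area `ωₙ = 2 π^{n/2} / Γ(n/2)` of the unit sphere in `ℝⁿ`. -/
noncomputable def sphereArea (n : ℕ) : ℝ :=
  2 * Real.pi ^ ((n : ℝ) / 2) / Real.Gamma ((n : ℝ) / 2)

/-- The holomorphic Newtonian potential `φ(z) = γ(z)^{2-n} / ((2-n) ωₙ)` on `ℂⁿ`, `n ≥ 3`. -/
noncomputable def holomorphicPotential {n : ℕ} (z : Fin n → ℂ) : ℂ :=
  (sphereArea n : ℂ)⁻¹ * (complexLength z ^ (2 - (n : ℤ)) / (2 - (n : ℂ)))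

open scoped Classical in
/-- The regularized potential `φ_ε(z) = θ(Re γ(z) - ε) φ(z)`, with `θ` the Heaviside function. -/
noncomputable def regularizedPotential {n : ℕ} (ε : ℝ) (z : Fin n → ℂ) : ℂ :=
  if ε < (complexLength z).re then holomorphicPotential z else 0

lemma complexLength_re_nonneg {n : ℕ} (z : Fin n → ℂ) : 0 ≤ (complexLength z).re := by
  rw [complexLength]
  by_cases h0 : (∑ i, z i ^ 2) = 0
  · rw [h0, Complex.zero_cpow (by norm_num)]; simp
  · rw [Complex.cpow_def_of_ne_zero h0, Complex.exp_re]
    refine mul_nonneg (Real.exp_pos _).le (Real.cos_nonneg_of_mem_Icc ?_)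
    have h1 := Complex.neg_pi_lt_arg (∑ i, z i ^ 2)
    have h2 := Complex.arg_le_pi (∑ i, z i ^ 2)
    have h3 : (Complex.log (∑ i, z i ^ 2) * (1 / 2 : ℂ)).im = Complex.arg (∑ i, z i ^ 2) / 2 := by
      rw [show (1 / 2 : ℂ) = ((1 / 2 : ℝ) : ℂ) by norm_num, Complex.im_mul_ofReal, Complex.log_im]
      ring
    rw [h3]
    constructor <;> linarith

lemma complexLength_sq {n : ℕ} (z : Fin n → ℂ) : complexLength z ^ 2 = ∑ i, z i ^ 2 := by
  simp [complexLength]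

/-- For `ε > 0` the regularized potential is a locally integrable function of `x`. -/
lemma locallyIntegrable_regularizedPotential {n : ℕ} (hn : 2 ≤ n) {ε : ℝ} (hε : 0 < ε)
    (y : EuclideanSpace ℝ (Fin n)) :
    LocallyIntegrable (fun x => regularizedPotential ε (complexPoint x y)) := by
  have hmeas1 : Measurable fun x : EuclideanSpace ℝ (Fin n) =>
      complexLength (complexPoint x y) := by
    unfold complexLength complexPoint
    fun_prop
  have hmeas : Measurable fun x : EuclideanSpace ℝ (Fin n) =>
      regularizedPotential ε (complexPoint x y) := by
    unfold regularizedPotential holomorphicPotential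
    refine Measurable.ite ?_ ?_ measurable_const
    · exact measurableSet_lt measurable_const (Complex.measurable_re.comp hmeas1)
    · obtain ⟨k, rfl⟩ := Nat.exists_eq_add_of_le hn
      have : (2 - ((2 + k : ℕ) : ℤ)) = -(k : ℤ) := by push_cast; ring
      simp only [this, zpow_neg, zpow_natCast]
      exact (((hmeas1.pow_const k).inv).div_const _).const_mul _
  have hbound : ∀ x, ‖regularizedPotential ε (complexPoint x y)‖ ≤
      ‖(sphereArea n : ℂ)⁻¹‖ * (ε ^ (2 - (n : ℤ)) / ‖(2 - (n : ℂ))‖) := by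
    intro x
    unfold regularizedPotential
    split_ifs with h
    · unfold holomorphicPotential
      rw [norm_mul, norm_div, norm_zpow]
      gcongr
      have h1 : ε ≤ ‖complexLength (complexPoint x y)‖ := h.le.trans (Complex.re_le_norm _)
      obtain ⟨k, rfl⟩ := Nat.exists_eq_add_of_le hn
      have : (2 - ((2 + k : ℕ) : ℤ)) = -(k : ℤ) := by push_cast; ring
      rw [this, zpow_neg, zpow_neg, zpow_natCast, zpow_natCast]
      gcongr
    · simp only [norm_zero]; positivity
  have hc : LocallyIntegrable (fun _ : EuclideanSpace ℝ (Fin n) =>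
      ‖(sphereArea n : ℂ)⁻¹‖ * (ε ^ (2 - (n : ℤ)) / ‖(2 - (n : ℂ))‖)) := locallyIntegrable_const _
  refine hc.mono hmeas.aestronglyMeasurable (Eventually.of_forall fun x => ?_)
  exact (hbound x).trans (le_abs_self _)

/-- The distribution `f ↦ ∫ f(x) g(x) dx` on `ℝⁿ` given by a locally integrable function `g`. -/
noncomputable def functionDistribution {n : ℕ} (g : EuclideanSpace ℝ (Fin n) → ℂ) :
    𝓓'((⊤ : TopologicalSpace.Opens (EuclideanSpace ℝ (Fin n))), ℂ) :=
  (TestFunction.integralAgainstBilinCLM (ContinuousLinearMap.lsmul ℝ ℝ) volume g :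
    𝓓((⊤ : TopologicalSpace.Opens (EuclideanSpace ℝ (Fin n))), ℝ) →L[ℝ] ℂ)

/-- The regularized source distribution `δ̃_ε(x + iy) = Δₓ φ_ε(x + iy)` on `ℝⁿ`, for fixed `y`;
the Laplacian is that of distributions. -/
noncomputable def regularizedSource {n : ℕ} (ε : ℝ) (y : EuclideanSpace ℝ (Fin n)) :
    𝓓'((⊤ : TopologicalSpace.Opens (EuclideanSpace ℝ (Fin n))), ℂ) :=
  LineDeriv.laplacianCLM ℝ (EuclideanSpace ℝ (Fin n))
    𝓓'((⊤ : TopologicalSpace.Opens (EuclideanSpace ℝ (Fin n))), ℂ)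
    (functionDistribution fun x => regularizedPotential ε (complexPoint x y))

/-- `T` is the singular source distribution `δ̃(x + iy)` on `ℝⁿ`, for fixed `y`: the limit as
`ε → 0⁺`, in the sense of distributions, of the regularized sources `δ̃_ε(x + iy)`. -/
def IsSingularSource {n : ℕ} (y : EuclideanSpace ℝ (Fin n))
    (T : 𝓓'((⊤ : TopologicalSpace.Opens (EuclideanSpace ℝ (Fin n))), ℂ)) : Prop :=
  ∀ f : 𝓓((⊤ : TopologicalSpace.Opens (EuclideanSpace ℝ (Fin n))), ℝ),
    Tendsto (fun ε : ℝ => regularizedSource ε y f) (𝓝[>] 0) (𝓝 (T f))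

/-- The point source `δ(x)` at the origin of `ℝⁿ`, as a complex-valued distribution. -/
noncomputable def pointSource (n : ℕ) :
    𝓓'((⊤ : TopologicalSpace.Opens (EuclideanSpace ℝ (Fin n))), ℂ) :=
  Distribution.mapCLM Complex.ofRealCLM (Distribution.delta 0)

/-! Write p = Re γ, q = Im γ. Pairing the regularized source with f gives the integral of φ_ε Δf, so
everything concerns integrals of γ^(2-n) over {p > ε}. For y ≠ 0 the singularity lies on the branch
sphere ‖x‖ = ‖y‖, ⟪x, y⟫ = 0, of codimension two, where |γ|² is comparable to the distance; γ^(2-n)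
is thus not locally integrable for large n, and the limit rests on cancellation.

The cancellation comes from the field V = Re(1/γ) y + Im(1/γ) x, which is tangent to the level sets
of p: along it γ has the purely imaginary derivative i(‖y‖² - q²)/|γ|² (`gam_deriv_along_tangent`).
Integration by parts along V therefore produces no boundary term on the cut p = ε. Since ‖y‖² - q² =
(‖y‖² + p²) - 2pγ + γ², the lowest power of γ carries the nonvanishing factor ‖y‖² + p²; dividing by
it expresses an integral through others with higher powers of γ, at the cost of one derivative of
the test function (`integral_weighted_reduce`). Iteration ends at |γ|⁻³, which is locally integrable
uniformly over unit y (`exists_integrableOn_norm_gam`), and dominated convergence applies. This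
yields the limit together with a bound by finitely many derivatives
(`exists_limit_potentialPairing`), hence a distribution. The case y = 0 is elementary, and scaling
reduces the other y to ‖y‖ = 1 (`potentialPairing_smul`).

For y → 0, put a = ‖y‖ and rescale: the source at y acts on f as the source at the unit vector y/a
acts on f(a x). As γ^(2-n) is harmonic off the branch cut, only the values on ‖x‖ < 2 matter
(`tendsto_potentialPairing_lap_congr`). There f(a x) is f(0) times a cutoff plus a remainder of size
O(a) in every C^N norm. The cutoff pairs to 1: its pairing is unchanged under y ↦ a y and tends to
the flux of the real Newtonian potential (`tendsto_potentialPairing_cutoff`). Hence the value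
differs from f(0) by O(‖y‖) (`exists_limit_lap_near`). -/

open scoped ContDiff InnerProductSpace

/-! ### Vanishing integrals of divergences of compactly supported fields. -/

section Divergence

variable {E : Type*} [NormedAddCommGroup E] [InnerProductSpace ℝ E] [FiniteDimensional ℝ E]
  [MeasurableSpace E] [BorelSpace E]

lemma integral_fderiv_apply_eq_zero {F : E → ℂ} (hF : ContDiff ℝ 1 F) (hc : HasCompactSupport F)
    (v : E) : ∫ x, fderiv ℝ F x v = 0 := by
  have hd : Continuous fun x => fderiv ℝ F x v :=
    (hF.continuous_fderiv one_ne_zero).clm_apply continuous_const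
  have hdc : HasCompactSupport fun x => fderiv ℝ F x v := hc.fderiv_apply ℝ v
  have h := integral_mul_fderiv_eq_neg_fderiv_mul_of_integrable (μ := (volume : Measure E))
    (f := fun _ => (1 : ℂ)) (g := F) (v := v) (by simp)
    (by simpa using hd.integrable_of_hasCompactSupport hdc)
    (by simpa using hF.continuous.integrable_of_hasCompactSupport hc)
    (fun x _ => differentiableAt_const _)
    (fun x _ => (hF.differentiable one_ne_zero).differentiableAt)
  simpa using h

/-- The integrand is the divergence of the field F(x) x; an orthonormal basis splits it into
directional derivatives of the functions ⟪b i, x⟫ F. -/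
lemma integral_fderiv_self_add_eq_zero {F : E → ℂ} (hF : ContDiff ℝ 1 F)
    (hc : HasCompactSupport F) :
    ∫ x, (fderiv ℝ F x x + (Module.finrank ℝ E : ℂ) * F x) = 0 := by
  set b := stdOrthonormalBasis ℝ E
  have hG : ∀ i, ContDiff ℝ 1 fun x => ((⟪b i, x⟫_ℝ : ℝ) : ℂ) * F x := fun i =>
    (Complex.ofRealCLM.contDiff.comp (contDiff_const.inner ℝ contDiff_id)).mul hF
  have hGc : ∀ i, HasCompactSupport fun x => ((⟪b i, x⟫_ℝ : ℝ) : ℂ) * F x := fun i =>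
    hc.mul_left
  have hder : ∀ i x, fderiv ℝ (fun x => ((⟪b i, x⟫_ℝ : ℝ) : ℂ) * F x) x (b i) =
      F x + ((⟪b i, x⟫_ℝ : ℝ) : ℂ) * fderiv ℝ F x (b i) := by
    intro i x
    have h1 : HasFDerivAt (fun x : E => ((⟪b i, x⟫_ℝ : ℝ) : ℂ))
        (Complex.ofRealCLM.comp (innerSL ℝ (b i))) x :=
      (Complex.ofRealCLM.comp (innerSL ℝ (b i))).hasFDerivAt
    have h2 := (h1.mul (hF.differentiable one_ne_zero x).hasFDerivAt).fderiv
    refine (congrArg (fun L => L (b i)) h2).trans ?_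
    simp [add_comm]
  have hsum : ∀ x, fderiv ℝ F x x + (Module.finrank ℝ E : ℂ) * F x =
      ∑ i, fderiv ℝ (fun x => ((⟪b i, x⟫_ℝ : ℝ) : ℂ) * F x) x (b i) := by
    intro x
    simp only [hder, Finset.sum_add_distrib, Finset.sum_const, Finset.card_univ, Fintype.card_fin,
      nsmul_eq_mul]
    rw [add_comm]
    congr 1
    conv_lhs => rw [← b.sum_repr' x]
    rw [map_sum]
    refine Finset.sum_congr rfl fun i _ => ?_
    conv_lhs => rw [b.sum_repr' x]
    rw [map_smul]
    simp
  simp only [hsum]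
  rw [integral_finsetSum]
  · exact Finset.sum_eq_zero fun i _ => integral_fderiv_apply_eq_zero (hG i) (hGc i) _
  · intro i _
    exact (((hG i).continuous_fderiv one_ne_zero).clm_apply
      continuous_const).integrable_of_hasCompactSupport ((hGc i).fderiv_apply ℝ _)

end Divergence

/-! ### Test functions on a fixed ball and quantitative bounds on their derivatives. -/

section TestFunctions

variable {E : Type*} [NormedAddCommGroup E] [NormedSpace ℝ E]

/-- Smooth functions that vanish outside the closed ball of radius `R` about the origin. -/
structure IsTestOn (R : ℝ) (f : E → ℂ) : Prop where
  contDiff : ContDiff ℝ ∞ f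
  eq_zero : ∀ x, R < ‖x‖ → f x = 0

/-- The derivatives of `f` up to order `N` are bounded by `M` on the closed ball of radius `R`. -/
def DerivBound (N : ℕ) (R M : ℝ) (f : E → ℂ) : Prop :=
  ∀ j ≤ N, ∀ x, ‖x‖ ≤ R → ‖iteratedFDeriv ℝ j f x‖ ≤ M

/-- The derivative in the direction `v`. -/
noncomputable def dirDeriv (v : E) (f : E → ℂ) (x : E) : ℂ := fderiv ℝ f x v

/-- The derivative along the Euler field. -/
noncomputable def radialDeriv (f : E → ℂ) (x : E) : ℂ := fderiv ℝ f x x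

lemma IsTestOn.tsupport_subset {R : ℝ} {f : E → ℂ} (hf : IsTestOn R f) :
    tsupport f ⊆ Metric.closedBall 0 R := by
  refine closure_minimal (fun x hx => ?_) Metric.isClosed_closedBall
  by_contra h
  exact hx (hf.eq_zero x (by simpa using h))

lemma IsTestOn.hasCompactSupport [ProperSpace E] {R : ℝ} {f : E → ℂ} (hf : IsTestOn R f) :
    HasCompactSupport f :=
  (isCompact_closedBall (0 : E) R).of_isClosed_subset (isClosed_tsupport f) hf.tsupport_subset

lemma IsTestOn.fderiv_eq_zero {R : ℝ} {f : E → ℂ} (hf : IsTestOn R f) {x : E} (hx : R < ‖x‖) :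
    fderiv ℝ f x = 0 := by
  have : f =ᶠ[𝓝 x] fun _ => 0 := by
    filter_upwards [(isOpen_lt continuous_const continuous_norm).mem_nhds hx] with z hz
    exact hf.eq_zero z hz
  rw [this.fderiv_eq]; simp

lemma IsTestOn.dirDeriv {R : ℝ} {f : E → ℂ} (hf : IsTestOn R f) (v : E) :
    IsTestOn R (dirDeriv v f) :=
  ⟨(hf.contDiff.fderiv_right (m := ∞) (by simp)).clm_apply contDiff_const,
    fun x hx => by simp [_root_.dirDeriv, hf.fderiv_eq_zero hx]⟩

lemma IsTestOn.radialDeriv {R : ℝ} {f : E → ℂ} (hf : IsTestOn R f) :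
    IsTestOn R (radialDeriv f) :=
  ⟨(hf.contDiff.fderiv_right (m := ∞) (by simp)).clm_apply contDiff_id,
    fun x hx => by simp [_root_.radialDeriv, hf.fderiv_eq_zero hx]⟩

lemma IsTestOn.add {R : ℝ} {f g : E → ℂ} (hf : IsTestOn R f) (hg : IsTestOn R g) :
    IsTestOn R (fun x => f x + g x) :=
  ⟨hf.contDiff.add hg.contDiff, fun x hx => by simp [hf.eq_zero x hx, hg.eq_zero x hx]⟩

lemma IsTestOn.mul_left {R : ℝ} {f g : E → ℂ} (hf : IsTestOn R f) (hg : ContDiff ℝ ∞ g) :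
    IsTestOn R (fun x => g x * f x) :=
  ⟨hg.mul hf.contDiff, fun x hx => by simp [hf.eq_zero x hx]⟩

lemma IsTestOn.const_mul {R : ℝ} {f : E → ℂ} (hf : IsTestOn R f) (c : ℂ) :
    IsTestOn R (fun x => c * f x) :=
  hf.mul_left contDiff_const

lemma IsTestOn.sum {ι : Type*} (s : Finset ι) {R : ℝ} {f : ι → E → ℂ}
    (hf : ∀ i, IsTestOn R (f i)) : IsTestOn R (fun x => ∑ i ∈ s, f i x) :=
  ⟨ContDiff.sum fun i _ => (hf i).contDiff, fun x hx =>
    Finset.sum_eq_zero fun i _ => (hf i).eq_zero x hx⟩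

lemma IsTestOn.mono {R R' : ℝ} {f : E → ℂ} (hf : IsTestOn R f) (h : R ≤ R') : IsTestOn R' f :=
  ⟨hf.contDiff, fun x hx => hf.eq_zero x (h.trans_lt hx)⟩

lemma DerivBound.mono {N N' : ℕ} {R R' M M' : ℝ} {f : E → ℂ} (h : DerivBound N R M f)
    (hN : N' ≤ N) (hR : R' ≤ R) (hM : M ≤ M') : DerivBound N' R' M' f :=
  fun j hj x hx => (h j (hj.trans hN) x (hx.trans hR)).trans hM

lemma DerivBound.nonneg {N : ℕ} {R M : ℝ} {f : E → ℂ} (h : DerivBound N R M f) (hR : 0 ≤ R) :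
    0 ≤ M :=
  (norm_nonneg _).trans (h 0 (Nat.zero_le _) 0 (by simpa using hR))

lemma DerivBound.norm_le {N : ℕ} {R M : ℝ} {f : E → ℂ} (h : DerivBound N R M f) {x : E}
    (hx : ‖x‖ ≤ R) : ‖f x‖ ≤ M := by
  simpa using h 0 (Nat.zero_le _) x hx

lemma DerivBound.add {N : ℕ} {R M M' : ℝ} {f g : E → ℂ} (hf : DerivBound N R M f)
    (hg : DerivBound N R M' g) (hfs : ContDiff ℝ ∞ f) (hgs : ContDiff ℝ ∞ g) :
    DerivBound N R (M + M') (fun x => f x + g x) := by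
  intro j hj x hx
  have := iteratedFDeriv_add_apply (𝕜 := ℝ) (i := j) (x := x)
    ((hfs.of_le (mod_cast le_top)).contDiffAt) ((hgs.of_le (mod_cast le_top)).contDiffAt)
  change ‖iteratedFDeriv ℝ j (f + g) x‖ ≤ _
  rw [this]
  exact (norm_add_le _ _).trans (add_le_add (hf j hj x hx) (hg j hj x hx))

lemma DerivBound.const_mul {N : ℕ} {R M : ℝ} {f : E → ℂ} (hf : DerivBound N R M f)
    (hfs : ContDiff ℝ ∞ f) (c : ℂ) : DerivBound N R (‖c‖ * M) (fun x => c * f x) := by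
  intro j hj x hx
  have := iteratedFDeriv_const_smul_apply' (𝕜 := ℝ) (i := j) (x := x) (a := c) (f := f)
    ((hfs.of_le (mod_cast le_top)).contDiffAt)
  simp only [smul_eq_mul] at this
  rw [this, norm_smul]
  exact mul_le_mul_of_nonneg_left (hf j hj x hx) (norm_nonneg _)

lemma DerivBound.sum {ι : Type*} (s : Finset ι) {N : ℕ} {R M : ℝ} {f : ι → E → ℂ}
    (hf : ∀ i, DerivBound N R M (f i)) (hfs : ∀ i, ContDiff ℝ ∞ (f i)) :
    DerivBound N R (s.card * M) (fun x => ∑ i ∈ s, f i x) := by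
  classical
  induction s using Finset.induction_on with
  | empty =>
    intro j hj x hx
    simp only [Finset.sum_empty, Finset.card_empty, Nat.cast_zero, zero_mul]
    have : iteratedFDeriv ℝ j (fun _ : E => (0 : ℂ)) = 0 := iteratedFDeriv_fun_zero
    rw [this]; simp
  | insert i s hi ih =>
    simp only [Finset.sum_insert hi, Finset.card_insert_of_notMem hi, Nat.cast_succ, add_mul,
      one_mul]
    rw [add_comm]
    exact (hf i).add ih (hfs i) (ContDiff.sum fun i _ => hfs i)

lemma DerivBound.dirDeriv {N : ℕ} {R M : ℝ} {f : E → ℂ} (hf : DerivBound (N + 1) R M f)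
    (hfs : ContDiff ℝ ∞ f) (v : E) : DerivBound N R (‖v‖ * M) (dirDeriv v f) := by
  intro j hj x hx
  refine (norm_iteratedFDeriv_clm_apply_const (N := ∞)
    (hfs.fderiv_right (m := ∞) (by simp)).contDiffAt (mod_cast le_top)).trans ?_
  rw [norm_iteratedFDeriv_fderiv]
  exact mul_le_mul_of_nonneg_left (hf _ (by omega) x hx) (norm_nonneg _)

lemma norm_iteratedFDeriv_id_le (j : ℕ) (x : E) :
    ‖iteratedFDeriv ℝ j (fun z : E => z) x‖ ≤ ‖x‖ + 1 := by
  rcases j with _ | j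
  · simp
  · rw [← norm_iteratedFDeriv_fderiv]
    have : fderiv ℝ (fun z : E => z) = fun _ => ContinuousLinearMap.id ℝ E := by
      ext1 z; exact fderiv_fun_id
    rw [this]
    rcases j with _ | j
    · simp only [norm_iteratedFDeriv_zero]
      exact ContinuousLinearMap.norm_id_le.trans (by linarith [norm_nonneg x])
    · rw [iteratedFDeriv_const_of_ne (by omega)]
      simp only [Pi.zero_apply, norm_zero]
      positivity

lemma DerivBound.radialDeriv {N : ℕ} {R M : ℝ} {f : E → ℂ} (hf : DerivBound (N + 1) R M f)
    (hfs : ContDiff ℝ ∞ f) (hR : 0 ≤ R) :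
    DerivBound N R (2 ^ N * (R + 1) * M) (radialDeriv f) := by
  intro j hj x hx
  have hM := hf.nonneg hR
  refine (norm_iteratedFDeriv_clm_apply (N := ∞)
    (hfs.fderiv_right (m := ∞) (by simp)) contDiff_id x (mod_cast le_top)).trans ?_
  -- Leibniz rule: the binomial coefficients sum to 2 ^ j, and R + 1 bounds the identity and all its
  -- derivatives on the ball.
  calc _ ≤ ∑ i ∈ Finset.range (j + 1), (j.choose i : ℝ) * M * (R + 1) := by
        refine Finset.sum_le_sum fun i hi => ?_
        rw [norm_iteratedFDeriv_fderiv]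
        have hi' : i < j + 1 := Finset.mem_range.1 hi
        have h1 := hf (i + 1) (by omega) x hx
        have h2 : ‖iteratedFDeriv ℝ (j - i) (id : E → E) x‖ ≤ R + 1 :=
          (norm_iteratedFDeriv_id_le (j - i) x).trans (by linarith)
        gcongr
    _ = 2 ^ j * (R + 1) * M := by
        rw [← Finset.sum_mul, ← Finset.sum_mul, ← Nat.cast_sum, Nat.sum_range_choose]
        push_cast; ring
    _ ≤ _ := by
        gcongr
        norm_num

lemma DerivBound.mul {N : ℕ} {R M M' : ℝ} {f g : E → ℂ} (hf : DerivBound N R M f)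
    (hg : DerivBound N R M' g) (hfs : ContDiff ℝ ∞ f) (hgs : ContDiff ℝ ∞ g) (hR : 0 ≤ R) :
    DerivBound N R (2 ^ N * (M * M')) (fun x => f x * g x) := by
  intro j hj x hx
  have hM := hf.nonneg hR
  have hM' := hg.nonneg hR
  refine (norm_iteratedFDeriv_mul_le (N := ∞) hfs hgs x (mod_cast le_top)).trans ?_
  calc _ ≤ ∑ i ∈ Finset.range (j + 1), (j.choose i : ℝ) * M * M' := by
        refine Finset.sum_le_sum fun i hi => ?_
        have hi' : i < j + 1 := Finset.mem_range.1 hi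
        have h1 := hf i (by omega) x hx
        have h2 := hg (j - i) (by omega) x hx
        gcongr
    _ = 2 ^ j * (M * M') := by
        rw [← Finset.sum_mul, ← Finset.sum_mul, ← Nat.cast_sum, Nat.sum_range_choose]
        push_cast; ring
    _ ≤ _ := by
        gcongr
        norm_num

lemma exists_derivBound [ProperSpace E] {f : E → ℂ} (hf : ContDiff ℝ ∞ f) (N : ℕ) (R : ℝ) :
    ∃ M, 0 ≤ M ∧ DerivBound N R M f := by
  have h : ∀ j : ℕ, ∃ M, ∀ x, ‖x‖ ≤ R → ‖iteratedFDeriv ℝ j f x‖ ≤ M := by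
    intro j
    obtain ⟨M, hM⟩ := (isCompact_closedBall (0 : E) R).exists_bound_of_continuousOn
      (f := iteratedFDeriv ℝ j f)
      (hf.continuous_iteratedFDeriv (m := j) (mod_cast le_top)).continuousOn
    exact ⟨M, fun x hx => hM x (by simpa using hx)⟩
  choose M hM using h
  refine ⟨∑ j ∈ Finset.range (N + 1), |M j|, Finset.sum_nonneg fun _ _ => abs_nonneg _,
    fun j hj x hx => (hM j x hx).trans ((le_abs_self _).trans ?_)⟩
  exact Finset.single_le_sum (f := fun j => |M j|) (fun _ _ => abs_nonneg _)
    (Finset.mem_range.2 (by omega))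

end TestFunctions

/-! ### The complex length as a function of x: real and imaginary parts, regularity, gradient. -/

section ComplexLength

variable {n : ℕ}

/-- The complex length of `x + iy`, as a function of `x`. -/
noncomputable def gam (y x : EuclideanSpace ℝ (Fin n)) : ℂ := complexLength (complexPoint x y)

/-- The square `‖x‖² - ‖y‖² + 2i⟪x, y⟫` of the complex length of `x + iy`. -/
noncomputable def gamSq (y x : EuclideanSpace ℝ (Fin n)) : ℂ :=
  ((‖x‖ ^ 2 - ‖y‖ ^ 2 : ℝ) : ℂ) + ((2 * ⟪x, y⟫_ℝ : ℝ) : ℂ) * Complex.I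

lemma sum_complexPoint_sq (y x : EuclideanSpace ℝ (Fin n)) :
    ∑ i, complexPoint x y i ^ 2 = gamSq y x := by
  have h1 : ∀ z : EuclideanSpace ℝ (Fin n), ‖z‖ ^ 2 = ∑ i, z i ^ 2 := fun z => by
    rw [EuclideanSpace.norm_sq_eq]; simp
  have h2 : ⟪x, y⟫_ℝ = ∑ i, x i * y i := by
    rw [PiLp.inner_apply]; simp [mul_comm]
  rw [gamSq, h1, h1, h2]
  push_cast
  rw [← Finset.sum_sub_distrib, Finset.mul_sum, Finset.sum_mul, ← Finset.sum_add_distrib]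
  refine Finset.sum_congr rfl fun i _ => ?_
  simp only [complexPoint]
  linear_combination ((y i : ℂ) ^ 2) * Complex.I_sq

lemma gam_sq (y x : EuclideanSpace ℝ (Fin n)) : gam y x ^ 2 = gamSq y x := by
  rw [gam, complexLength_sq, sum_complexPoint_sq]

lemma gam_eq_cpow (y x : EuclideanSpace ℝ (Fin n)) : gam y x = gamSq y x ^ (1 / 2 : ℂ) := by
  rw [gam, complexLength, sum_complexPoint_sq]

lemma gam_re_nonneg (y x : EuclideanSpace ℝ (Fin n)) : 0 ≤ (gam y x).re :=
  complexLength_re_nonneg _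

lemma gamSq_re (y x : EuclideanSpace ℝ (Fin n)) : (gamSq y x).re = ‖x‖ ^ 2 - ‖y‖ ^ 2 := by
  simp [gamSq, -Complex.ofReal_pow]

lemma gamSq_im (y x : EuclideanSpace ℝ (Fin n)) : (gamSq y x).im = 2 * ⟪x, y⟫_ℝ := by
  simp [gamSq, -Complex.ofReal_pow]

lemma gam_re_sq_sub_im_sq (y x : EuclideanSpace ℝ (Fin n)) :
    (gam y x).re ^ 2 - (gam y x).im ^ 2 = ‖x‖ ^ 2 - ‖y‖ ^ 2 := by
  rw [← gamSq_re, ← gam_sq, pow_two (gam y x), Complex.mul_re]; ring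

lemma gam_re_mul_im (y x : EuclideanSpace ℝ (Fin n)) :
    (gam y x).re * (gam y x).im = ⟪x, y⟫_ℝ := by
  have h := gamSq_im y x
  rw [← gam_sq, pow_two (gam y x), Complex.mul_im] at h
  linarith

lemma continuous_gamSq (y : EuclideanSpace ℝ (Fin n)) : Continuous (gamSq y) := by
  unfold gamSq; fun_prop

lemma norm_gam_sq (y x : EuclideanSpace ℝ (Fin n)) : ‖gam y x‖ ^ 2 = ‖gamSq y x‖ := by
  rw [← gam_sq, norm_pow]

lemma norm_gam_sq_eq (y x : EuclideanSpace ℝ (Fin n)) :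
    ‖gam y x‖ ^ 2 = (gam y x).re ^ 2 + (gam y x).im ^ 2 := by
  rw [← Complex.normSq_eq_norm_sq, Complex.normSq_apply]; ring

/-- Across the disc ‖x‖ < ‖y‖, ⟪x, y⟫ = 0 the imaginary part of γ changes sign, but p² = (|γ²| + Re
γ²)/2 is continuous and p ≥ 0. -/
lemma continuous_gam_re (y : EuclideanSpace ℝ (Fin n)) : Continuous fun x => (gam y x).re := by
  have h : (fun x => (gam y x).re) =
      fun x => √((‖gamSq y x‖ + (gamSq y x).re) / 2) := by
    ext x
    have h1 : (‖gamSq y x‖ + (gamSq y x).re) / 2 = (gam y x).re ^ 2 := by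
      rw [← norm_gam_sq, norm_gam_sq_eq, gamSq_re, ← gam_re_sq_sub_im_sq]; ring
    rw [h1, Real.sqrt_sq (gam_re_nonneg y x)]
  rw [h]
  exact (((continuous_gamSq y).norm.add (Complex.continuous_re.comp (continuous_gamSq y))).div_const
    2).sqrt

lemma norm_gamSq_sq (y x : EuclideanSpace ℝ (Fin n)) :
    ‖gamSq y x‖ ^ 2 = (‖x‖ ^ 2 - ‖y‖ ^ 2) ^ 2 + 4 * ⟪x, y⟫_ℝ ^ 2 := by
  rw [← Complex.normSq_eq_norm_sq, Complex.normSq_apply, gamSq_re, gamSq_im]; ring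

lemma norm_gam_le (y x : EuclideanSpace ℝ (Fin n)) : ‖gam y x‖ ≤ ‖x‖ + ‖y‖ := by
  refine abs_le_of_sq_le_sq' ?_ (by positivity) |>.2
  refine (abs_le_of_sq_le_sq' ?_ (by positivity)).2
  rw [norm_gam_sq, norm_gamSq_sq]
  have h := abs_real_inner_le_norm x y
  have h2 : ⟪x, y⟫_ℝ ^ 2 ≤ (‖x‖ * ‖y‖) ^ 2 := by
    rw [← sq_abs]; gcongr
  nlinarith [mul_nonneg (mul_nonneg (norm_nonneg x) (norm_nonneg y)) (sq_nonneg (‖x‖ - ‖y‖)),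
    mul_nonneg (mul_nonneg (norm_nonneg x) (norm_nonneg y)) (sq_nonneg (‖x‖ + ‖y‖)),
    sq_nonneg (‖x‖ * ‖y‖)]

lemma measurable_gam (y : EuclideanSpace ℝ (Fin n)) : Measurable (gam y) := by
  have : gam y = fun x => gamSq y x ^ (1 / 2 : ℂ) := funext (gam_eq_cpow y)
  rw [this]
  exact (continuous_gamSq y).measurable.pow_const _

/-- With p > 0 the square p² - q² + 2ipq is real only if q = 0, and then it is positive. -/
lemma gamSq_mem_slitPlane {y x : EuclideanSpace ℝ (Fin n)} (h : 0 < (gam y x).re) :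
    gamSq y x ∈ Complex.slitPlane := by
  rw [← gam_sq, Complex.mem_slitPlane_iff, pow_two, Complex.mul_re, Complex.mul_im]
  by_cases hq : (gam y x).im = 0
  · left; rw [hq]; nlinarith
  · right
    have : (gam y x).re * (gam y x).im ≠ 0 := mul_ne_zero h.ne' hq
    contrapose! this
    linarith

lemma gam_ne_zero {y x : EuclideanSpace ℝ (Fin n)} (h : 0 < (gam y x).re) : gam y x ≠ 0 := by
  intro h0; rw [h0] at h; simp at h

lemma gam_re_le_norm (y x : EuclideanSpace ℝ (Fin n)) : (gam y x).re ≤ ‖gam y x‖ :=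
  Complex.re_le_norm _

/-- The inner product `⟪x + iy, v⟫`. -/
noncomputable def cinner (y x v : EuclideanSpace ℝ (Fin n)) : ℂ :=
  (⟪x, v⟫_ℝ : ℂ) + (⟪y, v⟫_ℝ : ℂ) * Complex.I

/-- Differentiating γ² = z·z, z = x + iy, gives the complex gradient z/γ. -/
lemma hasLineDerivAt_gam {y x : EuclideanSpace ℝ (Fin n)} (h : 0 < (gam y x).re)
    (v : EuclideanSpace ℝ (Fin n)) :
    HasDerivAt (fun t : ℝ => gam y (x + t • v)) (cinner y x v / gam y x) 0 := by
  have hw : HasDerivAt (fun t : ℝ => gamSq y (x + t • v)) (2 * cinner y x v) 0 := by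
    have h1 : ∀ t : ℝ, gamSq y (x + t • v) = gamSq y x + (t : ℂ) * (2 * cinner y x v) +
        (t : ℂ) ^ 2 * ((‖v‖ ^ 2 : ℝ) : ℂ) := by
      intro t
      have e1 : ‖x + t • v‖ ^ 2 = ‖x‖ ^ 2 + 2 * t * ⟪x, v⟫_ℝ + t ^ 2 * ‖v‖ ^ 2 := by
        rw [norm_add_sq_real, inner_smul_right, norm_smul, mul_pow, Real.norm_eq_abs, sq_abs]; ring
      have e2 : ⟪x + t • v, y⟫_ℝ = ⟪x, y⟫_ℝ + t * ⟪y, v⟫_ℝ := by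
        rw [inner_add_left, inner_smul_left, real_inner_comm v y]; simp
      simp only [gamSq, cinner, e1, e2]
      push_cast; ring
    have h2 : HasDerivAt (fun t : ℝ => (t : ℂ)) 1 0 := Complex.ofRealCLM.hasDerivAt
    have h3 := ((h2.mul_const (2 * cinner y x v)).const_add (gamSq y x)).add
      ((h2.pow 2).mul_const ((‖v‖ ^ 2 : ℝ) : ℂ))
    refine (h3.congr_of_eventuallyEq (Eventually.of_forall fun t => ?_)).congr_deriv ?_
    · rw [h1]; simp
    · simp
  have hs : gamSq y (x + (0 : ℝ) • v) ∈ Complex.slitPlane := by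
    simpa using gamSq_mem_slitPlane h
  have h1 : HasDerivAt (fun w : ℂ => w ^ (1 / 2 : ℂ))
      ((1 / 2 : ℂ) * gamSq y (x + (0 : ℝ) • v) ^ ((1 / 2 : ℂ) - 1) * 1)
      (gamSq y (x + (0 : ℝ) • v)) :=
    (hasDerivAt_id _).cpow_const hs
  have h2 := HasDerivAt.scomp (𝕜 := ℝ) (0 : ℝ) h1 hw
  have hg := gam_ne_zero h
  refine (h2.congr_of_eventuallyEq (Eventually.of_forall fun t => gam_eq_cpow y _)).congr_deriv ?_
  have hw0 : gamSq y x ≠ 0 := by rw [← gam_sq]; exact pow_ne_zero _ hg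
  rw [zero_smul, add_zero, Complex.cpow_sub _ _ hw0, ← gam_eq_cpow, Complex.cpow_one, ← gam_sq,
    smul_eq_mul]
  field_simp

lemma contDiffAt_gam {y x : EuclideanSpace ℝ (Fin n)} (h : 0 < (gam y x).re) :
    ContDiffAt ℝ ∞ (gam y) x := by
  have hs := gamSq_mem_slitPlane h
  have hw : ContDiff ℝ ∞ (gamSq y) := by
    unfold gamSq
    refine (Complex.ofRealCLM.contDiff.comp ((contDiff_norm_sq ℝ).sub contDiff_const)).add
      ((Complex.ofRealCLM.contDiff.comp (contDiff_const.mul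
        (contDiff_id.inner ℝ contDiff_const))).mul contDiff_const)
  have hl : ContDiffAt ℝ ∞ (fun x => Complex.log (gamSq y x)) x :=
    ((Complex.contDiffAt_log hs (n := ∞)).restrict_scalars ℝ).comp x hw.contDiffAt
  have he : ContDiffAt ℝ ∞ (fun x => Complex.exp (Complex.log (gamSq y x) * (1 / 2))) x :=
    (hl.mul contDiffAt_const).cexp
  refine he.congr_of_eventuallyEq ?_
  filter_upwards [(continuous_gamSq y).continuousAt.eventually
    (Complex.isOpen_slitPlane.mem_nhds hs)] with z hz
  rw [gam_eq_cpow, Complex.cpow_def_of_ne_zero (Complex.slitPlane_ne_zero hz)]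

end ComplexLength

/-! ### Integration by parts along a field tangent to the level sets of Re γ. -/

section TangentField

variable {n : ℕ}

lemma fderiv_apply_eq_of_hasDerivAt {E : Type*} [NormedAddCommGroup E] [NormedSpace ℝ E]
    {F : E → ℂ} {x v : E} {d : ℂ} (hF : DifferentiableAt ℝ F x)
    (h : HasDerivAt (fun t : ℝ => F (x + t • v)) d 0) : fderiv ℝ F x v = d :=
  (hF.hasFDerivAt.hasLineDerivAt v).unique h

lemma hasDerivAt_comp_line {E : Type*} [NormedAddCommGroup E] [NormedSpace ℝ E]
    {F : E → ℂ} {x : E} (hF : DifferentiableAt ℝ F x) (v : E) :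
    HasDerivAt (fun t : ℝ => F (x + t • v)) (fderiv ℝ F x v) 0 :=
  hF.hasFDerivAt.hasLineDerivAt v

lemma contDiff_of_eq_zero_near_branch {y : EuclideanSpace ℝ (Fin n)}
    {F : EuclideanSpace ℝ (Fin n) → ℂ} {δ : ℝ} (hδ : 0 < δ)
    (h : ∀ x, 0 < (gam y x).re → ContDiffAt ℝ ∞ F x) (h0 : ∀ x, (gam y x).re < δ → F x = 0) :
    ContDiff ℝ ∞ F := by
  rw [contDiff_iff_contDiffAt]
  intro x
  by_cases hx : 0 < (gam y x).re
  · exact h x hx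
  · have : F =ᶠ[𝓝 x] fun _ => 0 := by
      filter_upwards [(isOpen_lt (continuous_gam_re y) continuous_const).mem_nhds
        (show (gam y x).re < δ by linarith)] with z hz
      exact h0 z hz
    exact contDiffAt_const.congr_of_eventuallyEq this

lemma contDiffAt_gam_zpow {y x : EuclideanSpace ℝ (Fin n)} (h : 0 < (gam y x).re) (m : ℤ) :
    ContDiffAt ℝ ∞ (fun x => gam y x ^ m) x := by
  have hg := contDiffAt_gam h
  have h0 := gam_ne_zero h
  cases m with
  | ofNat k => simpa using hg.pow k
  | negSucc k =>
    simp only [zpow_negSucc]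
    exact (hg.pow (k + 1)).inv (pow_ne_zero _ h0)

lemma hasDerivAt_gam_zpow {y x : EuclideanSpace ℝ (Fin n)} (h : 0 < (gam y x).re) (m : ℤ)
    (v : EuclideanSpace ℝ (Fin n)) :
    HasDerivAt (fun t : ℝ => gam y (x + t • v) ^ m)
      (m * gam y x ^ (m - 1) * (cinner y x v / gam y x)) 0 := by
  have h0 := gam_ne_zero h
  have h1 : HasDerivAt (fun w : ℂ => w ^ m) (m * gam y (x + (0 : ℝ) • v) ^ (m - 1))
      (gam y (x + (0 : ℝ) • v)) := hasDerivAt_zpow m _ (Or.inl (by simpa using h0))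
  have h2 := HasDerivAt.scomp (𝕜 := ℝ) (0 : ℝ) h1 (hasLineDerivAt_gam h v)
  refine h2.congr_deriv ?_
  simp only [zero_smul, add_zero, smul_eq_mul]
  ring

/-- A cutoff power of the complex length times a test function. -/
noncomputable def cutPower (c : ℝ → ℂ) (m : ℤ) (u : EuclideanSpace ℝ (Fin n) → ℂ)
    (y x : EuclideanSpace ℝ (Fin n)) : ℂ :=
  c (gam y x).re * gam y x ^ m * u x

lemma contDiffAt_cutPower {c : ℝ → ℂ} (hc : ContDiff ℝ ∞ c) (m : ℤ)
    {u : EuclideanSpace ℝ (Fin n) → ℂ} (hu : ContDiff ℝ ∞ u)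
    {y x : EuclideanSpace ℝ (Fin n)} (h : 0 < (gam y x).re) :
    ContDiffAt ℝ ∞ (cutPower c m u y) x :=
  ((hc.contDiffAt.comp x (Complex.reCLM.contDiff.contDiffAt.comp x (contDiffAt_gam h))).mul
    (contDiffAt_gam_zpow h m)).mul hu.contDiffAt

lemma hasDerivAt_cutPower {c : ℝ → ℂ} (hc : ContDiff ℝ ∞ c) (m : ℤ)
    {u : EuclideanSpace ℝ (Fin n) → ℂ} (hu : ContDiff ℝ ∞ u)
    {y x : EuclideanSpace ℝ (Fin n)} (h : 0 < (gam y x).re) (v : EuclideanSpace ℝ (Fin n)) :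
    HasDerivAt (fun t : ℝ => cutPower c m u y (x + t • v))
      (((cinner y x v / gam y x).re * deriv c (gam y x).re * gam y x ^ m +
        c (gam y x).re * (m * gam y x ^ (m - 1) * (cinner y x v / gam y x))) * u x +
        c (gam y x).re * gam y x ^ m * dirDeriv v u x) 0 := by
  have h1 : HasDerivAt (fun t : ℝ => (gam y (x + t • v)).re) (cinner y x v / gam y x).re 0 :=
    (Complex.reCLM.hasFDerivAt.comp_hasDerivAt (0 : ℝ) (hasLineDerivAt_gam h v))
  have h2 : HasDerivAt c (deriv c (gam y (x + (0 : ℝ) • v)).re) (gam y (x + (0 : ℝ) • v)).re :=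
    (hc.differentiable (by simp)).differentiableAt.hasDerivAt
  have h3 := HasDerivAt.scomp (0 : ℝ) h2 h1
  have h4 := (h3.mul (hasDerivAt_gam_zpow h m v)).mul
    (hasDerivAt_comp_line (hu.differentiable (by simp) x) v)
  refine h4.congr_deriv ?_
  simp [dirDeriv]

lemma cinner_self_left (y x : EuclideanSpace ℝ (Fin n)) :
    cinner y x y = ((gam y x).re * (gam y x).im : ℝ) + ((‖y‖ ^ 2 : ℝ) : ℂ) * Complex.I := by
  rw [cinner, gam_re_mul_im, real_inner_self_eq_norm_sq]

lemma cinner_self_right (y x : EuclideanSpace ℝ (Fin n)) :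
    cinner y x x = ((gam y x).re ^ 2 - (gam y x).im ^ 2 + ‖y‖ ^ 2 : ℝ) +
      ((gam y x).re * (gam y x).im : ℝ) * Complex.I := by
  rw [cinner, gam_re_mul_im, real_inner_self_eq_norm_sq, gam_re_sq_sub_im_sq,
    real_inner_comm, sub_add_cancel]

lemma inv_gam_re (y x : EuclideanSpace ℝ (Fin n)) :
    ((gam y x)⁻¹).re = (gam y x).re / ‖gam y x‖ ^ 2 := by
  rw [Complex.inv_re, Complex.normSq_eq_norm_sq]

lemma inv_gam_im (y x : EuclideanSpace ℝ (Fin n)) :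
    ((gam y x)⁻¹).im = -(gam y x).im / ‖gam y x‖ ^ 2 := by
  rw [Complex.inv_im, Complex.normSq_eq_norm_sq]

/-- The left side is the derivative of γ along V = Re(1/γ) y + Im(1/γ) x. The products z·y and z·x
are polynomials in p, q and ‖y‖², and in z·V a factor γ comes out and cancels. The result being
purely imaginary, V is tangent to the level sets of p. -/
lemma gam_deriv_along_tangent {y x : EuclideanSpace ℝ (Fin n)} (h : 0 < (gam y x).re) :
    cinner y x y / gam y x * (((gam y x)⁻¹).re : ℂ) + cinner y x x / gam y x *
      (((gam y x)⁻¹).im : ℂ) =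
      ((‖y‖ ^ 2 - (gam y x).im ^ 2) / ‖gam y x‖ ^ 2 : ℝ) * Complex.I := by
  have h0 := gam_ne_zero h
  have hn : (‖gam y x‖ : ℂ) ≠ 0 := by simpa using h0
  rw [cinner_self_left, cinner_self_right, inv_gam_re, inv_gam_im]
  have hg : gam y x = (gam y x).re + (gam y x).im * Complex.I := (Complex.re_add_im _).symm
  generalize (gam y x).re = p at *
  generalize (gam y x).im = q at *
  push_cast
  field_simp
  rw [hg]
  linear_combination ((q : ℂ) ^ 3 - q * (‖y‖ : ℂ) ^ 2) * Complex.I_sq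

lemma gam_deriv_re_along_tangent {y x : EuclideanSpace ℝ (Fin n)} (h : 0 < (gam y x).re) :
    (((cinner y x y / gam y x).re : ℝ) : ℂ) * (((gam y x)⁻¹).re : ℂ) +
      (((cinner y x x / gam y x).re : ℝ) : ℂ) * (((gam y x)⁻¹).im : ℂ) = 0 := by
  have := congrArg Complex.re (gam_deriv_along_tangent h)
  rw [Complex.add_re, Complex.re_mul_ofReal, Complex.re_mul_ofReal, Complex.re_ofReal_mul,
    Complex.I_re, mul_zero] at this
  exact_mod_cast this

/-- This is the imaginary part of an identity that follows from i z·y + z·x = z·z = γ². Together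
with the term n Im(1/γ) coming from div x = n, it says div V = (n - 1) Im(1/γ). -/
lemma divergence_tangent {y x : EuclideanSpace ℝ (Fin n)} (h : 0 < (gam y x).re) :
    (-(cinner y x y / gam y x) / gam y x ^ 2).re + (-(cinner y x x / gam y x) / gam y x ^ 2).im =
      -((gam y x)⁻¹).im := by
  have h0 := gam_ne_zero h
  have h1 : Complex.I * cinner y x y + cinner y x x = gam y x ^ 2 := by
    rw [cinner_self_left, cinner_self_right]
    conv_rhs => rw [← Complex.re_add_im (gam y x)]
    push_cast
    linear_combination ((‖y‖ : ℂ) ^ 2 - (gam y x).im ^ 2) * Complex.I_sq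
  have h2 : Complex.I * (-(cinner y x y / gam y x) / gam y x ^ 2) +
      (-(cinner y x x / gam y x) / gam y x ^ 2) = -(gam y x)⁻¹ := by
    field_simp
    linear_combination -h1
  have h3 := congrArg Complex.im h2
  rw [Complex.add_im, Complex.I_mul_im, Complex.neg_im] at h3
  exact h3

/-- The integrand of the weighted integrals `∫ c(Re γ) γ^m |γ|⁻² u`. -/
noncomputable def weighted (c : ℝ → ℂ) (m : ℤ) (u : EuclideanSpace ℝ (Fin n) → ℂ)
    (y x : EuclideanSpace ℝ (Fin n)) : ℂ :=
  c (gam y x).re * gam y x ^ m * ((‖gam y x‖ ^ 2)⁻¹ : ℝ) * u x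

/-- The first operator in the reduction of the exponent. -/
noncomputable def reduceOne (m : ℤ) (y : EuclideanSpace ℝ (Fin n))
    (u : EuclideanSpace ℝ (Fin n) → ℂ) (x : EuclideanSpace ℝ (Fin n)) : ℂ :=
  (Complex.I * (2 * m + n - 1)) * u x + ((-1) * dirDeriv y u x + Complex.I * radialDeriv u x)

/-- The second operator in the reduction of the exponent. -/
noncomputable def reduceTwo (m : ℤ)
    (u : EuclideanSpace ℝ (Fin n) → ℂ) (x : EuclideanSpace ℝ (Fin n)) : ℂ :=
  (Complex.I * (m + n - 1)) * u x + Complex.I * radialDeriv u x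

/-- The divergence of c(p) γ^m u V. No derivative of c survives, because V is tangent to the level
sets of p. Substituting iq = γ - p leaves only functions of p times powers of γ; the lowest power
γ^(m-1) carries the factor im(‖y‖² + p²), and the higher ones are collected in `reduceOne` and
`reduceTwo`. -/
lemma divergence_cutPower {c : ℝ → ℂ} (hc : ContDiff ℝ ∞ c) (m : ℤ)
    {u : EuclideanSpace ℝ (Fin n) → ℂ} (hu : ContDiff ℝ ∞ u)
    {y x : EuclideanSpace ℝ (Fin n)} (h : 0 < (gam y x).re) :
    fderiv ℝ (fun x => cutPower c m u y x * (((gam y x)⁻¹).re : ℂ)) x y +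
      (fderiv ℝ (fun x => cutPower c m u y x * (((gam y x)⁻¹).im : ℂ)) x x +
        (n : ℂ) * (cutPower c m u y x * (((gam y x)⁻¹).im : ℂ))) =
      Complex.I * m * weighted (fun s => c s * (‖y‖ ^ 2 + s ^ 2)) (m - 1) u y x -
        (weighted (fun s => c s * s) m (reduceOne m y u) y x -
          weighted c (m + 1) (reduceTwo m u) y x) := by
  have h0 := gam_ne_zero h
  have hn : (‖gam y x‖ : ℂ) ≠ 0 := by simpa using h0
  have hH := contDiffAt_cutPower hc m hu h
  have hinv : ContDiffAt ℝ ∞ (fun x => (gam y x)⁻¹) x := (contDiffAt_gam h).inv h0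
  have hre : ContDiffAt ℝ ∞ (fun x => (((gam y x)⁻¹).re : ℂ)) x :=
    (Complex.ofRealCLM.contDiff.comp Complex.reCLM.contDiff).contDiffAt.comp x hinv
  have him : ContDiffAt ℝ ∞ (fun x => (((gam y x)⁻¹).im : ℂ)) x :=
    (Complex.ofRealCLM.contDiff.comp Complex.imCLM.contDiff).contDiffAt.comp x hinv
  have dinv : ∀ v, HasDerivAt (fun t : ℝ => (gam y (x + t • v))⁻¹)
      (-(cinner y x v / gam y x) / gam y x ^ 2) 0 := fun v => by
    have := (hasLineDerivAt_gam h v).fun_inv (by simpa using h0)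
    simpa using this
  have dre : HasDerivAt (fun t : ℝ => (((gam y (x + t • y))⁻¹).re : ℂ))
      (((-(cinner y x y / gam y x) / gam y x ^ 2).re : ℝ) : ℂ) 0 :=
    (Complex.ofRealCLM.comp Complex.reCLM).hasFDerivAt.comp_hasDerivAt (0 : ℝ) (dinv y)
  have dim : HasDerivAt (fun t : ℝ => (((gam y (x + t • x))⁻¹).im : ℂ))
      (((-(cinner y x x / gam y x) / gam y x ^ 2).im : ℝ) : ℂ) 0 :=
    (Complex.ofRealCLM.comp Complex.imCLM).hasFDerivAt.comp_hasDerivAt (0 : ℝ) (dinv x)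
  rw [fderiv_apply_eq_of_hasDerivAt ((hH.mul hre).differentiableAt (by simp))
      ((hasDerivAt_cutPower hc m hu h y).mul dre),
    fderiv_apply_eq_of_hasDerivAt ((hH.mul him).differentiableAt (by simp))
      ((hasDerivAt_cutPower hc m hu h x).mul dim)]
  have e1 := gam_deriv_along_tangent h
  have e2 := gam_deriv_re_along_tangent h
  have e3 : (((-(cinner y x y / gam y x) / gam y x ^ 2).re : ℝ) : ℂ) +
      (((-(cinner y x x / gam y x) / gam y x ^ 2).im : ℝ) : ℂ) = -(((gam y x)⁻¹).im : ℂ) := by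
    exact_mod_cast divergence_tangent h
  simp only [zero_smul, add_zero]
  have e4 : (((gam y x)⁻¹).re : ℂ) = (gam y x).re * ((‖gam y x‖ ^ 2)⁻¹ : ℝ) := by
    rw [inv_gam_re, div_eq_mul_inv]; push_cast; ring
  have e5 : (((gam y x)⁻¹).im : ℂ) = Complex.I * (gam y x - (gam y x).re) *
      ((‖gam y x‖ ^ 2)⁻¹ : ℝ) := by
    have : Complex.I * (gam y x - (gam y x).re) = ((-(gam y x).im : ℝ) : ℂ) := by
      conv_lhs => rw [← Complex.re_add_im (gam y x)]
      push_cast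
      simp only [Complex.add_re, Complex.ofReal_re, Complex.mul_re, Complex.I_re, mul_zero,
        Complex.ofReal_im, Complex.I_im, mul_one, sub_self, add_zero]
      linear_combination ((gam y x).im : ℂ) * Complex.I_sq
    rw [this, inv_gam_im, div_eq_mul_inv]; push_cast; ring
  have e6 : (((‖y‖ ^ 2 - (gam y x).im ^ 2) / ‖gam y x‖ ^ 2 : ℝ) : ℂ) =
      (‖y‖ ^ 2 + ((gam y x).re - gam y x) ^ 2) * ((‖gam y x‖ ^ 2)⁻¹ : ℝ) := by
    have : ((gam y x).re - gam y x) ^ 2 = ((-(gam y x).im ^ 2 : ℝ) : ℂ) := by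
      conv_lhs => rw [← Complex.re_add_im (gam y x)]
      push_cast
      simp only [Complex.add_re, Complex.ofReal_re, Complex.mul_re, Complex.I_re, mul_zero,
        Complex.ofReal_im, Complex.I_im, mul_one, sub_self, add_zero]
      linear_combination ((gam y x).im : ℂ) ^ 2 * Complex.I_sq
    rw [this, div_eq_mul_inv]; push_cast; ring
  have e7 : gam y x ^ m = gam y x ^ (m - 1) * gam y x := by
    rw [← zpow_add_one₀ h0]; simp
  have e8 : gam y x ^ (m + 1) = gam y x ^ (m - 1) * gam y x ^ 2 := by
    rw [zpow_add_one₀ h0, e7]; ring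
  rw [e6] at e1
  simp only [cutPower, weighted, reduceOne, reduceTwo, dirDeriv, radialDeriv]
  rw [e8, e7]
  generalize gam y x ^ (m - 1) = Z at *
  generalize ((gam y x)⁻¹).re = α at *
  generalize ((gam y x)⁻¹).im = β at *
  generalize cinner y x y / gam y x = γ₁ at *
  generalize cinner y x x / gam y x = γ₂ at *
  generalize (-γ₁ / gam y x ^ 2).re = A at *
  generalize (-γ₂ / gam y x ^ 2).im = B at *
  generalize (((‖gam y x‖ ^ 2)⁻¹ : ℝ) : ℂ) = W at *
  generalize (γ₁.re : ℂ) = g1 at *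
  generalize (γ₂.re : ℂ) = g2 at *
  generalize c (gam y x).re = c0 at *
  generalize deriv c (gam y x).re = c1 at *
  generalize ((gam y x).re : ℂ) = p at *
  generalize gam y x = g at *
  generalize u x = u0 at *
  generalize fderiv ℝ u x y = uy at *
  generalize fderiv ℝ u x x = ux at *
  -- `e2` removes the derivative of the cutoff and `e1` differentiates γ^m. The coefficient n - 1 at
  -- `e5` is n from div x minus the 1 supplied by `e3`.
  linear_combination (c1 * Z * g * u0) * e2 + (c0 * m * Z * u0) * e1 + (c0 * Z * g * u0) * e3 +
    (c0 * Z * g * uy) * e4 + (c0 * Z * g * (ux + (n - 1) * u0)) * e5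

lemma integral_weighted_smooth {c : ℝ → ℂ} (hc : ContDiff ℝ ∞ c) {δ : ℝ} (hδ : 0 < δ)
    (hcδ : ∀ s < δ, c s = 0) (m : ℤ) {R : ℝ} {u : EuclideanSpace ℝ (Fin n) → ℂ}
    (hu : IsTestOn R u) (y : EuclideanSpace ℝ (Fin n)) :
    ∫ x, (Complex.I * m * weighted (fun s => c s * (‖y‖ ^ 2 + s ^ 2)) (m - 1) u y x -
        (weighted (fun s => c s * s) m (reduceOne m y u) y x -
          weighted c (m + 1) (reduceTwo m u) y x)) = 0 := by
  have hH0 : ∀ x, (gam y x).re < δ → cutPower c m u y x = 0 := fun x hx => by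
    simp [cutPower, hcδ _ hx]
  have hs1 : ContDiff ℝ ∞ fun x => cutPower c m u y x * (((gam y x)⁻¹).re : ℂ) := by
    refine contDiff_of_eq_zero_near_branch (y := y) hδ (fun x hx => ?_) fun x hx => by
      simp [hH0 x hx]
    exact (contDiffAt_cutPower hc m hu.contDiff hx).mul
      ((Complex.ofRealCLM.contDiff.comp Complex.reCLM.contDiff).contDiffAt.comp x
        ((contDiffAt_gam hx).inv (gam_ne_zero hx)))
  have hs2 : ContDiff ℝ ∞ fun x => cutPower c m u y x * (((gam y x)⁻¹).im : ℂ) := by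
    refine contDiff_of_eq_zero_near_branch (y := y) hδ (fun x hx => ?_) fun x hx => by
      simp [hH0 x hx]
    exact (contDiffAt_cutPower hc m hu.contDiff hx).mul
      ((Complex.ofRealCLM.contDiff.comp Complex.imCLM.contDiff).contDiffAt.comp x
        ((contDiffAt_gam hx).inv (gam_ne_zero hx)))
  have ht1 : IsTestOn R fun x => cutPower c m u y x * (((gam y x)⁻¹).re : ℂ) :=
    ⟨hs1, fun x hx => by simp [cutPower, hu.eq_zero x hx]⟩
  have ht2 : IsTestOn R fun x => cutPower c m u y x * (((gam y x)⁻¹).im : ℂ) :=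
    ⟨hs2, fun x hx => by simp [cutPower, hu.eq_zero x hx]⟩
  have i1 := integral_fderiv_apply_eq_zero (hs1.of_le (by simp)) ht1.hasCompactSupport y
  have i2 := integral_fderiv_self_add_eq_zero (hs2.of_le (by simp)) ht2.hasCompactSupport
  rw [finrank_euclideanSpace_fin] at i2
  have int1 : Integrable fun x =>
      fderiv ℝ (fun x => cutPower c m u y x * (((gam y x)⁻¹).re : ℂ)) x y :=
    (ht1.dirDeriv y).contDiff.continuous.integrable_of_hasCompactSupport
      (ht1.dirDeriv y).hasCompactSupport
  have int2 : Integrable fun x =>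
      fderiv ℝ (fun x => cutPower c m u y x * (((gam y x)⁻¹).im : ℂ)) x x +
        (n : ℂ) * (cutPower c m u y x * (((gam y x)⁻¹).im : ℂ)) :=
    (ht2.radialDeriv.add (ht2.const_mul n)).contDiff.continuous.integrable_of_hasCompactSupport
      (ht2.radialDeriv.add (ht2.const_mul n)).hasCompactSupport
  have hsum := integral_add int1 int2
  rw [i1, i2, add_zero] at hsum
  rw [← hsum]
  refine integral_congr_ae (Eventually.of_forall fun x => ?_)
  by_cases hx : 0 < (gam y x).re
  · exact (divergence_cutPower hc m hu.contDiff hx).symm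
  · have hx' : (gam y x).re < δ := by linarith
    have hz : ∀ F : EuclideanSpace ℝ (Fin n) → ℂ, (∀ z, (gam y z).re < δ → F z = 0) →
        fderiv ℝ F x = 0 := fun F hF => by
      have : F =ᶠ[𝓝 x] fun _ => 0 := by
        filter_upwards [(isOpen_lt (continuous_gam_re y) continuous_const).mem_nhds hx'] with z hz
        exact hF z hz
      rw [this.fderiv_eq]; simp
    dsimp only
    rw [hz _ fun z h => by simp [hH0 z h], hz _ fun z h => by simp [hH0 z h]]
    simp [weighted, hcδ _ hx', hH0 x hx']

end TangentField

/-! ### From smooth cutoffs to the sharp cutoff, and the reduction of the exponent. -/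

section SharpCutoff

variable {n : ℕ}

open scoped Classical in
/-- The function `b` cut off sharply below `ε`. -/
noncomputable def sharpCut (ε : ℝ) (b : ℝ → ℂ) (s : ℝ) : ℂ := if ε < s then b s else 0

lemma measurable_sharpCut {b : ℝ → ℂ} (hb : Continuous b) (ε : ℝ) : Measurable (sharpCut ε b) :=
  Measurable.ite measurableSet_Ioi hb.measurable measurable_const

lemma norm_sharpCut_le (ε : ℝ) (b : ℝ → ℂ) (s : ℝ) : ‖sharpCut ε b s‖ ≤ ‖b s‖ := by
  unfold sharpCut; split_ifs <;> simp

lemma sharpCut_eq_zero {ε s : ℝ} (b : ℝ → ℂ) (h : s ≤ ε) : sharpCut ε b s = 0 := by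
  simp [sharpCut, not_lt.2 h]

lemma measurable_gam_zpow (y : EuclideanSpace ℝ (Fin n)) (m : ℤ) :
    Measurable fun x => gam y x ^ m := by
  cases m with
  | ofNat k => simpa using (measurable_gam y).pow_const k
  | negSucc k =>
    simp only [zpow_negSucc]
    exact ((measurable_gam y).pow_const (k + 1)).inv

lemma measurable_weighted {c : ℝ → ℂ} (hc : Measurable c) (m : ℤ)
    {u : EuclideanSpace ℝ (Fin n) → ℂ} (hu : Continuous u) (y : EuclideanSpace ℝ (Fin n)) :
    Measurable (weighted c m u y) := by
  unfold weighted
  refine Measurable.mul (Measurable.mul (Measurable.mul ?_ (measurable_gam_zpow y m)) ?_)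
    hu.measurable
  · exact hc.comp (Complex.measurable_re.comp (measurable_gam y))
  · exact Complex.measurable_ofReal.comp (((measurable_gam y).norm.pow_const 2).inv)

lemma continuousAt_weighted {b : ℝ → ℂ} (hb : Continuous b) (m : ℤ)
    {u : EuclideanSpace ℝ (Fin n) → ℂ} (hu : Continuous u)
    {y x : EuclideanSpace ℝ (Fin n)} (h : 0 < (gam y x).re) :
    ContinuousAt (weighted b m u y) x := by
  have h0 := gam_ne_zero h
  have hg : ContinuousAt (gam y) x := (contDiffAt_gam h).continuousAt
  unfold weighted
  refine ContinuousAt.mul (ContinuousAt.mul (ContinuousAt.mul ?_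
    (contDiffAt_gam_zpow h m).continuousAt) ?_) hu.continuousAt
  · exact ContinuousAt.comp (f := fun x => (gam y x).re) hb.continuousAt
      (continuous_gam_re y).continuousAt
  · exact Complex.continuous_ofReal.continuousAt.comp
      ((hg.norm.pow 2).inv₀ (pow_ne_zero _ (norm_ne_zero_iff.2 h0)))

/-- An integrable majorant of all cutoffs at `ε`. -/
noncomputable def majorant (ε : ℝ) (b : ℝ → ℂ) (m : ℤ) (u : EuclideanSpace ℝ (Fin n) → ℂ)
    (y : EuclideanSpace ℝ (Fin n)) : EuclideanSpace ℝ (Fin n) → ℝ :=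
  Set.indicator {x | ε ≤ (gam y x).re} fun x => ‖weighted b m u y x‖

/-- On the compact set {p ≥ ε} ∩ {‖x‖ ≤ R} the integrand is continuous, since the branch set p = 0
is avoided. -/
lemma integrable_majorant {b : ℝ → ℂ} (hb : Continuous b) {ε : ℝ} (hε : 0 < ε) (m : ℤ)
    {u : EuclideanSpace ℝ (Fin n) → ℂ} (hu : Continuous u) {R : ℝ}
    (hR : ∀ x, R < ‖x‖ → u x = 0) (y : EuclideanSpace ℝ (Fin n)) :
    Integrable (majorant ε b m u y) := by
  have hcl : IsClosed {x | ε ≤ (gam y x).re} := isClosed_le continuous_const (continuous_gam_re y)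
  have hK : IsCompact ({x | ε ≤ (gam y x).re} ∩ Metric.closedBall 0 R) :=
    (isCompact_closedBall _ R).inter_left hcl
  have hint : IntegrableOn (fun x => ‖weighted b m u y x‖)
      ({x | ε ≤ (gam y x).re} ∩ Metric.closedBall 0 R) := by
    refine ContinuousOn.integrableOn_compact hK fun x hx => ?_
    exact (continuousAt_weighted hb m hu (hε.trans_le hx.1)).norm.continuousWithinAt
  unfold majorant
  rw [integrable_indicator_iff hcl.measurableSet]
  refine hint.of_forall_sdiff_eq_zero hcl.measurableSet fun x hx => ?_
  have : R < ‖x‖ := by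
    by_contra h
    exact hx.2 ⟨hx.1, by simpa using h⟩
  simp [weighted, hR x this]

lemma norm_weighted_le_majorant {b c : ℝ → ℂ} {ε : ℝ} (hcb : ∀ s, ‖c s‖ ≤ ‖b s‖)
    (hc0 : ∀ s ≤ ε, c s = 0) (m : ℤ) (u : EuclideanSpace ℝ (Fin n) → ℂ)
    (y x : EuclideanSpace ℝ (Fin n)) : ‖weighted c m u y x‖ ≤ majorant ε b m u y x := by
  unfold majorant
  by_cases hx : ε ≤ (gam y x).re
  · rw [Set.indicator_of_mem (by exact hx)]
    simp only [weighted, norm_mul]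
    gcongr
    exact hcb _
  · rw [Set.indicator_of_notMem (by exact hx)]
    simp [weighted, hc0 _ (not_le.1 hx).le]

lemma integrable_weighted {b c : ℝ → ℂ} (hb : Continuous b) (hc : Measurable c) {ε : ℝ}
    (hε : 0 < ε) (hcb : ∀ s, ‖c s‖ ≤ ‖b s‖) (hc0 : ∀ s ≤ ε, c s = 0) (m : ℤ)
    {u : EuclideanSpace ℝ (Fin n) → ℂ} (hu : Continuous u) {R : ℝ}
    (hR : ∀ x, R < ‖x‖ → u x = 0) (y : EuclideanSpace ℝ (Fin n)) :
    Integrable (weighted c m u y) :=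
  (integrable_majorant hb hε m hu hR y).mono' (measurable_weighted hc m hu y).aestronglyMeasurable
    (Eventually.of_forall fun x => norm_weighted_le_majorant hcb hc0 m u y x)

lemma integrable_weighted_sharpCut {b : ℝ → ℂ} (hb : Continuous b) {ε : ℝ}
    (hε : 0 < ε) (m : ℤ) {u : EuclideanSpace ℝ (Fin n) → ℂ} (hu : Continuous u) {R : ℝ}
    (hR : ∀ x, R < ‖x‖ → u x = 0) (y : EuclideanSpace ℝ (Fin n)) :
    Integrable (weighted (sharpCut ε b) m u y) :=
  integrable_weighted hb (measurable_sharpCut hb ε) hε (norm_sharpCut_le ε b)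
    (fun _ hs => sharpCut_eq_zero b hs) m hu hR y

/-- Smooth cutoffs that converge to the indicator function of `(ε, ∞)`. -/
noncomputable def smoothCut (ε : ℝ) (j : ℕ) (s : ℝ) : ℂ :=
  ((Real.smoothTransition (j * (s - ε)) : ℝ) : ℂ)

lemma contDiff_smoothCut (ε : ℝ) (j : ℕ) : ContDiff ℝ ∞ (smoothCut ε j) :=
  Complex.ofRealCLM.contDiff.comp (Real.smoothTransition.contDiff.comp
    (contDiff_const.mul (contDiff_id.sub contDiff_const)))

lemma smoothCut_eq_zero {ε s : ℝ} (j : ℕ) (h : s ≤ ε) : smoothCut ε j s = 0 := by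
  rw [smoothCut, Real.smoothTransition.zero_of_nonpos]
  · simp
  · exact mul_nonpos_of_nonneg_of_nonpos (by positivity) (by linarith)

lemma norm_smoothCut_le (ε : ℝ) (j : ℕ) (s : ℝ) : ‖smoothCut ε j s‖ ≤ 1 := by
  rw [smoothCut, Complex.norm_real, Real.norm_eq_abs,
    abs_of_nonneg (Real.smoothTransition.nonneg _)]
  exact Real.smoothTransition.le_one _

lemma tendsto_smoothCut_mul (ε : ℝ) (b : ℝ → ℂ) (s : ℝ) :
    Tendsto (fun j => smoothCut ε j s * b s) atTop (𝓝 (sharpCut ε b s)) := by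
  by_cases h : ε < s
  · rw [show sharpCut ε b s = b s by simp [sharpCut, h]]
    refine tendsto_const_nhds.congr' ?_
    obtain ⟨k, hk⟩ := exists_nat_ge (s - ε)⁻¹
    filter_upwards [eventually_ge_atTop k] with j hj
    have : 1 ≤ (j : ℝ) * (s - ε) := by
      have h1 : (s - ε)⁻¹ ≤ j := hk.trans (by exact_mod_cast hj)
      rwa [inv_le_iff_one_le_mul₀ (by linarith)] at h1
    rw [smoothCut, Real.smoothTransition.one_of_one_le this]
    simp
  · rw [sharpCut_eq_zero b (not_lt.1 h)]
    simp [smoothCut_eq_zero _ (not_lt.1 h)]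

lemma tendsto_integral_smoothCut {b : ℝ → ℂ} (hb : Continuous b) {ε : ℝ} (hε : 0 < ε) (m : ℤ)
    {u : EuclideanSpace ℝ (Fin n) → ℂ} (hu : Continuous u) {R : ℝ}
    (hR : ∀ x, R < ‖x‖ → u x = 0) (y : EuclideanSpace ℝ (Fin n)) :
    Tendsto (fun j => ∫ x, weighted (fun s => smoothCut ε j s * b s) m u y x) atTop
      (𝓝 (∫ x, weighted (sharpCut ε b) m u y x)) := by
  refine tendsto_integral_of_dominated_convergence (majorant ε b m u y) (fun j => ?_)
    (integrable_majorant hb hε m hu hR y) (fun j => Eventually.of_forall fun x => ?_)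
    (Eventually.of_forall fun x => ?_)
  · exact (measurable_weighted (((contDiff_smoothCut ε j).continuous.mul hb).measurable) m hu
      y).aestronglyMeasurable
  · refine norm_weighted_le_majorant (fun s => ?_) (fun s hs => ?_) m u y x
    · rw [norm_mul]
      exact mul_le_of_le_one_left (norm_nonneg _) (norm_smoothCut_le ε j s)
    · simp [smoothCut_eq_zero j hs]
  · exact ((tendsto_smoothCut_mul ε b _).mul_const _).mul_const _ |>.mul_const _

lemma IsTestOn.reduceOne {R : ℝ} {u : EuclideanSpace ℝ (Fin n) → ℂ} (hu : IsTestOn R u) (m : ℤ)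
    (y : EuclideanSpace ℝ (Fin n)) : IsTestOn R (reduceOne m y u) :=
  (hu.const_mul _).add (((hu.dirDeriv y).const_mul _).add (hu.radialDeriv.const_mul _))

lemma IsTestOn.reduceTwo {R : ℝ} {u : EuclideanSpace ℝ (Fin n) → ℂ} (hu : IsTestOn R u) (m : ℤ) :
    IsTestOn R (reduceTwo m u) :=
  (hu.const_mul _).add (hu.radialDeriv.const_mul _)

/-- The identity for smooth cutoffs contains no derivative of the cutoff, so it passes to the sharp
cutoff by dominated convergence and no boundary term on p = ε arises. -/
lemma integral_weighted_reduce_aux {b : ℝ → ℂ} (hb : ContDiff ℝ ∞ b) {ε : ℝ} (hε : 0 < ε) (m : ℤ)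
    {R : ℝ} {u : EuclideanSpace ℝ (Fin n) → ℂ} (hu : IsTestOn R u)
    (y : EuclideanSpace ℝ (Fin n)) :
    Complex.I * m * ∫ x, weighted (sharpCut ε fun s => b s * (‖y‖ ^ 2 + s ^ 2)) (m - 1) u y x =
      (∫ x, weighted (sharpCut ε fun s => b s * s) m (reduceOne m y u) y x) -
        ∫ x, weighted (sharpCut ε b) (m + 1) (reduceTwo m u) y x := by
  have c1 : Continuous fun s : ℝ => b s * ((‖y‖ : ℂ) ^ 2 + (s : ℂ) ^ 2) :=
    hb.continuous.mul (by fun_prop)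
  have c2 : Continuous fun s : ℝ => b s * (s : ℂ) := hb.continuous.mul (by fun_prop)
  have h1 := hu.reduceOne m y
  have h2 := hu.reduceTwo m
  have t1 := tendsto_integral_smoothCut c1 hε (m - 1) hu.contDiff.continuous hu.eq_zero y
  have t2 := tendsto_integral_smoothCut c2 hε m h1.contDiff.continuous h1.eq_zero y
  have t3 := tendsto_integral_smoothCut hb.continuous hε (m + 1) h2.contDiff.continuous
    h2.eq_zero y
  have t := (t1.const_mul (Complex.I * m)).sub (t2.sub t3)
  have hz : ∀ j : ℕ, Complex.I * m *
        (∫ x, weighted (fun s => smoothCut ε j s * (b s * (‖y‖ ^ 2 + s ^ 2))) (m - 1) u y x) -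
      ((∫ x, weighted (fun s => smoothCut ε j s * (b s * s)) m (reduceOne m y u) y x) -
        ∫ x, weighted (fun s => smoothCut ε j s * b s) (m + 1) (reduceTwo m u) y x) = 0 := by
    intro j
    have hi : ∀ {b' : ℝ → ℂ}, Continuous b' → ∀ (k : ℤ) {v : EuclideanSpace ℝ (Fin n) → ℂ},
        IsTestOn R v → Integrable (weighted (fun s => smoothCut ε j s * b' s) k v y) := by
      intro b' hb' k v hv
      have hm : Measurable fun s => smoothCut ε j s * b' s :=
        ((contDiff_smoothCut ε j).continuous.mul hb').measurable
      refine integrable_weighted hb' hm hε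
        (fun s => ?_) (fun s hs => ?_) k hv.contDiff.continuous hv.eq_zero y
      · rw [norm_mul]
        exact mul_le_of_le_one_left (norm_nonneg _) (norm_smoothCut_le ε j s)
      · simp [smoothCut_eq_zero j hs]
    have hc : ContDiff ℝ ∞ fun s => smoothCut ε j s * b s := (contDiff_smoothCut ε j).mul hb
    have hmain := integral_weighted_smooth hc hε
      (fun s hs => by simp [smoothCut_eq_zero j hs.le]) m hu y
    simp only [mul_assoc] at hmain ⊢
    rw [integral_sub, integral_sub, integral_const_mul, integral_const_mul] at hmain
    · exact hmain
    · exact hi c2 m h1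
    · exact hi hb.continuous (m + 1) h2
    · exact ((hi c1 (m - 1) hu).const_mul _).const_mul _
    · exact (hi c2 m h1).sub (hi hb.continuous (m + 1) h2)
  have := tendsto_nhds_unique t (tendsto_const_nhds.congr fun j => (hz j).symm)
  exact sub_eq_zero.1 this

/-- For ‖y‖ = 1 the factor 1 + p² never vanishes, so `integral_weighted_reduce_aux` may be applied
to b/(1 + s²). The exponent m - 1 is thereby traded for m and m + 1. -/
lemma integral_weighted_reduce {b : ℝ → ℂ} (hb : ContDiff ℝ ∞ b) {ε : ℝ} (hε : 0 < ε) {m : ℤ}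
    (hm : m ≠ 0) {R : ℝ} {u : EuclideanSpace ℝ (Fin n) → ℂ} (hu : IsTestOn R u)
    {y : EuclideanSpace ℝ (Fin n)} (hy : ‖y‖ = 1) :
    ∫ x, weighted (sharpCut ε b) (m - 1) u y x = (Complex.I * m)⁻¹ *
      ((∫ x, weighted (sharpCut ε fun s => b s * (1 + s ^ 2 : ℝ)⁻¹ * s) m (reduceOne m y u) y x) -
        ∫ x, weighted (sharpCut ε fun s => b s * (1 + s ^ 2 : ℝ)⁻¹) (m + 1)
          (reduceTwo m u) y x) := by
  have hpos : ∀ s : ℝ, (1 + s ^ 2 : ℝ) ≠ 0 := fun s => by positivity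
  have hb' : ContDiff ℝ ∞ fun s : ℝ => b s * (1 + s ^ 2 : ℝ)⁻¹ := by
    have : ContDiff ℝ ∞ fun s : ℝ => (1 + s ^ 2 : ℝ)⁻¹ :=
      (contDiff_const.add (contDiff_id.pow 2)).inv hpos
    simpa using hb.mul (Complex.ofRealCLM.contDiff.comp this)
  have h := integral_weighted_reduce_aux hb' hε m hu y
  have e : (fun s : ℝ => b s * (1 + s ^ 2 : ℝ)⁻¹ * ((‖y‖ : ℂ) ^ 2 + (s : ℂ) ^ 2)) = b := by
    ext s
    have : (1 + (s : ℂ) ^ 2) ≠ 0 := by exact_mod_cast hpos s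
    rw [hy]; push_cast; rw [one_pow, mul_assoc, inv_mul_cancel₀ this, mul_one]
  rw [e] at h
  have hm' : Complex.I * (m : ℂ) ≠ 0 := mul_ne_zero Complex.I_ne_zero (by exact_mod_cast hm)
  rw [← h, ← mul_assoc, inv_mul_cancel₀ hm', one_mul]

end SharpCutoff

/-! ### Uniform local integrability of |γ|⁻³ for unit y, by a divergence argument. -/

section LocalIntegrability

variable {n : ℕ}

lemma integral_fderiv_apply_eq_zero_real {F : EuclideanSpace ℝ (Fin n) → ℝ} (hF : ContDiff ℝ 1 F)
    (hc : HasCompactSupport F) (v : EuclideanSpace ℝ (Fin n)) : ∫ x, fderiv ℝ F x v = 0 := by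
  have h := integral_fderiv_apply_eq_zero (F := fun x => (F x : ℂ))
    (Complex.ofRealCLM.contDiff.comp hF) (hc.comp_left Complex.ofReal_zero) v
  have e : ∀ x, fderiv ℝ (fun x => (F x : ℂ)) x v = ((fderiv ℝ F x v : ℝ) : ℂ) := fun x => by
    have := Complex.ofRealCLM.hasFDerivAt.comp x (hF.differentiable one_ne_zero x).hasFDerivAt
    exact congrArg (fun L => L v) this.fderiv
  simp only [e] at h
  rw [integral_complex_ofReal] at h
  exact_mod_cast h

lemma integral_fderiv_self_add_eq_zero_real {F : EuclideanSpace ℝ (Fin n) → ℝ}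
    (hF : ContDiff ℝ 1 F) (hc : HasCompactSupport F) :
    ∫ x, (fderiv ℝ F x x + n * F x) = 0 := by
  have h := integral_fderiv_self_add_eq_zero (F := fun x => (F x : ℂ))
    (Complex.ofRealCLM.contDiff.comp hF) (hc.comp_left Complex.ofReal_zero)
  have e : ∀ x, fderiv ℝ (fun x => (F x : ℂ)) x x = ((fderiv ℝ F x x : ℝ) : ℂ) := fun x => by
    have := Complex.ofRealCLM.hasFDerivAt.comp x (hF.differentiable one_ne_zero x).hasFDerivAt
    exact congrArg (fun L => L x) this.fderiv
  simp only [e, finrank_euclideanSpace_fin] at h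
  have e2 : ∀ x, ((fderiv ℝ F x x : ℝ) : ℂ) + (n : ℂ) * (F x : ℂ) =
      ((fderiv ℝ F x x + n * F x : ℝ) : ℂ) := fun x => by push_cast; rfl
  simp only [e2] at h
  rw [integral_complex_ofReal] at h
  exact_mod_cast h

/-- The fourth power of the modulus of the complex length, shifted by `η`. -/
noncomputable def quartic (η : ℝ) (y x : EuclideanSpace ℝ (Fin n)) : ℝ :=
  (‖x‖ ^ 2 - ‖y‖ ^ 2) ^ 2 + 4 * ⟪x, y⟫_ℝ ^ 2 + η

lemma norm_gam_pow_four (y x : EuclideanSpace ℝ (Fin n)) : ‖gam y x‖ ^ 4 = quartic 0 y x := by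
  rw [quartic, add_zero, ← norm_gamSq_sq, ← norm_gam_sq]; ring

lemma quartic_pos {η : ℝ} (hη : 0 < η) (y x : EuclideanSpace ℝ (Fin n)) : 0 < quartic η y x := by
  unfold quartic; positivity

lemma contDiff_normSq_sub (y : EuclideanSpace ℝ (Fin n)) :
    ContDiff ℝ ∞ fun x : EuclideanSpace ℝ (Fin n) => ‖x‖ ^ 2 - ‖y‖ ^ 2 :=
  (contDiff_norm_sq ℝ).sub contDiff_const

lemma contDiff_inner_right (y : EuclideanSpace ℝ (Fin n)) :
    ContDiff ℝ ∞ fun x : EuclideanSpace ℝ (Fin n) => ⟪x, y⟫_ℝ :=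
  contDiff_id.inner ℝ contDiff_const

lemma contDiff_quartic (η : ℝ) (y : EuclideanSpace ℝ (Fin n)) : ContDiff ℝ ∞ (quartic η y) :=
  (((contDiff_normSq_sub y).pow 2).add (contDiff_const.mul ((contDiff_inner_right y).pow 2))).add
    contDiff_const

lemma contDiff_quartic_rpow {η : ℝ} (hη : 0 < η) (y : EuclideanSpace ℝ (Fin n)) :
    ContDiff ℝ ∞ fun x => quartic η y x ^ (-(3 / 4) : ℝ) :=
  (contDiff_quartic η y).rpow_const_of_ne fun x => (quartic_pos hη y x).ne'

lemma hasDerivAt_line (x v : EuclideanSpace ℝ (Fin n)) :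
    HasDerivAt (fun τ : ℝ => x + τ • v) v 0 := by
  simpa using ((hasDerivAt_id (0 : ℝ)).smul_const v).const_add x

lemma hasDerivAt_normSq_sub (y x v : EuclideanSpace ℝ (Fin n)) :
    HasDerivAt (fun τ : ℝ => ‖x + τ • v‖ ^ 2 - ‖y‖ ^ 2) (2 * ⟪x, v⟫_ℝ) 0 := by
  simpa using (hasDerivAt_line x v).norm_sq.sub_const (‖y‖ ^ 2)

lemma hasDerivAt_inner_line (y x v : EuclideanSpace ℝ (Fin n)) :
    HasDerivAt (fun τ : ℝ => ⟪x + τ • v, y⟫_ℝ) ⟪v, y⟫_ℝ 0 := by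
  simpa using (hasDerivAt_line x v).inner ℝ (hasDerivAt_const (0 : ℝ) y)

lemma hasDerivAt_quartic_rpow {η : ℝ} (hη : 0 < η) (y x v : EuclideanSpace ℝ (Fin n)) :
    HasDerivAt (fun τ : ℝ => quartic η y (x + τ • v) ^ (-(3 / 4) : ℝ))
      (-(3 / 4) * quartic η y x ^ (-(3 / 4) : ℝ) / quartic η y x *
        (4 * (‖x‖ ^ 2 - ‖y‖ ^ 2) * ⟪x, v⟫_ℝ + 8 * ⟪x, y⟫_ℝ * ⟪v, y⟫_ℝ)) 0 := by
  have h1 : HasDerivAt (fun τ : ℝ => quartic η y (x + τ • v))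
      (4 * (‖x‖ ^ 2 - ‖y‖ ^ 2) * ⟪x, v⟫_ℝ + 8 * ⟪x, y⟫_ℝ * ⟪v, y⟫_ℝ) 0 := by
    have := (((hasDerivAt_normSq_sub y x v).pow 2).add
      (((hasDerivAt_inner_line y x v).pow 2).const_mul 4)).add_const η
    refine this.congr_deriv ?_
    simp; ring
  have h2 := h1.rpow_const (p := (-(3 / 4) : ℝ)) (Or.inl (by simpa using (quartic_pos hη y x).ne'))
  refine h2.congr_deriv ?_
  simp only [zero_smul, add_zero]
  rw [Real.rpow_sub (quartic_pos hη y x), Real.rpow_one]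
  ring

lemma fderiv_apply_eq_of_hasDerivAt_real {E : Type*} [NormedAddCommGroup E] [NormedSpace ℝ E]
    {F : E → ℝ} {x v : E} {d : ℝ} (hF : DifferentiableAt ℝ F x)
    (h : HasDerivAt (fun t : ℝ => F (x + t • v)) d 0) : fderiv ℝ F x v = d :=
  (hF.hasFDerivAt.hasLineDerivAt v).unique h

/-- Let W = 2⟪x, y⟫ y + (‖x‖² - 1) x and let Q be the shifted quartic, with Q₀ its value at η = 0.
Then div W = 2 + 2‖x‖² + n(‖x‖² - 1), and Q has derivative 4‖x‖² Q₀ along W. With the exponent -3/4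
the bracket multiplying ψ, at points with ‖x‖ = 1, is 4 - 3 Q₀/Q ≥ 1; this positivity is what the
choice of W achieves. -/
lemma divergence_quartic {η : ℝ} (hη : 0 < η) {ψ : EuclideanSpace ℝ (Fin n) → ℝ}
    (hψ : ContDiff ℝ ∞ ψ) {y : EuclideanSpace ℝ (Fin n)} (hy : ‖y‖ = 1)
    (x : EuclideanSpace ℝ (Fin n)) :
    fderiv ℝ (fun x => 2 * (quartic η y x ^ (-(3 / 4) : ℝ) * ψ x * ⟪x, y⟫_ℝ)) x y +
      (fderiv ℝ (fun x => quartic η y x ^ (-(3 / 4) : ℝ) * ψ x * (‖x‖ ^ 2 - ‖y‖ ^ 2)) x x +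
        n * (quartic η y x ^ (-(3 / 4) : ℝ) * ψ x * (‖x‖ ^ 2 - ‖y‖ ^ 2))) =
      quartic η y x ^ (-(3 / 4) : ℝ) * (ψ x * (2 * ‖x‖ ^ 2 + 2 + n * (‖x‖ ^ 2 - 1) -
        3 * ‖x‖ ^ 2 * (quartic 0 y x / quartic η y x)) +
        ((‖x‖ ^ 2 - 1) * fderiv ℝ ψ x x + 2 * ⟪x, y⟫_ℝ * fderiv ℝ ψ x y)) := by
  have hq := contDiff_quartic_rpow hη y
  have hψl : ∀ v, HasDerivAt (fun τ : ℝ => ψ (x + τ • v)) (fderiv ℝ ψ x v) 0 := fun v =>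
    (hψ.differentiable (by simp) x).hasFDerivAt.hasLineDerivAt v
  have d1 := ((((hasDerivAt_quartic_rpow hη y x y).mul (hψl y)).mul
    (hasDerivAt_inner_line y x y)).const_mul 2)
  have d2 := (((hasDerivAt_quartic_rpow hη y x x).mul (hψl x)).mul
    (hasDerivAt_normSq_sub y x x))
  rw [fderiv_apply_eq_of_hasDerivAt_real
      ((contDiff_const.mul ((hq.mul hψ).mul (contDiff_inner_right y))).differentiable (by simp) x)
      d1,
    fderiv_apply_eq_of_hasDerivAt_real
      (((hq.mul hψ).mul (contDiff_normSq_sub y)).differentiable (by simp) x) d2]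
  simp only [zero_smul, add_zero, real_inner_self_eq_norm_sq, hy]
  have hp := (quartic_pos hη y x).ne'
  have h0 : quartic 0 y x = (‖x‖ ^ 2 - 1) ^ 2 + 4 * ⟪x, y⟫_ℝ ^ 2 := by simp [quartic, hy]
  rw [h0]
  simp only [Pi.mul_apply, zero_smul, add_zero]
  generalize quartic η y x ^ (-(3 / 4) : ℝ) = Z
  generalize quartic η y x = Q at *
  field_simp
  ring

/-- Put s = ‖x‖² - 1. As Q₀ ≤ Q, the bracket is at least 1 + (n - 1)s ≥ 1/2 - (n + 1)² s², and s²
Q^(-3/4) ≤ Q^(1/4) is bounded on the ball. The gradient of ψ lives where ‖x‖ ≥ R ≥ 2, hence Q ≥ 1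
there and its terms are bounded too. -/
lemma divergence_quartic_ge {η : ℝ} (hη : 0 < η) (hη1 : η ≤ 1) {R B : ℝ} (hR : 2 ≤ R)
    (ψ : EuclideanSpace ℝ (Fin n) → ℝ) (h0 : ∀ x, 0 ≤ ψ x) (h1 : ∀ x, ψ x ≤ 1)
    (hin : ∀ x, ‖x‖ < R → fderiv ℝ ψ x = 0) (hout : ∀ x, R + 1 < ‖x‖ → fderiv ℝ ψ x = 0)
    (hout' : ∀ x, R + 1 < ‖x‖ → ψ x = 0) (hB : ∀ x, ‖fderiv ℝ ψ x‖ ≤ B)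
    {y : EuclideanSpace ℝ (Fin n)} (hy : ‖y‖ = 1) (x : EuclideanSpace ℝ (Fin n)) :
    1 / 2 * (quartic η y x ^ (-(3 / 4) : ℝ) * ψ x) -
        (Metric.closedBall (0 : EuclideanSpace ℝ (Fin n)) (R + 1)).indicator
        (fun _ => (n + 1) ^ 2 * ((R + 2) ^ 4 + 1) + ((R + 1) ^ 3 * B + 2 * (R + 1) * B)) x ≤
      quartic η y x ^ (-(3 / 4) : ℝ) * (ψ x * (2 * ‖x‖ ^ 2 + 2 + n * (‖x‖ ^ 2 - 1) -
        3 * ‖x‖ ^ 2 * (quartic 0 y x / quartic η y x)) +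
        ((‖x‖ ^ 2 - 1) * fderiv ℝ ψ x x + 2 * ⟪x, y⟫_ℝ * fderiv ℝ ψ x y)) := by
  by_cases hx : R + 1 < ‖x‖
  · rw [Set.indicator_of_notMem (by simpa using hx), hout x hx, hout' x hx]
    simp
  · have hx' : ‖x‖ ≤ R + 1 := not_lt.1 hx
    rw [Set.indicator_of_mem (by simpa using hx')]
    have hQ := quartic_pos hη y x
    have hA : 0 < quartic η y x ^ (-(3 / 4) : ℝ) := Real.rpow_pos_of_pos hQ _
    have hB0 : 0 ≤ B := (norm_nonneg _).trans (hB 0)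
    have hr := norm_nonneg x
    have ht : |⟪x, y⟫_ℝ| ≤ R + 1 := (abs_real_inner_le_norm x y).trans (by rw [hy]; linarith)
    have hratio : quartic 0 y x / quartic η y x ≤ 1 := by
      rw [div_le_one hQ]; unfold quartic; linarith
    have hsQ : (‖x‖ ^ 2 - 1) ^ 2 ≤ quartic η y x := by
      unfold quartic; rw [hy]; nlinarith [sq_nonneg ⟪x, y⟫_ℝ]
    have hQK : quartic η y x ≤ (R + 2) ^ 4 + 1 := by
      have e : quartic η y x = ‖gam y x‖ ^ 4 + η := by
        rw [norm_gam_pow_four]; simp [quartic]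
      have : ‖gam y x‖ ≤ R + 2 := (norm_gam_le y x).trans (by rw [hy]; linarith)
      rw [e]; gcongr
    have hAs : quartic η y x ^ (-(3 / 4) : ℝ) * (‖x‖ ^ 2 - 1) ^ 2 ≤ (R + 2) ^ 4 + 1 := by
      calc _ ≤ quartic η y x ^ (-(3 / 4) : ℝ) * quartic η y x := by gcongr
        _ = quartic η y x ^ (1 / 4 : ℝ) := by
            rw [← Real.rpow_add_one hQ.ne']; norm_num
        _ ≤ ((R + 2) ^ 4 + 1) ^ (1 / 4 : ℝ) := by gcongr
        _ ≤ ((R + 2) ^ 4 + 1) ^ (1 : ℝ) :=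
            Real.rpow_le_rpow_of_exponent_le (by nlinarith [pow_nonneg (by linarith : 0 ≤ R + 2) 4])
              (by norm_num)
        _ = _ := Real.rpow_one _
    have hgrad : -((R + 1) ^ 3 * B + 2 * (R + 1) * B) ≤ quartic η y x ^ (-(3 / 4) : ℝ) *
        ((‖x‖ ^ 2 - 1) * fderiv ℝ ψ x x + 2 * ⟪x, y⟫_ℝ * fderiv ℝ ψ x y) := by
      by_cases hxR : ‖x‖ < R
      · rw [hin x hxR]
        simp only [zero_apply, mul_zero, add_zero]
        exact neg_nonpos.2 (by positivity)
      · have hxR' : 2 ≤ ‖x‖ := hR.trans (not_lt.1 hxR)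
        have hA1 : quartic η y x ^ (-(3 / 4) : ℝ) ≤ 1 := by
          refine Real.rpow_le_one_of_one_le_of_nonpos (le_trans ?_ hsQ) (by norm_num)
          have h3 : 3 ≤ ‖x‖ ^ 2 - 1 := by nlinarith
          nlinarith
        have hb1 : |(‖x‖ ^ 2 - 1) * fderiv ℝ ψ x x| ≤ (R + 1) ^ 3 * B := by
          rw [abs_mul, abs_of_nonneg (by nlinarith)]
          have : |fderiv ℝ ψ x x| ≤ B * (R + 1) :=
            ((fderiv ℝ ψ x).le_opNorm x).trans (by gcongr; exact hB x)
          calc _ ≤ (R + 1) ^ 2 * (B * (R + 1)) := by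
                gcongr; nlinarith
            _ = _ := by ring
        have hb2 : |2 * ⟪x, y⟫_ℝ * fderiv ℝ ψ x y| ≤ 2 * (R + 1) * B := by
          rw [abs_mul, abs_mul, abs_two]
          have : |fderiv ℝ ψ x y| ≤ B * 1 :=
            ((fderiv ℝ ψ x).le_opNorm y).trans (by rw [hy]; gcongr; exact hB x)
          rw [mul_one] at this
          gcongr
        have hb : |(‖x‖ ^ 2 - 1) * fderiv ℝ ψ x x + 2 * ⟪x, y⟫_ℝ * fderiv ℝ ψ x y| ≤
            (R + 1) ^ 3 * B + 2 * (R + 1) * B := (abs_add_le _ _).trans (add_le_add hb1 hb2)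
        refine (neg_le_neg ?_).trans (neg_abs_le _)
        rw [abs_mul, abs_of_pos hA]
        exact (mul_le_of_le_one_left (abs_nonneg _) hA1).trans hb
    have hψ0 := h0 x
    have hmain : 1 / 2 * (quartic η y x ^ (-(3 / 4) : ℝ) * ψ x) -
        (n + 1) ^ 2 * ((R + 2) ^ 4 + 1) ≤ quartic η y x ^ (-(3 / 4) : ℝ) *
        (ψ x * (2 * ‖x‖ ^ 2 + 2 + n * (‖x‖ ^ 2 - 1) -
        3 * ‖x‖ ^ 2 * (quartic 0 y x / quartic η y x))) := by
      have hlow : 1 / 2 - (n + 1) ^ 2 * (‖x‖ ^ 2 - 1) ^ 2 ≤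
          2 * ‖x‖ ^ 2 + 2 + n * (‖x‖ ^ 2 - 1) -
          3 * ‖x‖ ^ 2 * (quartic 0 y x / quartic η y x) := by
        have : 3 * ‖x‖ ^ 2 * (quartic 0 y x / quartic η y x) ≤ 3 * ‖x‖ ^ 2 * 1 := by gcongr
        have hn : (0 : ℝ) ≤ n := Nat.cast_nonneg n
        nlinarith [sq_nonneg ((n - 1) * (‖x‖ ^ 2 - 1) + 1),
          mul_nonneg hn (sq_nonneg (‖x‖ ^ 2 - 1)), sq_nonneg (n * (‖x‖ ^ 2 - 1)),
          sq_nonneg (‖x‖ ^ 2 - 1)]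
      calc _ ≤ 1 / 2 * (quartic η y x ^ (-(3 / 4) : ℝ) * ψ x) -
            ψ x * ((n + 1) ^ 2 * (quartic η y x ^ (-(3 / 4) : ℝ) * (‖x‖ ^ 2 - 1) ^ 2)) := by
            refine sub_le_sub_left ?_ _
            rw [← one_mul ((n + 1 : ℝ) ^ 2 * ((R + 2) ^ 4 + 1))]
            exact mul_le_mul (h1 x) (mul_le_mul_of_nonneg_left hAs (by positivity))
              (by positivity) zero_le_one
        _ = quartic η y x ^ (-(3 / 4) : ℝ) * (ψ x *
            (1 / 2 - (n + 1) ^ 2 * (‖x‖ ^ 2 - 1) ^ 2)) := by ring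
        _ ≤ _ := by gcongr
    rw [mul_add]
    linarith

/-- A divergence integrates to zero, so the lower bound `divergence_quartic_ge` becomes an upper
bound for the integral of Q^(-3/4) ψ that depends on neither y nor η. -/
lemma exists_integral_quartic_le {R : ℝ} (hR : 2 ≤ R) :
    ∃ C, ∀ y : EuclideanSpace ℝ (Fin n), ‖y‖ = 1 → ∀ η, 0 < η → η ≤ 1 →
      ∫⁻ x in Metric.closedBall 0 R, ENNReal.ofReal (quartic η y x ^ (-(3 / 4) : ℝ)) ≤
        ENNReal.ofReal C := by
  let ψ : ContDiffBump (0 : EuclideanSpace ℝ (Fin n)) := ⟨R, R + 1, by linarith, by linarith⟩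
  have hψ : ContDiff ℝ ∞ ψ := ψ.contDiff
  have hψc : HasCompactSupport ψ := ψ.hasCompactSupport
  obtain ⟨B, hB⟩ := (hψ.continuous_fderiv (by simp)).bounded_above_of_compact_support
    (hψc.fderiv ℝ)
  have hin : ∀ x, ‖x‖ < R → fderiv ℝ ψ x = 0 := fun x hx => by
    have : (ψ : EuclideanSpace ℝ (Fin n) → ℝ) =ᶠ[𝓝 x] fun _ => 1 := by
      filter_upwards [(isOpen_lt continuous_norm continuous_const).mem_nhds hx] with z hz
      exact ψ.one_of_mem_closedBall (by simpa using (show ‖z‖ < R from hz).le)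
    rw [this.fderiv_eq]; simp
  have hout' : ∀ x, R + 1 < ‖x‖ → ψ x = 0 := fun x hx =>
    ψ.zero_of_le_dist (by simpa using hx.le)
  have hout : ∀ x, R + 1 < ‖x‖ → fderiv ℝ ψ x = 0 := fun x hx => by
    have : (ψ : EuclideanSpace ℝ (Fin n) → ℝ) =ᶠ[𝓝 x] fun _ => 0 := by
      filter_upwards [(isOpen_lt continuous_const continuous_norm).mem_nhds hx] with z hz
      exact hout' z hz
    rw [this.fderiv_eq]; simp
  set K : ℝ := (n + 1) ^ 2 * ((R + 2) ^ 4 + 1) + ((R + 1) ^ 3 * B + 2 * (R + 1) * B)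
  set ball := Metric.closedBall (0 : EuclideanSpace ℝ (Fin n)) (R + 1)
  refine ⟨2 * ∫ x, ball.indicator (fun _ => K) x, fun y hy η hη hη1 => ?_⟩
  have hq := contDiff_quartic_rpow hη y
  have s1 : ContDiff ℝ ∞ fun x => 2 * (quartic η y x ^ (-(3 / 4) : ℝ) * ψ x * ⟪x, y⟫_ℝ) :=
    contDiff_const.mul ((hq.mul hψ).mul (contDiff_inner_right y))
  have s2 : ContDiff ℝ ∞ fun x => quartic η y x ^ (-(3 / 4) : ℝ) * ψ x * (‖x‖ ^ 2 - ‖y‖ ^ 2) :=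
    (hq.mul hψ).mul (contDiff_normSq_sub y)
  have k0 : HasCompactSupport fun x => quartic η y x ^ (-(3 / 4) : ℝ) * ψ x := hψc.mul_left
  have k1 : HasCompactSupport fun x => 2 * (quartic η y x ^ (-(3 / 4) : ℝ) * ψ x * ⟪x, y⟫_ℝ) :=
    (k0.mul_right).mul_left
  have k2 : HasCompactSupport fun x =>
      quartic η y x ^ (-(3 / 4) : ℝ) * ψ x * (‖x‖ ^ 2 - ‖y‖ ^ 2) := k0.mul_right
  have i1 := integral_fderiv_apply_eq_zero_real (s1.of_le (by simp)) k1 y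
  have i2 := integral_fderiv_self_add_eq_zero_real (s2.of_le (by simp)) k2
  have int1 : Integrable fun x => fderiv ℝ
      (fun x => 2 * (quartic η y x ^ (-(3 / 4) : ℝ) * ψ x * ⟪x, y⟫_ℝ)) x y :=
    ((s1.continuous_fderiv (by simp)).clm_apply
      continuous_const).integrable_of_hasCompactSupport (k1.fderiv_apply ℝ y)
  have k3 : HasCompactSupport fun x => fderiv ℝ
      (fun x => quartic η y x ^ (-(3 / 4) : ℝ) * ψ x * (‖x‖ ^ 2 - ‖y‖ ^ 2)) x x :=
    (k2.fderiv ℝ).mono fun x hx => by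
      intro h0; exact hx (by simp [h0])
  have int2 : Integrable fun x => fderiv ℝ
      (fun x => quartic η y x ^ (-(3 / 4) : ℝ) * ψ x * (‖x‖ ^ 2 - ‖y‖ ^ 2)) x x +
        n * (quartic η y x ^ (-(3 / 4) : ℝ) * ψ x * (‖x‖ ^ 2 - ‖y‖ ^ 2)) :=
    (((s2.continuous_fderiv (by simp)).clm_apply
      continuous_id).integrable_of_hasCompactSupport k3).add
      ((s2.continuous.integrable_of_hasCompactSupport k2).const_mul _)
  have hsum := integral_add int1 int2
  rw [i1, i2, add_zero] at hsum
  have intT := int1.add int2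
  have intA : Integrable fun x => quartic η y x ^ (-(3 / 4) : ℝ) * ψ x :=
    (hq.continuous.mul hψ.continuous).integrable_of_hasCompactSupport k0
  have intK : Integrable (ball.indicator fun _ => K) :=
    (integrable_indicator_iff Metric.isClosed_closedBall.measurableSet).2
      (integrableOn_const (isCompact_closedBall _ _).measure_lt_top.ne)
  have hle : ∫ x, (1 / 2 * (quartic η y x ^ (-(3 / 4) : ℝ) * ψ x) - ball.indicator (fun _ => K) x) ≤
      0 := by
    rw [← hsum]
    refine integral_mono ((intA.const_mul _).sub intK) intT fun x => ?_
    have := divergence_quartic_ge hη hη1 hR ψ (fun _ => ψ.nonneg) (fun _ => ψ.le_one) hin hout hout'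
      hB hy x
    rw [← divergence_quartic hη hψ hy x] at this
    exact this
  rw [integral_sub (intA.const_mul _) intK, integral_const_mul] at hle
  have hA0 : ∀ x, 0 ≤ quartic η y x ^ (-(3 / 4) : ℝ) * ψ x := fun x =>
    mul_nonneg (Real.rpow_nonneg (quartic_pos hη y x).le _) ψ.nonneg
  calc _ = ∫⁻ x in Metric.closedBall 0 R,
        ENNReal.ofReal (quartic η y x ^ (-(3 / 4) : ℝ) * ψ x) := by
        refine setLIntegral_congr_fun Metric.isClosed_closedBall.measurableSet fun x hx => ?_
        rw [ψ.one_of_mem_closedBall hx, mul_one]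
    _ ≤ ∫⁻ x, ENNReal.ofReal (quartic η y x ^ (-(3 / 4) : ℝ) * ψ x) := setLIntegral_le_lintegral _ _
    _ = ENNReal.ofReal (∫ x, quartic η y x ^ (-(3 / 4) : ℝ) * ψ x) :=
        (ofReal_integral_eq_lintegral_ofReal intA (Eventually.of_forall hA0)).symm
    _ ≤ _ := ENNReal.ofReal_le_ofReal (by linarith)

/-- Fatou's lemma along η = 1/(k + 1) → 0. -/
lemma exists_lintegral_norm_gam_le {R : ℝ} (hR : 2 ≤ R) :
    ∃ C, ∀ y : EuclideanSpace ℝ (Fin n), ‖y‖ = 1 →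
      ∫⁻ x in Metric.closedBall 0 R, ENNReal.ofReal ((‖gam y x‖ ^ 3)⁻¹) ≤ ENNReal.ofReal C := by
  obtain ⟨C, hC⟩ := exists_integral_quartic_le (n := n) hR
  refine ⟨C, fun y hy => ?_⟩
  have hη : ∀ k : ℕ, (0 : ℝ) < 1 / (k + 1) := fun k => by positivity
  have hη1 : ∀ k : ℕ, (1 : ℝ) / (k + 1) ≤ 1 := fun k => by
    rw [div_le_one (by positivity)]; linarith [Nat.cast_nonneg (α := ℝ) k]
  have hlim : ∀ x, ENNReal.ofReal ((‖gam y x‖ ^ 3)⁻¹) ≤ liminf (fun k : ℕ =>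
      ENNReal.ofReal (quartic (1 / (k + 1)) y x ^ (-(3 / 4) : ℝ))) atTop := by
    intro x
    -- On the branch set the inverse takes its default value 0, so nothing is needed about the limit
    -- there.
    by_cases h0 : ‖gam y x‖ = 0
    · simp [h0]
    · have hp : 0 < ‖gam y x‖ := lt_of_le_of_ne (norm_nonneg _) (Ne.symm h0)
      have e : (‖gam y x‖ ^ 3)⁻¹ = quartic 0 y x ^ (-(3 / 4) : ℝ) := by
        rw [← norm_gam_pow_four, Real.rpow_neg (by positivity), ← Real.rpow_natCast _ 4,
          ← Real.rpow_mul hp.le, ← Real.rpow_natCast _ 3]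
        norm_num
      rw [e]
      refine (Tendsto.liminf_eq ?_).ge
      refine ENNReal.tendsto_ofReal ?_
      have hq : Tendsto (fun k : ℕ => quartic (1 / (k + 1)) y x) atTop (𝓝 (quartic 0 y x)) :=
        tendsto_const_nhds.add tendsto_one_div_add_atTop_nhds_zero_nat
      refine hq.rpow_const (Or.inl ?_)
      rw [← norm_gam_pow_four]; positivity
  calc _ ≤ ∫⁻ x in Metric.closedBall 0 R, liminf (fun k : ℕ =>
        ENNReal.ofReal (quartic (1 / (k + 1)) y x ^ (-(3 / 4) : ℝ))) atTop := lintegral_mono hlim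
    _ ≤ liminf (fun k : ℕ => ∫⁻ x in Metric.closedBall 0 R,
        ENNReal.ofReal (quartic (1 / (k + 1)) y x ^ (-(3 / 4) : ℝ))) atTop :=
        lintegral_liminf_le fun k =>
          (contDiff_quartic_rpow (hη k) y).continuous.measurable.ennreal_ofReal
    _ ≤ _ := liminf_le_of_le (by isBoundedDefault) fun b hb => by
        obtain ⟨k, hk⟩ := hb.exists
        exact hk.trans (hC y hy _ (hη k) (hη1 k))

lemma exists_integrableOn_norm_gam (R : ℝ) :
    ∃ C, 0 ≤ C ∧ ∀ y : EuclideanSpace ℝ (Fin n), ‖y‖ = 1 →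
      IntegrableOn (fun x => (‖gam y x‖ ^ 3)⁻¹) (Metric.closedBall 0 R) ∧
      ∫ x in Metric.closedBall 0 R, (‖gam y x‖ ^ 3)⁻¹ ≤ C := by
  obtain ⟨C, hC⟩ := exists_lintegral_norm_gam_le (n := n) (le_max_right R 2)
  refine ⟨max C 0, le_max_right _ _, fun y hy => ?_⟩
  have h1 : ∫⁻ x in Metric.closedBall 0 R, ENNReal.ofReal ((‖gam y x‖ ^ 3)⁻¹) ≤
      ENNReal.ofReal C :=
    (lintegral_mono_set (Metric.closedBall_subset_closedBall (le_max_left R 2))).trans (hC y hy)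
  have hm : Measurable fun x => (‖gam y x‖ ^ 3)⁻¹ := ((measurable_gam y).norm.pow_const 3).inv
  have h0 : ∀ x, 0 ≤ (‖gam y x‖ ^ 3)⁻¹ := fun x => by positivity
  refine ⟨⟨hm.aestronglyMeasurable, ?_⟩, ?_⟩
  · rw [hasFiniteIntegral_iff_ofReal (Eventually.of_forall h0)]
    exact h1.trans_lt ENNReal.ofReal_lt_top
  · rw [integral_eq_lintegral_of_nonneg_ae (Eventually.of_forall h0) hm.aestronglyMeasurable]
    exact ENNReal.toReal_le_of_le_ofReal (le_max_right _ _)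
      (h1.trans (ENNReal.ofReal_le_ofReal (le_max_left _ _)))

end LocalIntegrability

/-! ### Existence of the limit ε → 0⁺ for unit y. -/

section Limits

variable {n : ℕ}

lemma tendsto_sharpCut (b : ℝ → ℂ) {s : ℝ} (hs : 0 ≤ s) :
    Tendsto (fun ε => sharpCut ε b s) (𝓝[>] 0) (𝓝 (sharpCut 0 b s)) := by
  rcases hs.eq_or_lt with rfl | hs
  · rw [sharpCut_eq_zero b le_rfl]
    refine tendsto_const_nhds.congr' ?_
    filter_upwards [self_mem_nhdsWithin] with ε hε
    exact (sharpCut_eq_zero b (le_of_lt hε)).symm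
  · refine tendsto_const_nhds.congr' ?_
    filter_upwards [nhdsWithin_le_nhds (Iio_mem_nhds hs)] with ε hε
    simp [sharpCut, hs, show ε < s from hε]

/-- The powers of γ have modulus |γ|^(-1-k) = |γ|^(2-k) |γ|⁻³, and 2 - k ≥ 0 makes the first factor
bounded. -/
lemma norm_weighted_le_cube {b : ℝ → ℂ} {R B M : ℝ} (hR : 0 ≤ R)
    (hB : ∀ s, 0 ≤ s → s ≤ R + 1 → ‖b s‖ ≤ B) {k : ℕ} (hk : k ≤ 2)
    {u : EuclideanSpace ℝ (Fin n) → ℂ} (hu : ∀ x, R < ‖x‖ → u x = 0)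
    (hM : ∀ x, ‖x‖ ≤ R → ‖u x‖ ≤ M) {y : EuclideanSpace ℝ (Fin n)} (hy : ‖y‖ = 1) {ε : ℝ}
    (hε : 0 ≤ ε) (x : EuclideanSpace ℝ (Fin n)) :
    ‖weighted (sharpCut ε b) (1 - k) u y x‖ ≤
      (Metric.closedBall (0 : EuclideanSpace ℝ (Fin n)) R).indicator
        (fun x => B * (R + 1) ^ 2 * M * (‖gam y x‖ ^ 3)⁻¹) x := by
  by_cases hx : R < ‖x‖
  · rw [Set.indicator_of_notMem (by simpa using hx)]
    simp [weighted, hu x hx]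
  · have hx' := not_lt.1 hx
    rw [Set.indicator_of_mem (by simpa using hx')]
    have hMx := hM x hx'
    have hM0 : 0 ≤ M := (norm_nonneg _).trans hMx
    have hB0 : 0 ≤ B := (norm_nonneg _).trans (hB 0 le_rfl (by linarith))
    by_cases hp : (gam y x).re ≤ ε
    · simp only [weighted, sharpCut_eq_zero b hp, zero_mul, norm_zero]
      positivity
    · have hp' : 0 < (gam y x).re := hε.trans_lt (not_le.1 hp)
      have hg : 0 < ‖gam y x‖ := norm_pos_iff.2 (gam_ne_zero hp')
      have hgR : ‖gam y x‖ ≤ R + 1 := (norm_gam_le y x).trans (by rw [hy]; linarith)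
      have hb := (norm_sharpCut_le ε b (gam y x).re).trans
        (hB _ hp'.le ((gam_re_le_norm y x).trans hgR))
      have e : ‖gam y x‖ ^ (1 - k : ℤ) * (‖gam y x‖ ^ 2)⁻¹ =
          ‖gam y x‖ ^ (2 - k) * (‖gam y x‖ ^ 3)⁻¹ := by
        rw [← zpow_natCast _ (2 - k), ← zpow_natCast _ 2, ← zpow_natCast _ 3, ← zpow_neg,
          ← zpow_neg, ← zpow_add₀ hg.ne', ← zpow_add₀ hg.ne']
        congr 1
        omega
      have h2 : ‖gam y x‖ ^ (2 - k) ≤ (R + 1) ^ 2 :=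
        (pow_le_pow_left₀ hg.le hgR _).trans (pow_le_pow_right₀ (by linarith) (by omega))
      simp only [weighted, norm_mul, norm_zpow, Complex.norm_real, norm_inv, norm_pow, norm_norm]
      calc _ = ‖sharpCut ε b (gam y x).re‖ * (‖gam y x‖ ^ (1 - k : ℤ) * (‖gam y x‖ ^ 2)⁻¹) *
            ‖u x‖ := by ring
        _ = ‖sharpCut ε b (gam y x).re‖ * (‖gam y x‖ ^ (2 - k) * (‖gam y x‖ ^ 3)⁻¹) *
            ‖u x‖ := by rw [e]
        _ ≤ B * ((R + 1) ^ 2 * (‖gam y x‖ ^ 3)⁻¹) * M := by gcongr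
        _ = _ := by ring

lemma exists_limit_weighted_of_le_two {R : ℝ} (hR : 0 ≤ R) {b : ℝ → ℂ} (hb : Continuous b)
    {k : ℕ} (hk : k ≤ 2) :
    ∃ C, 0 ≤ C ∧ ∀ y : EuclideanSpace ℝ (Fin n), ‖y‖ = 1 → ∀ u, IsTestOn R u →
      ∀ M, DerivBound 0 R M u → ∃ L, Tendsto
        (fun ε => ∫ x, weighted (sharpCut ε b) (1 - k) u y x) (𝓝[>] 0) (𝓝 L) ∧ ‖L‖ ≤ C * M := by
  obtain ⟨C, hC0, hC⟩ := exists_integrableOn_norm_gam (n := n) R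
  obtain ⟨B, hB⟩ := (isCompact_Icc (a := 0) (b := R + 1)).exists_bound_of_continuousOn
    hb.continuousOn
  have hB' : ∀ s, 0 ≤ s → s ≤ R + 1 → ‖b s‖ ≤ B := fun s h0 h1 => hB s ⟨h0, h1⟩
  have hB0 : 0 ≤ B := (norm_nonneg _).trans (hB' 0 le_rfl (by linarith))
  refine ⟨B * (R + 1) ^ 2 * C, by positivity, fun y hy u hu M hM => ?_⟩
  obtain ⟨hint, hle⟩ := hC y hy
  have hM0 := hM.nonneg hR
  have hdom : Integrable ((Metric.closedBall (0 : EuclideanSpace ℝ (Fin n)) R).indicator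
        (fun x => B * (R + 1) ^ 2 * M * (‖gam y x‖ ^ 3)⁻¹)) :=
    (integrable_indicator_iff Metric.isClosed_closedBall.measurableSet).2 (hint.const_mul _)
  have hbd := fun ε (hε : 0 ≤ ε) x => norm_weighted_le_cube hR hB' hk hu.eq_zero
    (fun x hx => hM.norm_le hx) hy hε x
  refine ⟨∫ x, weighted (sharpCut 0 b) (1 - k) u y x,
    tendsto_integral_filter_of_dominated_convergence _ ?_ ?_ hdom ?_, ?_⟩
  · exact Eventually.of_forall fun ε => (measurable_weighted (measurable_sharpCut hb ε) _
      hu.contDiff.continuous y).aestronglyMeasurable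
  · filter_upwards [self_mem_nhdsWithin] with ε hε
    exact Eventually.of_forall (hbd ε (le_of_lt hε))
  · exact Eventually.of_forall fun x => ((tendsto_sharpCut b (gam_re_nonneg y x)).mul_const
      _).mul_const _ |>.mul_const _
  · refine (norm_integral_le_of_norm_le hdom (Eventually.of_forall (hbd 0 le_rfl))).trans ?_
    rw [integral_indicator Metric.isClosed_closedBall.measurableSet, integral_const_mul]
    calc _ ≤ B * (R + 1) ^ 2 * M * C := by gcongr
      _ = _ := by ring

lemma DerivBound.reduceOne {N : ℕ} {R M : ℝ} (hR : 0 ≤ R) {u : EuclideanSpace ℝ (Fin n) → ℂ}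
    (hu : ContDiff ℝ ∞ u) (h : DerivBound (N + 1) R M u) (m : ℤ)
    {y : EuclideanSpace ℝ (Fin n)} (hy : ‖y‖ = 1) :
    DerivBound N R ((‖Complex.I * (2 * m + n - 1)‖ + (1 + 2 ^ N * (R + 1))) * M)
      (reduceOne m y u) := by
  have hd : ContDiff ℝ ∞ (_root_.dirDeriv y u) :=
    (hu.fderiv_right (m := ∞) (by simp)).clm_apply contDiff_const
  have hr : ContDiff ℝ ∞ (_root_.radialDeriv u) :=
    (hu.fderiv_right (m := ∞) (by simp)).clm_apply contDiff_id
  have h1 := (h.mono (Nat.le_succ N) le_rfl le_rfl).const_mul hu (Complex.I * (2 * m + n - 1))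
  have h2 := (h.dirDeriv hu y).const_mul hd (-1)
  have h3 := (h.radialDeriv hu hR).const_mul hr Complex.I
  refine (h1.add (h2.add h3 (contDiff_const.mul hd) (contDiff_const.mul hr))
    (contDiff_const.mul hu) ((contDiff_const.mul hd).add (contDiff_const.mul hr))).mono le_rfl
    le_rfl (le_of_eq ?_)
  rw [hy, Complex.norm_I, norm_neg, norm_one]; ring

lemma DerivBound.reduceTwo {N : ℕ} {R M : ℝ} (hR : 0 ≤ R) {u : EuclideanSpace ℝ (Fin n) → ℂ}
    (hu : ContDiff ℝ ∞ u) (h : DerivBound (N + 1) R M u) (m : ℤ) :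
    DerivBound N R ((‖Complex.I * (m + n - 1)‖ + 2 ^ N * (R + 1)) * M)
      (reduceTwo m u) := by
  have hr : ContDiff ℝ ∞ (_root_.radialDeriv u) :=
    (hu.fderiv_right (m := ∞) (by simp)).clm_apply contDiff_id
  have h1 := (h.mono (Nat.le_succ N) le_rfl le_rfl).const_mul hu (Complex.I * (m + n - 1))
  have h3 := (h.radialDeriv hu hR).const_mul hr Complex.I
  refine (h1.add h3 (contDiff_const.mul hu) (contDiff_const.mul hr)).mono le_rfl
    le_rfl (le_of_eq ?_)
  rw [Complex.norm_I]; ring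

/-- Strong induction on k: the reduction leads from k to k - 1 and k - 2 and consumes one derivative
of u, until k ≤ 2, where |γ|⁻³ dominates. The amplitude b changes at each step and is therefore
quantified inside the induction. -/
lemma exists_limit_weighted {R : ℝ} (hR : 0 ≤ R) (k : ℕ) :
    ∀ b : ℝ → ℂ, ContDiff ℝ ∞ b →
    ∃ (C : ℝ) (N : ℕ), 0 ≤ C ∧ ∀ y : EuclideanSpace ℝ (Fin n), ‖y‖ = 1 → ∀ u, IsTestOn R u →
      ∀ M, DerivBound N R M u → ∃ L, Tendsto
        (fun ε => ∫ x, weighted (sharpCut ε b) (1 - k) u y x) (𝓝[>] 0) (𝓝 L) ∧ ‖L‖ ≤ C * M := by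
  induction k using Nat.strong_induction_on with
  | _ k ih =>
    intro b hb
    by_cases hk : k ≤ 2
    · obtain ⟨C, hC, h⟩ := exists_limit_weighted_of_le_two (n := n) hR hb.continuous hk
      exact ⟨C, 0, hC, h⟩
    · have hinv : ContDiff ℝ ∞ fun s : ℝ => (((1 + s ^ 2 : ℝ)⁻¹ : ℝ) : ℂ) :=
        Complex.ofRealCLM.contDiff.comp
          ((contDiff_const.add (contDiff_id.pow 2)).inv fun s => by positivity)
      have hb2 : ContDiff ℝ ∞ fun s : ℝ => b s * (1 + s ^ 2 : ℝ)⁻¹ := by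
        simpa using hb.mul hinv
      have hb1 : ContDiff ℝ ∞ fun s : ℝ => b s * (1 + s ^ 2 : ℝ)⁻¹ * s :=
        hb2.mul Complex.ofRealCLM.contDiff
      obtain ⟨C1, N1, hC1, h1⟩ := ih (k - 1) (by omega) _ hb1
      obtain ⟨C2, N2, hC2, h2⟩ := ih (k - 2) (by omega) _ hb2
      -- Chosen so that m - 1 = 1 - k; here k ≥ 3, so the divisor m is nonzero.
      set m : ℤ := 2 - k
      have hm : m ≠ 0 := by omega
      set A1 : ℝ := ‖Complex.I * (2 * m + n - 1)‖ + (1 + 2 ^ N1 * (R + 1))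
      set A2 : ℝ := ‖Complex.I * (m + n - 1)‖ + 2 ^ N2 * (R + 1)
      refine ⟨‖(Complex.I * m)⁻¹‖ * (C1 * A1 + C2 * A2), max N1 N2 + 1, by positivity,
        fun y hy u hu M hM => ?_⟩
      obtain ⟨L1, ht1, hL1⟩ := h1 y hy _ (hu.reduceOne m y) _
        (DerivBound.reduceOne hR hu.contDiff
          (hM.mono (N' := N1 + 1) (by gcongr; exact le_max_left _ _) le_rfl le_rfl) m hy)
      obtain ⟨L2, ht2, hL2⟩ := h2 y hy _ (hu.reduceTwo m) _
        (DerivBound.reduceTwo hR hu.contDiff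
          (hM.mono (N' := N2 + 1) (by gcongr; exact le_max_right _ _) le_rfl le_rfl) m)
      refine ⟨(Complex.I * m)⁻¹ * (L1 - L2), ?_, ?_⟩
      · refine ((ht1.sub ht2).const_mul ((Complex.I * m)⁻¹)).congr' ?_
        filter_upwards [self_mem_nhdsWithin] with ε hε
        have e0 : (1 - k : ℤ) = m - 1 := by omega
        have e1 : (1 - ((k - 1 : ℕ) : ℤ)) = m := by omega
        have e2 : (1 - ((k - 2 : ℕ) : ℤ)) = m + 1 := by omega
        rw [e0, e1, e2, integral_weighted_reduce hb hε hm hu hy]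
      · rw [norm_mul, mul_assoc]
        refine mul_le_mul_of_nonneg_left ?_ (norm_nonneg _)
        refine (norm_sub_le _ _).trans ((add_le_add hL1 hL2).trans (le_of_eq ?_))
        ring

/-- The pairing of the regularized potential with `u`. -/
noncomputable def potentialPairing (ε : ℝ) (y : EuclideanSpace ℝ (Fin n))
    (u : EuclideanSpace ℝ (Fin n) → ℂ) : ℂ :=
  ∫ x, regularizedPotential ε (complexPoint x y) * u x

/-- From |γ|² = γ(2p - γ) one gets γ^(2-n) = (2p γ^(3-n) - γ^(4-n))/|γ|², which puts the potential
in the weighted form. -/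
lemma regularizedPotential_mul_eq (hn : 3 ≤ n) {ε : ℝ} (hε : 0 < ε)
    (y : EuclideanSpace ℝ (Fin n)) (u : EuclideanSpace ℝ (Fin n) → ℂ)
    (x : EuclideanSpace ℝ (Fin n)) :
    regularizedPotential ε (complexPoint x y) * u x =
      (sphereArea n : ℂ)⁻¹ / (2 - n) *
        (weighted (sharpCut ε fun s => 2 * s) (1 - (n - 2 : ℕ)) u y x -
          weighted (sharpCut ε fun _ => 1) (1 - (n - 3 : ℕ)) u y x) := by
  unfold regularizedPotential
  by_cases h : ε < (gam y x).re
  · have h0 := gam_ne_zero (hε.trans h)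
    rw [if_pos (by exact h)]
    have e1 : (1 - ((n - 2 : ℕ) : ℤ)) = (2 - n : ℤ) + 1 := by omega
    have e2 : (1 - ((n - 3 : ℕ) : ℤ)) = (2 - n : ℤ) + 1 + 1 := by omega
    have hnorm : ((‖gam y x‖ ^ 2 : ℝ) : ℂ) = gam y x * (2 * (gam y x).re - gam y x) := by
      rw [← Complex.normSq_eq_norm_sq, Complex.normSq_eq_conj_mul_self]
      have : (starRingEnd ℂ) (gam y x) = 2 * (gam y x).re - gam y x := by
        rw [eq_sub_iff_add_eq', Complex.add_conj]; push_cast; rfl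
      rw [this]; ring
    have hnn : ((‖gam y x‖ ^ 2 : ℝ) : ℂ) ≠ 0 := by
      simpa using h0
    simp only [holomorphicPotential, weighted, sharpCut, if_pos h, e1, e2, zpow_add_one₀ h0]
    change _ * (gam y x ^ (2 - (n : ℤ)) / _) * _ = _
    rw [Complex.ofReal_inv]
    have hkey : gam y x ^ (2 - (n : ℤ)) = (2 * (gam y x).re * (gam y x ^ (2 - (n : ℤ)) * gam y x) -
        gam y x ^ (2 - (n : ℤ)) * gam y x * gam y x) * ((‖gam y x‖ ^ 2 : ℝ) : ℂ)⁻¹ := by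
      rw [eq_mul_inv_iff_mul_eq₀ hnn, hnorm]; ring
    conv_lhs => rw [hkey]
    ring
  · rw [if_neg (by exact h)]
    simp [weighted, sharpCut, h]

lemma exists_limit_potentialPairing (hn : 3 ≤ n) {R : ℝ} (hR : 0 ≤ R) :
    ∃ (C : ℝ) (N : ℕ), 0 ≤ C ∧ ∀ y : EuclideanSpace ℝ (Fin n), ‖y‖ = 1 → ∀ u, IsTestOn R u →
      ∀ M, DerivBound N R M u → ∃ L, Tendsto
        (fun ε => potentialPairing ε y u) (𝓝[>] 0) (𝓝 L) ∧ ‖L‖ ≤ C * M := by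
  have hb1 : ContDiff ℝ ∞ fun s : ℝ => (2 * s : ℂ) := contDiff_const.mul Complex.ofRealCLM.contDiff
  have hb2 : ContDiff ℝ ∞ fun _ : ℝ => (1 : ℂ) := contDiff_const
  obtain ⟨C1, N1, hC1, h1⟩ := exists_limit_weighted (n := n) hR (n - 2) _ hb1
  obtain ⟨C2, N2, hC2, h2⟩ := exists_limit_weighted (n := n) hR (n - 3) _ hb2
  refine ⟨‖(sphereArea n : ℂ)⁻¹ / (2 - n)‖ * (C1 + C2), max N1 N2, by positivity,
    fun y hy u hu M hM => ?_⟩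
  obtain ⟨L1, ht1, hL1⟩ := h1 y hy u hu M (hM.mono (le_max_left _ _) le_rfl le_rfl)
  obtain ⟨L2, ht2, hL2⟩ := h2 y hy u hu M (hM.mono (le_max_right _ _) le_rfl le_rfl)
  refine ⟨(sphereArea n : ℂ)⁻¹ / (2 - n) * (L1 - L2), ?_, ?_⟩
  · refine ((ht1.sub ht2).const_mul ((sphereArea n : ℂ)⁻¹ / (2 - n))).congr' ?_
    filter_upwards [self_mem_nhdsWithin] with ε hε
    rw [potentialPairing]
    simp only [regularizedPotential_mul_eq hn hε]
    rw [integral_const_mul, integral_sub]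
    · exact integrable_weighted_sharpCut hb1.continuous hε _ hu.contDiff.continuous hu.eq_zero y
    · exact integrable_weighted_sharpCut hb2.continuous hε _ hu.contDiff.continuous hu.eq_zero y
  · rw [norm_mul, mul_assoc]
    refine mul_le_mul_of_nonneg_left ?_ (norm_nonneg _)
    refine (norm_sub_le _ _).trans ((add_le_add hL1 hL2).trans (le_of_eq ?_))
    ring

end Limits

/-! ### The Laplacian on test functions: linearity, dilations, derivative bounds. -/

section Laplacian

variable {n : ℕ}

/-- The Laplacian of a complex function on `ℝⁿ`. -/
noncomputable def lap (f : EuclideanSpace ℝ (Fin n) → ℂ) (x : EuclideanSpace ℝ (Fin n)) : ℂ :=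
  ∑ i, dirDeriv (EuclideanSpace.basisFun (Fin n) ℝ i)
    (dirDeriv (EuclideanSpace.basisFun (Fin n) ℝ i) f) x

lemma IsTestOn.lap {R : ℝ} {f : EuclideanSpace ℝ (Fin n) → ℂ} (hf : IsTestOn R f) :
    IsTestOn R (lap f) :=
  IsTestOn.sum _ fun _ => (hf.dirDeriv _).dirDeriv _

lemma contDiff_dirDeriv {E : Type*} [NormedAddCommGroup E] [NormedSpace ℝ E] {f : E → ℂ}
    (hf : ContDiff ℝ ∞ f) (v : E) : ContDiff ℝ ∞ (dirDeriv v f) :=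
  (hf.fderiv_right (m := ∞) (by simp)).clm_apply contDiff_const

lemma DerivBound.lap {N : ℕ} {R M : ℝ} {f : EuclideanSpace ℝ (Fin n) → ℂ}
    (hf : ContDiff ℝ ∞ f) (h : DerivBound (N + 2) R M f) : DerivBound N R (n * M) (lap f) := by
  have := DerivBound.sum (Finset.univ : Finset (Fin n)) (N := N) (R := R) (M := M)
    (f := fun i => _root_.dirDeriv (EuclideanSpace.basisFun (Fin n) ℝ i)
      (_root_.dirDeriv (EuclideanSpace.basisFun (Fin n) ℝ i) f)) (fun i => ?_)
    (fun i => contDiff_dirDeriv (contDiff_dirDeriv hf _) _)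
  · rwa [Finset.card_univ, Fintype.card_fin] at this
  · have h1 := DerivBound.dirDeriv (N := N) (h.dirDeriv hf (EuclideanSpace.basisFun (Fin n) ℝ i))
      (contDiff_dirDeriv hf _) (EuclideanSpace.basisFun (Fin n) ℝ i)
    rw [(EuclideanSpace.basisFun (Fin n) ℝ).norm_eq_one, one_mul, one_mul] at h1
    exact h1

lemma dirDeriv_add {E : Type*} [NormedAddCommGroup E] [NormedSpace ℝ E] {f g : E → ℂ}
    (hf : ContDiff ℝ ∞ f) (hg : ContDiff ℝ ∞ g) (v : E) :
    dirDeriv v (fun x => f x + g x) = fun x => dirDeriv v f x + dirDeriv v g x := by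
  ext x
  simp only [dirDeriv]
  rw [fderiv_fun_add (hf.differentiable (by simp) x) (hg.differentiable (by simp) x)]
  rfl

lemma dirDeriv_const_mul {E : Type*} [NormedAddCommGroup E] [NormedSpace ℝ E] {f : E → ℂ}
    (hf : ContDiff ℝ ∞ f) (c : ℂ) (v : E) :
    dirDeriv v (fun x => c * f x) = fun x => c * dirDeriv v f x := by
  ext x
  simp only [dirDeriv]
  rw [fderiv_const_mul (hf.differentiable (by simp) x)]
  rfl

lemma dirDeriv_comp_smul {E : Type*} [NormedAddCommGroup E] [NormedSpace ℝ E] {f : E → ℂ}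
    (hf : ContDiff ℝ ∞ f) (a : ℝ) (v : E) :
    dirDeriv v (fun x => f (a • x)) = fun x => (a : ℂ) * dirDeriv v f (a • x) := by
  ext x
  simp only [dirDeriv]
  have h1 : HasFDerivAt (fun x : E => a • x) (a • ContinuousLinearMap.id ℝ E) x :=
    (hasFDerivAt_id x).const_smul a
  have h2 := ((hf.differentiable (by simp) (a • x)).hasFDerivAt.comp x h1).fderiv
  refine (congrArg (fun L => L v) h2).trans ?_
  simp

lemma lap_add {f g : EuclideanSpace ℝ (Fin n) → ℂ} (hf : ContDiff ℝ ∞ f) (hg : ContDiff ℝ ∞ g) :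
    lap (fun x => f x + g x) = fun x => lap f x + lap g x := by
  ext x
  simp only [lap, dirDeriv_add hf hg, dirDeriv_add (contDiff_dirDeriv hf _)
    (contDiff_dirDeriv hg _), Finset.sum_add_distrib]

lemma lap_const_mul {f : EuclideanSpace ℝ (Fin n) → ℂ} (hf : ContDiff ℝ ∞ f) (c : ℂ) :
    lap (fun x => c * f x) = fun x => c * lap f x := by
  ext x
  simp only [lap, dirDeriv_const_mul hf, dirDeriv_const_mul (contDiff_dirDeriv hf _),
    Finset.mul_sum]

lemma lap_comp_smul {f : EuclideanSpace ℝ (Fin n) → ℂ} (hf : ContDiff ℝ ∞ f) (a : ℝ) :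
    lap (fun x => f (a • x)) = fun x => (a : ℂ) ^ 2 * lap f (a • x) := by
  ext x
  have h : ∀ v : EuclideanSpace ℝ (Fin n), dirDeriv v (fun x => (a : ℂ) * dirDeriv v f (a • x)) x =
      (a : ℂ) ^ 2 * dirDeriv v (dirDeriv v f) (a • x) := fun v => by
    have hs : ContDiff ℝ ∞ fun x => dirDeriv v f (a • x) :=
      (contDiff_dirDeriv hf v).comp (contDiff_const_smul a)
    rw [dirDeriv_const_mul hs, dirDeriv_comp_smul (contDiff_dirDeriv hf v)]
    ring
  simp only [lap, dirDeriv_comp_smul hf, h, Finset.mul_sum]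

end Laplacian

/-! ### Homogeneity under positive dilations. -/

section Scaling

variable {n : ℕ}

lemma gam_smul {a : ℝ} (ha : 0 < a) (y x : EuclideanSpace ℝ (Fin n)) :
    gam (a • y) (a • x) = a * gam y x := by
  have h : gamSq (a • y) (a • x) = ((a ^ 2 : ℝ) : ℂ) * gamSq y x := by
    simp only [gamSq, norm_smul, inner_smul_left, inner_smul_right, Real.norm_eq_abs, mul_pow,
      sq_abs]
    simp; ring
  rw [gam_eq_cpow, gam_eq_cpow, h]
  by_cases h0 : gamSq y x = 0
  · rw [h0, mul_zero, Complex.zero_cpow (by norm_num), mul_zero]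
  · have ha2 : ((a ^ 2 : ℝ) : ℂ) ≠ 0 := by
      simpa using ha.ne'
    rw [Complex.cpow_def_of_ne_zero (mul_ne_zero ha2 h0), Complex.cpow_def_of_ne_zero h0,
      Complex.log_ofReal_mul (by positivity) h0, add_mul, Complex.exp_add]
    congr 1
    rw [Real.log_pow]
    push_cast
    rw [show (2 : ℂ) * (Real.log a : ℂ) * (1 / 2) = (Real.log a : ℂ) by ring, ← Complex.ofReal_exp,
      Real.exp_log ha]

lemma regularizedPotential_smul {a : ℝ} (ha : 0 < a) (ε : ℝ) (y x : EuclideanSpace ℝ (Fin n)) :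
    regularizedPotential ε (complexPoint (a • x) (a • y)) =
      (a : ℂ) ^ (2 - (n : ℤ)) * regularizedPotential (ε / a) (complexPoint x y) := by
  have hg : complexLength (complexPoint (a • x) (a • y)) = a * complexLength (complexPoint x y) :=
    gam_smul ha y x
  unfold regularizedPotential holomorphicPotential
  rw [hg, Complex.re_ofReal_mul]
  have hiff : ε / a < (complexLength (complexPoint x y)).re ↔
      ε < a * (complexLength (complexPoint x y)).re := by
    rw [div_lt_iff₀' ha]
  by_cases h : ε < a * (complexLength (complexPoint x y)).re
  · rw [if_pos h, if_pos (hiff.2 h), mul_zpow]; ring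
  · rw [if_neg h, if_neg (mt hiff.1 h), mul_zero]

/-- The Jacobian a^n times the homogeneity factor a^(2-n) equals a², the factor in Δ(f(a x)).
Dilation changes only ε, which is immaterial in the limit, so a nonzero y may be normalized to
length one. -/
lemma potentialPairing_smul {a : ℝ} (ha : 0 < a) (ε : ℝ) (y : EuclideanSpace ℝ (Fin n))
    {f : EuclideanSpace ℝ (Fin n) → ℂ} (hf : ContDiff ℝ ∞ f) :
    potentialPairing ε (a • y) (lap f) =
      potentialPairing (ε / a) y (lap fun x => f (a • x)) := by
  have h := Measure.integral_comp_smul (volume : Measure (EuclideanSpace ℝ (Fin n)))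
    (fun x => regularizedPotential ε (complexPoint x (a • y)) * lap f x) a
  rw [finrank_euclideanSpace_fin, abs_of_pos (by positivity)] at h
  have hne : (a : ℂ) ≠ 0 := by exact_mod_cast ha.ne'
  have h2 : potentialPairing ε (a • y) (lap f) = (a : ℂ) ^ n *
      ∫ x, regularizedPotential ε (complexPoint (a • x) (a • y)) * lap f (a • x) := by
    rw [h, Complex.real_smul, potentialPairing]
    push_cast
    rw [← mul_assoc, mul_inv_cancel₀ (pow_ne_zero _ hne), one_mul]
  rw [h2, potentialPairing, ← integral_const_mul, lap_comp_smul hf]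
  refine integral_congr_ae (Eventually.of_forall fun x => ?_)
  dsimp only
  rw [regularizedPotential_smul ha]
  have : (a : ℂ) ^ n * (a : ℂ) ^ (2 - (n : ℤ)) = (a : ℂ) ^ 2 := by
    rw [← zpow_natCast, ← zpow_natCast, ← zpow_add₀ hne]; congr 1; push_cast; ring
  linear_combination (regularizedPotential (ε / a) (complexPoint x y) * lap f (a • x)) * this

end Scaling

/-! ### Harmonicity of γ^(2-n) off the branch cut. -/

section Harmonicity

variable {n : ℕ}

lemma continuous_mul_of_tsupport {X : Type*} [TopologicalSpace X] {G g : X → ℂ}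
    (hg : Continuous g) (hG : ∀ x ∈ tsupport g, ContinuousAt G x) :
    Continuous fun x => G x * g x := by
  rw [continuous_iff_continuousAt]
  intro x
  by_cases hx : x ∈ tsupport g
  · exact (hG x hx).mul hg.continuousAt
  · have : (fun x => G x * g x) =ᶠ[𝓝 x] fun _ => 0 := by
      filter_upwards [(isClosed_tsupport g).isOpen_compl.mem_nhds hx] with z hz
      rw [image_eq_zero_of_notMem_tsupport hz, mul_zero]
    exact continuousAt_const.congr this.symm

lemma tsupport_dirDeriv_subset {E : Type*} [NormedAddCommGroup E] [NormedSpace ℝ E] (v : E)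
    (f : E → ℂ) : tsupport (dirDeriv v f) ⊆ tsupport f :=
  tsupport_fderiv_apply_subset ℝ v

lemma integral_mul_dirDeriv {R : ℝ} {g : EuclideanSpace ℝ (Fin n) → ℂ} (hg : IsTestOn R g)
    {G G' : EuclideanSpace ℝ (Fin n) → ℂ} (v : EuclideanSpace ℝ (Fin n))
    (hG : ∀ x ∈ tsupport g, HasDerivAt (fun t : ℝ => G (x + t • v)) (G' x) 0)
    (hGc : ∀ x ∈ tsupport g, ContinuousAt G x) (hGc' : ∀ x ∈ tsupport g, ContinuousAt G' x) :
    ∫ x, G x * dirDeriv v g x = -∫ x, G' x * g x := by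
  have hgc := hg.hasCompactSupport
  have hdc := (hg.dirDeriv v).hasCompactSupport
  refine integral_bilinear_hasLineDerivAt_right_eq_neg_left_of_integrable (v := v)
    (B := ContinuousLinearMap.mul ℝ ℂ) (f := G) (f' := G') (g := g) (g' := dirDeriv v g)
    ?_ ?_ ?_ hG fun x _ => ?_
  · exact (continuous_mul_of_tsupport hg.contDiff.continuous
      hGc').integrable_of_hasCompactSupport hgc.mul_left
  · exact (continuous_mul_of_tsupport (hg.dirDeriv v).contDiff.continuous fun x hx =>
      hGc x (tsupport_dirDeriv_subset v g hx)).integrable_of_hasCompactSupport hdc.mul_left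
  · exact (continuous_mul_of_tsupport hg.contDiff.continuous
      hGc).integrable_of_hasCompactSupport hgc.mul_left
  · exact (hg.contDiff.differentiable (by simp) x).hasFDerivAt.hasLineDerivAt v

lemma cinner_basisFun (y x : EuclideanSpace ℝ (Fin n)) (i : Fin n) :
    cinner y x (EuclideanSpace.basisFun (Fin n) ℝ i) = complexPoint x y i := by
  simp only [cinner, complexPoint, EuclideanSpace.basisFun_apply, EuclideanSpace.inner_single_right]
  simp [mul_comm]

lemma continuous_cinner (y v : EuclideanSpace ℝ (Fin n)) : Continuous fun x => cinner y x v := by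
  unfold cinner; fun_prop

lemma hasDerivAt_gam_zpow' {y x : EuclideanSpace ℝ (Fin n)} (h : 0 < (gam y x).re) (m : ℤ)
    (v : EuclideanSpace ℝ (Fin n)) :
    HasDerivAt (fun t : ℝ => gam y (x + t • v) ^ m)
      (m * gam y x ^ (m - 2) * cinner y x v) 0 := by
  refine (hasDerivAt_gam_zpow h m v).congr_deriv ?_
  have h0 := gam_ne_zero h
  rw [show m - 1 = m - 2 + 1 by ring, zpow_add_one₀ h0]
  field_simp

lemma integral_gam_zpow_mul_dirDeriv {y : EuclideanSpace ℝ (Fin n)} {R : ℝ}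
    {g : EuclideanSpace ℝ (Fin n) → ℂ} (hg : IsTestOn R g)
    (hs : ∀ x ∈ tsupport g, 0 < (gam y x).re) (m : ℤ) (v : EuclideanSpace ℝ (Fin n)) :
    ∫ x, gam y x ^ m * dirDeriv v g x = -∫ x, m * gam y x ^ (m - 2) * cinner y x v * g x := by
  refine integral_mul_dirDeriv hg v (fun x hx => hasDerivAt_gam_zpow' (hs x hx) m v)
    (fun x hx => (contDiffAt_gam_zpow (hs x hx) m).continuousAt) fun x hx => ?_
  exact (continuousAt_const.mul (contDiffAt_gam_zpow (hs x hx) (m - 2)).continuousAt).mul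
    (continuous_cinner y v).continuousAt

lemma hasDerivAt_cinner (y x v : EuclideanSpace ℝ (Fin n)) (hv : ‖v‖ = 1) :
    HasDerivAt (fun t : ℝ => cinner y (x + t • v) v) 1 0 := by
  have h : ∀ t : ℝ, cinner y (x + t • v) v = cinner y x v + t := fun t => by
    simp only [cinner, inner_add_left, inner_smul_left, real_inner_self_eq_norm_sq, hv]
    simp; ring
  simp only [h]
  exact (Complex.ofRealCLM.hasDerivAt (x := (0 : ℝ))).const_add _

lemma integral_gam_zpow_mul_cinner_mul_dirDeriv {y : EuclideanSpace ℝ (Fin n)} {R : ℝ}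
    {g : EuclideanSpace ℝ (Fin n) → ℂ} (hg : IsTestOn R g)
    (hs : ∀ x ∈ tsupport g, 0 < (gam y x).re) (m : ℤ) {v : EuclideanSpace ℝ (Fin n)}
    (hv : ‖v‖ = 1) :
    ∫ x, (gam y x ^ m * cinner y x v) * dirDeriv v g x =
      -∫ x, (m * gam y x ^ (m - 2) * cinner y x v * cinner y x v + gam y x ^ m) * g x := by
  refine integral_mul_dirDeriv hg v (fun x hx => ?_)
    (fun x hx => (contDiffAt_gam_zpow (hs x hx) m).continuousAt.mul
      (continuous_cinner y v).continuousAt) fun x hx => ?_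
  · refine ((hasDerivAt_gam_zpow' (hs x hx) m v).mul (hasDerivAt_cinner y x v hv)).congr_deriv ?_
    simp
  · exact (((continuousAt_const.mul (contDiffAt_gam_zpow (hs x hx) (m - 2)).continuousAt).mul
      (continuous_cinner y v).continuousAt).mul (continuous_cinner y v).continuousAt).add
      (contDiffAt_gam_zpow (hs x hx) m).continuousAt

/-- Only one of the two integrations by parts, so only the first derivatives of f must be supported
where p > 0. The cutoff that is constant near the branch set satisfies this. -/
lemma integral_gam_zpow_mul_lap {y : EuclideanSpace ℝ (Fin n)} {R : ℝ}
    {f : EuclideanSpace ℝ (Fin n) → ℂ} (hf : IsTestOn R f)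
    (hs : ∀ i, ∀ x ∈ tsupport (dirDeriv (EuclideanSpace.basisFun (Fin n) ℝ i) f),
      0 < (gam y x).re) (m : ℤ) :
    ∫ x, gam y x ^ m * lap f x = -m * ∑ i, ∫ x, (gam y x ^ (m - 2) *
      cinner y x (EuclideanSpace.basisFun (Fin n) ℝ i)) *
        dirDeriv (EuclideanSpace.basisFun (Fin n) ℝ i) f x := by
  simp only [lap, Finset.mul_sum]
  rw [integral_finsetSum]
  · refine Finset.sum_congr rfl fun i _ => ?_
    rw [integral_gam_zpow_mul_dirDeriv (hf.dirDeriv _) (hs i), ← integral_const_mul,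
      ← integral_neg]
    refine integral_congr_ae (Eventually.of_forall fun x => ?_)
    dsimp only
    ring
  · intro i _
    have h2 := (hf.dirDeriv (EuclideanSpace.basisFun (Fin n) ℝ i)).dirDeriv
      (EuclideanSpace.basisFun (Fin n) ℝ i)
    exact (continuous_mul_of_tsupport h2.contDiff.continuous fun x hx =>
      (contDiffAt_gam_zpow (hs i x (tsupport_dirDeriv_subset _ _ hx))
        m).continuousAt).integrable_of_hasCompactSupport h2.hasCompactSupport.mul_left

/-- After the second integration by parts the sum over i is -n γ^(-n-2) Σ z_i² + n γ^(-n), which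
vanishes because Σ z_i² = γ². -/
lemma integral_gam_zpow_mul_lap_eq_zero {y : EuclideanSpace ℝ (Fin n)} {R : ℝ}
    {f : EuclideanSpace ℝ (Fin n) → ℂ} (hf : IsTestOn R f)
    (hs : ∀ x ∈ tsupport f, 0 < (gam y x).re) :
    ∫ x, gam y x ^ (2 - n : ℤ) * lap f x = 0 := by
  rw [integral_gam_zpow_mul_lap hf fun i x hx => hs x (tsupport_dirDeriv_subset _ _ hx)]
  refine mul_eq_zero_of_right _ ?_
  simp only [integral_gam_zpow_mul_cinner_mul_dirDeriv hf hs _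
    ((EuclideanSpace.basisFun (Fin n) ℝ).norm_eq_one _)]
  rw [Finset.sum_neg_distrib, ← integral_finsetSum]
  · rw [neg_eq_zero, ← integral_zero (EuclideanSpace ℝ (Fin n)) ℂ]
    refine integral_congr_ae (Eventually.of_forall fun x => ?_)
    dsimp only
    by_cases hx : x ∈ tsupport f
    · rw [← Finset.sum_mul, Finset.sum_add_distrib]
      simp only [mul_assoc, ← Finset.mul_sum, cinner_basisFun]
      have h0 := gam_ne_zero (hs x hx)
      have hsq : ∑ i, complexPoint x y i * complexPoint x y i = gam y x ^ 2 := by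
        rw [gam_sq, ← sum_complexPoint_sq]; simp only [pow_two]
      rw [hsq, ← zpow_natCast _ 2, ← zpow_add₀ h0]
      simp
    · simp [image_eq_zero_of_notMem_tsupport hx]
  · intro i _
    refine (continuous_mul_of_tsupport hf.contDiff.continuous fun x hx =>
      ?_).integrable_of_hasCompactSupport hf.hasCompactSupport.mul_left
    exact (((continuousAt_const.mul (contDiffAt_gam_zpow (hs x hx) _).continuousAt).mul
      (continuous_cinner y _).continuousAt).mul (continuous_cinner y _).continuousAt).add
      (contDiffAt_gam_zpow (hs x hx) _).continuousAt

/-- p² ≥ ‖x‖² - ‖y‖² ≥ 3. Hence for ε < 1 both the branch set and the truncated region lie in the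
ball of radius 2. -/
lemma one_lt_gam_re {y x : EuclideanSpace ℝ (Fin n)} (hy : ‖y‖ ≤ 1) (hx : 2 ≤ ‖x‖) :
    1 < (gam y x).re := by
  have h := gam_re_sq_sub_im_sq y x
  have h0 := gam_re_nonneg y x
  nlinarith [sq_nonneg (gam y x).im, norm_nonneg y]

lemma two_le_norm_of_mem_tsupport {g : EuclideanSpace ℝ (Fin n) → ℂ}
    (h : ∀ x, ‖x‖ < 2 → g x = 0) {x : EuclideanSpace ℝ (Fin n)} (hx : x ∈ tsupport g) :
    2 ≤ ‖x‖ := by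
  have hcl : IsClosed {x : EuclideanSpace ℝ (Fin n) | 2 ≤ ‖x‖} :=
    isClosed_le continuous_const continuous_norm
  refine closure_minimal (fun z hz => ?_) hcl hx
  by_contra hlt
  exact hz (h z (not_le.1 hlt))

lemma lap_eq_zero_of_const {g : EuclideanSpace ℝ (Fin n) → ℂ} {c : ℂ}
    (h : ∀ x, ‖x‖ < 2 → g x = c) (x : EuclideanSpace ℝ (Fin n)) (hx : ‖x‖ < 2) : lap g x = 0 := by
  have h1 : ∀ (g : EuclideanSpace ℝ (Fin n) → ℂ) (c : ℂ), (∀ x, ‖x‖ < 2 → g x = c) →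
      ∀ v x, ‖x‖ < 2 → dirDeriv v g x = 0 := fun g c h v x hx => by
    have : g =ᶠ[𝓝 x] fun _ => c := by
      filter_upwards [(isOpen_lt continuous_norm continuous_const).mem_nhds hx] with z hz
      exact h z hz
    rw [dirDeriv, this.fderiv_eq]; simp
  exact Finset.sum_eq_zero fun i _ => h1 _ 0 (h1 g c h _) _ x hx

lemma potentialPairing_lap_of_const {g : EuclideanSpace ℝ (Fin n) → ℂ} {c : ℂ}
    (h : ∀ x, ‖x‖ < 2 → g x = c) {y : EuclideanSpace ℝ (Fin n)} (hy : ‖y‖ ≤ 1) {ε : ℝ}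
    (hε : ε < 1) :
    potentialPairing ε y (lap g) = (sphereArea n : ℂ)⁻¹ / (2 - n) *
      ∫ x, gam y x ^ (2 - n : ℤ) * lap g x := by
  rw [potentialPairing, ← integral_const_mul]
  refine integral_congr_ae (Eventually.of_forall fun x => ?_)
  dsimp only
  by_cases hx : ‖x‖ < 2
  · rw [lap_eq_zero_of_const h x hx]; simp
  · have hp : ε < (gam y x).re := hε.trans (one_lt_gam_re hy (not_lt.1 hx))
    rw [regularizedPotential, if_pos (by exact hp), holomorphicPotential]
    change _ * (gam y x ^ _ / _) * _ = _
    ring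

lemma potentialPairing_lap_eq_zero {R : ℝ} {f : EuclideanSpace ℝ (Fin n) → ℂ} (hf : IsTestOn R f)
    (h : ∀ x, ‖x‖ < 2 → f x = 0) {y : EuclideanSpace ℝ (Fin n)} (hy : ‖y‖ ≤ 1) {ε : ℝ}
    (hε : ε < 1) : potentialPairing ε y (lap f) = 0 := by
  rw [potentialPairing_lap_of_const h hy hε, integral_gam_zpow_mul_lap_eq_zero hf, mul_zero]
  exact fun x hx => zero_lt_one.trans (one_lt_gam_re hy (two_le_norm_of_mem_tsupport h hx))

end Harmonicity

/-! ### The case y = 0: the real Newtonian potential. -/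

section RealPoint

variable {n : ℕ}

lemma gam_zero (x : EuclideanSpace ℝ (Fin n)) : gam 0 x = ‖x‖ := by
  have h1 := gam_re_sq_sub_im_sq 0 x
  have h2 := gam_re_mul_im 0 x
  have h3 := gam_re_nonneg 0 x
  rw [inner_zero_right, mul_eq_zero] at h2
  rw [norm_zero] at h1
  have him : (gam 0 x).im = 0 := by
    rcases h2 with h | h
    · rw [h] at h1; nlinarith [sq_nonneg ‖x‖, sq_nonneg (gam 0 x).im]
    · exact h
  have hre : (gam 0 x).re = ‖x‖ := by
    rw [him] at h1
    refine (pow_left_inj₀ h3 (norm_nonneg x) two_ne_zero).1 (by linarith)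
  exact Complex.ext (by simp [hre]) (by simp [him])

/-- In polar coordinates r^(n-1) r^(2-n) = r. -/
lemma integrableOn_norm_zpow (hn : 3 ≤ n) (R : ℝ) :
    Integrable fun x : EuclideanSpace ℝ (Fin n) =>
      (Set.Iic R).indicator (fun r : ℝ => r ^ (2 - n : ℤ)) ‖x‖ := by
  have : Nonempty (Fin n) := ⟨⟨0, by omega⟩⟩
  have : Nontrivial (EuclideanSpace ℝ (Fin n)) := inferInstance
  rw [integrable_fun_norm_addHaar (volume : Measure (EuclideanSpace ℝ (Fin n)))
    (f := (Set.Iic R).indicator (fun r : ℝ => r ^ (2 - n : ℤ))), finrank_euclideanSpace_fin]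
  have h : IntegrableOn (fun r : ℝ => r) (Set.Ioc 0 R) :=
    (continuous_id.integrableOn_Icc).mono_set Set.Ioc_subset_Icc_self
  have h2 : IntegrableOn ((Set.Iic R).indicator fun r : ℝ => r) (Set.Ioi 0) := by
    rw [IntegrableOn, integrable_indicator_iff measurableSet_Iic, IntegrableOn,
      Measure.restrict_restrict measurableSet_Iic, Set.inter_comm, Set.Ioi_inter_Iic]
    exact h
  refine h2.congr_fun (fun r hr => ?_) measurableSet_Ioi
  by_cases hrR : r ∈ Set.Iic R
  · simp only [Set.indicator_of_mem hrR, smul_eq_mul]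
    rw [← zpow_natCast, ← zpow_add₀ (ne_of_gt hr)]
    rw [show ((n - 1 : ℕ) : ℤ) + (2 - n) = 1 by omega, zpow_one]
  · simp [Set.indicator_of_notMem hrR]

lemma regularizedPotential_eq (ε : ℝ) (y x : EuclideanSpace ℝ (Fin n)) :
    regularizedPotential ε (complexPoint x y) =
      sharpCut ε (fun _ => (sphereArea n : ℂ)⁻¹ * (gam y x ^ (2 - n : ℤ) / (2 - n)))
        (gam y x).re := rfl

lemma measurable_regularizedPotential (ε : ℝ) (y : EuclideanSpace ℝ (Fin n)) :
    Measurable fun x => regularizedPotential ε (complexPoint x y) := by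
  refine Measurable.ite (measurableSet_lt measurable_const
    (Complex.measurable_re.comp (measurable_gam y))) ?_ measurable_const
  exact ((measurable_gam_zpow y _).div_const _).const_mul _

/-- The singularity ‖x‖^(2-n) is already integrable, so dominated convergence suffices and no
derivative of u enters. -/
lemma exists_limit_potentialPairing_zero (hn : 3 ≤ n) (R : ℝ) :
    ∃ C : ℝ, 0 ≤ C ∧ ∀ u : EuclideanSpace ℝ (Fin n) → ℂ, IsTestOn R u →
      ∀ M, DerivBound 0 R M u → 0 ≤ M → ∃ L, Tendsto
        (fun ε => potentialPairing ε 0 u) (𝓝[>] 0) (𝓝 L) ∧ ‖L‖ ≤ C * M := by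
  have hint := integrableOn_norm_zpow hn R
  set κ := ‖(sphereArea n : ℂ)⁻¹ / (2 - n)‖
  refine ⟨κ * ∫ x : EuclideanSpace ℝ (Fin n), (Set.Iic R).indicator
    (fun r : ℝ => r ^ (2 - n : ℤ)) ‖x‖, ?_, fun u hu M hM hM0 => ?_⟩
  · refine mul_nonneg (norm_nonneg _) (integral_nonneg fun x => ?_)
    exact Set.indicator_apply_nonneg fun _ => zpow_nonneg (norm_nonneg x) _
  · have hbd : ∀ ε, ∀ x : EuclideanSpace ℝ (Fin n),
        ‖regularizedPotential ε (complexPoint x 0) * u x‖ ≤ κ * M * (Set.Iic R).indicator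
          (fun r : ℝ => r ^ (2 - n : ℤ)) ‖x‖ := by
      intro ε x
      by_cases hx : ‖x‖ ≤ R
      · rw [Set.indicator_of_mem (by exact hx), norm_mul]
        have h1 := norm_sharpCut_le ε (fun _ => (sphereArea n : ℂ)⁻¹ *
          (gam 0 x ^ (2 - n : ℤ) / (2 - n))) (gam 0 x).re
        rw [← regularizedPotential_eq] at h1
        have h2 : ‖(sphereArea n : ℂ)⁻¹ * (gam 0 x ^ (2 - n : ℤ) / (2 - n))‖ =
            κ * ‖x‖ ^ (2 - n : ℤ) := by
          rw [gam_zero, mul_div_left_comm, norm_mul, norm_zpow, Complex.norm_real, norm_norm,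
            mul_comm]
        rw [h2] at h1
        have h3 := hM.norm_le hx
        calc _ ≤ κ * ‖x‖ ^ (2 - n : ℤ) * M := by gcongr
          _ = _ := by ring
      · rw [Set.indicator_of_notMem (by exact hx), hu.eq_zero x (not_le.1 hx)]
        simp
    have hdom := hint.const_mul (κ * M)
    refine ⟨potentialPairing 0 0 u, tendsto_integral_filter_of_dominated_convergence _ ?_ ?_ hdom
      ?_, ?_⟩
    · exact Eventually.of_forall fun ε => ((measurable_regularizedPotential ε 0).mul
        hu.contDiff.continuous.measurable).aestronglyMeasurable
    · exact Eventually.of_forall fun ε => Eventually.of_forall (hbd ε)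
    · refine Eventually.of_forall fun x => ?_
      simp only [regularizedPotential_eq]
      exact (tendsto_sharpCut _ (gam_re_nonneg 0 x)).mul_const _
    · refine (norm_integral_le_of_norm_le hdom (Eventually.of_forall (hbd 0))).trans ?_
      rw [integral_const_mul]
      exact le_of_eq (by ring)

end RealPoint

/-! ### The normalization: total flux one of the Newtonian potential. -/

section Flux

variable {n : ℕ}

/-- A smooth profile that is `1` below `4` and `0` above `9`. -/
noncomputable def profile (s : ℝ) : ℝ := 1 - Real.smoothTransition ((s - 4) / 5)

lemma contDiff_profile : ContDiff ℝ ∞ profile :=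
  contDiff_const.sub (Real.smoothTransition.contDiff.comp
    ((contDiff_id.sub contDiff_const).div_const _))

lemma profile_eq_one {s : ℝ} (h : s ≤ 4) : profile s = 1 := by
  rw [profile, Real.smoothTransition.zero_of_nonpos (by linarith), sub_zero]

lemma profile_eq_zero {s : ℝ} (h : 9 ≤ s) : profile s = 0 := by
  rw [profile, Real.smoothTransition.one_of_one_le (by linarith), sub_self]

/-- A radial cutoff function that is `1` on the ball of radius `2` and `0` off the ball of
radius `3`. -/
noncomputable def cutoff (x : EuclideanSpace ℝ (Fin n)) : ℂ := (profile (‖x‖ ^ 2) : ℂ)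

lemma isTestOn_cutoff : IsTestOn 3 (cutoff (n := n)) :=
  ⟨Complex.ofRealCLM.contDiff.comp (contDiff_profile.comp (contDiff_norm_sq ℝ)), fun x hx => by
    rw [cutoff, profile_eq_zero (by nlinarith), Complex.ofReal_zero]⟩

lemma cutoff_eq_one {x : EuclideanSpace ℝ (Fin n)} (hx : ‖x‖ < 2) : cutoff x = 1 := by
  rw [cutoff, profile_eq_one (by nlinarith [norm_nonneg x]), Complex.ofReal_one]

lemma dirDeriv_cutoff (v x : EuclideanSpace ℝ (Fin n)) :
    dirDeriv v cutoff x = ((deriv profile (‖x‖ ^ 2) * (2 * ⟪x, v⟫_ℝ) : ℝ) : ℂ) := by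
  refine fderiv_apply_eq_of_hasDerivAt (isTestOn_cutoff.contDiff.differentiable (by simp) x) ?_
  have h1 : HasDerivAt (fun t : ℝ => ‖x + t • v‖ ^ 2) (2 * ⟪x, v⟫_ℝ) 0 := by
    simpa using hasDerivAt_normSq_sub 0 x v
  have h2 : HasDerivAt profile (deriv profile (‖x + (0 : ℝ) • v‖ ^ 2)) (‖x + (0 : ℝ) • v‖ ^ 2) :=
    (contDiff_profile.differentiable (by simp)).differentiableAt.hasDerivAt
  have h3 := (HasDerivAt.comp (0 : ℝ) h2 h1).ofReal_comp
  refine h3.congr_deriv ?_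
  simp

lemma tsupport_dirDeriv_cutoff {v x : EuclideanSpace ℝ (Fin n)}
    (hx : x ∈ tsupport (dirDeriv v cutoff)) : 2 ≤ ‖x‖ := by
  refine two_le_norm_of_mem_tsupport (fun z hz => ?_) hx
  have : (cutoff (n := n)) =ᶠ[𝓝 z] fun _ => 1 := by
    filter_upwards [(isOpen_lt continuous_norm continuous_const).mem_nhds hz] with w hw
    exact cutoff_eq_one hw
  rw [dirDeriv, this.fderiv_eq]; simp

lemma integral_radial_profile :
    ∫ r in Set.Ioi (0 : ℝ), 2 * r * deriv profile (r ^ 2) = -1 := by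
  have hd : ∀ r : ℝ, HasDerivAt (fun r : ℝ => profile (r ^ 2)) (2 * r * deriv profile (r ^ 2)) r := by
    intro r
    have h2 : HasDerivAt profile (deriv profile (r ^ 2)) (r ^ 2) :=
      (contDiff_profile.differentiable (by simp)).differentiableAt.hasDerivAt
    have h3 := HasDerivAt.comp (h := fun r : ℝ => r ^ 2) r h2 (hasDerivAt_pow 2 r)
    refine h3.congr_deriv ?_
    simp; ring
  have hz : ∀ r : ℝ, 3 < r → deriv profile (r ^ 2) = 0 := fun r hr => by
    have : profile =ᶠ[𝓝 (r ^ 2)] fun _ => 0 := by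
      filter_upwards [Ioi_mem_nhds (show 9 < r ^ 2 by nlinarith)] with s hs
      exact profile_eq_zero (le_of_lt hs)
    rw [this.deriv_eq]; simp
  have hc : Continuous fun r : ℝ => 2 * r * deriv profile (r ^ 2) :=
    (continuous_const.mul continuous_id).mul
      ((contDiff_profile.continuous_deriv (by simp)).comp (continuous_pow 2))
  have hi : IntegrableOn (fun r : ℝ => 2 * r * deriv profile (r ^ 2)) (Set.Ioi 0) := by
    refine IntegrableOn.of_forall_sdiff_eq_zero (s := Set.Icc 0 3) hc.integrableOn_Icc
      measurableSet_Ioi fun r hr => ?_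
    rw [hz r, mul_zero]
    by_contra h
    exact hr.2 ⟨le_of_lt hr.1, not_lt.1 h⟩
  have ht : Tendsto (fun r : ℝ => profile (r ^ 2)) atTop (𝓝 0) := by
    refine tendsto_const_nhds.congr' ?_
    filter_upwards [eventually_ge_atTop 3] with r hr
    exact (profile_eq_zero (by nlinarith)).symm
  rw [integral_Ioi_of_hasDerivAt_of_tendsto' (fun r _ => hd r) hi ht, profile_eq_one (by norm_num)]
  norm_num

lemma sphereArea_eq (hn : 3 ≤ n) :
    sphereArea n = n * (volume : Measure (EuclideanSpace ℝ (Fin n))).real (Metric.ball 0 1) := by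
  have : Nonempty (Fin n) := ⟨⟨0, by omega⟩⟩
  have hn0 : (0 : ℝ) < n := by positivity
  have hG : Real.Gamma ((n : ℝ) / 2) ≠ 0 := (Real.Gamma_pos_of_pos (by positivity)).ne'
  rw [Measure.real, EuclideanSpace.volume_ball, Fintype.card_fin, ENNReal.ofReal_one, one_pow,
    one_mul, ENNReal.toReal_ofReal (div_nonneg (by positivity)
      (Real.Gamma_pos_of_pos (by positivity)).le), Real.Gamma_add_one (by positivity), sphereArea]
  have : √Real.pi ^ n = Real.pi ^ ((n : ℝ) / 2) := by
    rw [Real.sqrt_eq_rpow, ← Real.rpow_natCast, ← Real.rpow_mul Real.pi_pos.le]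
    congr 1; ring
  rw [this]
  field_simp

lemma sphereArea_pos (hn : 3 ≤ n) : 0 < sphereArea n := by
  have : (0 : ℝ) < n / 2 := by positivity
  exact div_pos (mul_pos two_pos (Real.rpow_pos_of_pos Real.pi_pos _)) (Real.Gamma_pos_of_pos this)

/-- One integration by parts leaves a radial integrand. In polar coordinates it is the derivative of
r ↦ `profile (r ^ 2)`, with integral -1, times n vol(B) = ω_n. -/
lemma integral_norm_zpow_mul_lap_cutoff (hn : 3 ≤ n) :
    ∫ x : EuclideanSpace ℝ (Fin n), gam 0 x ^ (2 - n : ℤ) * lap cutoff x =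
      (2 - n) * sphereArea n := by
  have : Nonempty (Fin n) := ⟨⟨0, by omega⟩⟩
  have : Nontrivial (EuclideanSpace ℝ (Fin n)) := inferInstance
  have hs : ∀ i, ∀ x ∈ tsupport (dirDeriv (EuclideanSpace.basisFun (Fin n) ℝ i) cutoff),
      0 < (gam 0 x).re := fun i x hx =>
    zero_lt_one.trans (one_lt_gam_re (by simp) (tsupport_dirDeriv_cutoff hx))
  rw [integral_gam_zpow_mul_lap isTestOn_cutoff hs, ← integral_finsetSum]
  · have e : ∀ x : EuclideanSpace ℝ (Fin n), ∑ i, (gam 0 x ^ (2 - (n : ℤ) - 2) *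
        cinner 0 x (EuclideanSpace.basisFun (Fin n) ℝ i)) *
        dirDeriv (EuclideanSpace.basisFun (Fin n) ℝ i) cutoff x =
        ((fun r : ℝ => r ^ (-(n : ℤ)) * (2 * r ^ 2 * deriv profile (r ^ 2))) ‖x‖ : ℝ) := by
      intro x
      have hsum : ‖x‖ ^ 2 = ∑ i, ⟪x, EuclideanSpace.basisFun (Fin n) ℝ i⟫_ℝ ^ 2 := by
        rw [EuclideanSpace.norm_sq_eq]
        refine Finset.sum_congr rfl fun i _ => ?_
        simp [EuclideanSpace.basisFun_apply, EuclideanSpace.inner_single_right]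
      simp only [dirDeriv_cutoff, cinner, inner_zero_left, gam_zero]
      rw [show (2 - (n : ℤ) - 2) = -n by ring]
      have : (‖x‖ : ℝ) ^ (-(n : ℤ)) * (2 * ‖x‖ ^ 2 * deriv profile (‖x‖ ^ 2)) =
          ∑ i, ‖x‖ ^ (-(n : ℤ)) * ⟪x, EuclideanSpace.basisFun (Fin n) ℝ i⟫_ℝ *
            (deriv profile (‖x‖ ^ 2) * (2 * ⟪x, EuclideanSpace.basisFun (Fin n) ℝ i⟫_ℝ)) := by
        have h2 : ‖x‖ ^ (-(n : ℤ)) * (2 * ‖x‖ ^ 2 * deriv profile (‖x‖ ^ 2)) =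
            (2 * ‖x‖ ^ (-(n : ℤ)) * deriv profile (‖x‖ ^ 2)) * ‖x‖ ^ 2 := by ring
        rw [h2]
        conv_lhs => rw [hsum]
        rw [Finset.mul_sum]
        simp only [← hsum]
        refine Finset.sum_congr rfl fun i _ => by ring
      rw [this]
      push_cast
      simp
    simp only [e]
    rw [integral_complex_ofReal, integral_fun_norm_addHaar
      (volume : Measure (EuclideanSpace ℝ (Fin n)))
      (fun r : ℝ => r ^ (-(n : ℤ)) * (2 * r ^ 2 * deriv profile (r ^ 2))),
      finrank_euclideanSpace_fin]
    have hr : ∫ r in Set.Ioi (0 : ℝ), r ^ (n - 1) • (r ^ (-(n : ℤ)) *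
        (2 * r ^ 2 * deriv profile (r ^ 2))) = -1 := by
      rw [← integral_radial_profile]
      refine setIntegral_congr_fun measurableSet_Ioi fun r hr => ?_
      have hr0 : r ≠ 0 := ne_of_gt hr
      have : r ^ (n - 1) * r ^ (-(n : ℤ)) = r⁻¹ := by
        rw [← zpow_natCast, ← zpow_add₀ hr0, ← zpow_neg_one]; congr 1; omega
      simp only [smul_eq_mul]
      rw [← mul_assoc, this]
      field_simp
    rw [hr, sphereArea_eq hn]
    simp only [smul_eq_mul, nsmul_eq_mul]
    push_cast
    ring
  · intro i _
    have h2 := isTestOn_cutoff.dirDeriv (EuclideanSpace.basisFun (Fin n) ℝ i)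
    exact (continuous_mul_of_tsupport h2.contDiff.continuous fun x hx =>
      (contDiffAt_gam_zpow (hs i x hx) _).continuousAt.mul
      (continuous_cinner 0 _).continuousAt).integrable_of_hasCompactSupport
      h2.hasCompactSupport.mul_left

lemma tendsto_gam_zero {x : EuclideanSpace ℝ (Fin n)} (hx : x ≠ 0) :
    Tendsto (fun y => gam y x) (𝓝 0) (𝓝 (gam 0 x)) := by
  have hs : gamSq 0 x ∈ Complex.slitPlane := by
    refine gamSq_mem_slitPlane ?_
    rw [gam_zero]; simpa using hx
  have hc : Continuous fun y : EuclideanSpace ℝ (Fin n) => gamSq y x := by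
    unfold gamSq; fun_prop
  simp only [gam_eq_cpow]
  exact (continuousAt_cpow_const hs).tendsto.comp (hc.tendsto 0)

/-- The Laplacian of the cutoff vanishes for ‖x‖ < 2, and for ‖x‖ ≥ 2, ‖y‖ ≤ 1 one has |γ| ≥ 1 with
exponent 2 - n ≤ 0. So the Laplacian itself dominates the integrand. -/
lemma tendsto_flux (hn : 3 ≤ n) :
    Tendsto (fun y : EuclideanSpace ℝ (Fin n) => (sphereArea n : ℂ)⁻¹ / (2 - n) *
      ∫ x, gam y x ^ (2 - n : ℤ) * lap cutoff x) (𝓝 0) (𝓝 1) := by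
  have hlap := (isTestOn_cutoff (n := n)).lap
  have h : Tendsto (fun y : EuclideanSpace ℝ (Fin n) =>
      ∫ x, gam y x ^ (2 - n : ℤ) * lap cutoff x) (𝓝 0)
      (𝓝 (∫ x : EuclideanSpace ℝ (Fin n), gam 0 x ^ (2 - n : ℤ) * lap cutoff x)) := by
    refine tendsto_integral_filter_of_dominated_convergence (fun x => ‖lap cutoff x‖) ?_ ?_
      (hlap.contDiff.continuous.integrable_of_hasCompactSupport hlap.hasCompactSupport).norm ?_
    · exact Eventually.of_forall fun y => ((measurable_gam_zpow y _).mul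
        hlap.contDiff.continuous.measurable).aestronglyMeasurable
    · filter_upwards [Metric.closedBall_mem_nhds (0 : EuclideanSpace ℝ (Fin n)) one_pos] with y hy
      refine Eventually.of_forall fun x => ?_
      have hy' : ‖y‖ ≤ 1 := by simpa using hy
      by_cases hx : ‖x‖ < 2
      · rw [lap_eq_zero_of_const (fun z hz => cutoff_eq_one hz) x hx]; simp
      · rw [norm_mul, norm_zpow]
        have h1 : 1 ≤ ‖gam y x‖ :=
          ((one_lt_gam_re hy' (not_lt.1 hx)).trans_le (gam_re_le_norm y x)).le
        exact mul_le_of_le_one_left (norm_nonneg _) (zpow_le_one_of_nonpos₀ h1 (by omega))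
    · refine Eventually.of_forall fun x => ?_
      by_cases hx : ‖x‖ < 2
      · rw [lap_eq_zero_of_const (fun z hz => cutoff_eq_one hz) x hx]; simp
      · have hx0 : x ≠ 0 := by rintro rfl; simp at hx
        have hg0 : gam 0 x ≠ 0 := by rw [gam_zero]; simpa using hx0
        exact (((continuousAt_zpow₀ _ _ (Or.inl hg0)).tendsto).comp
          (tendsto_gam_zero hx0)).mul_const _
  have h2 := h.const_mul ((sphereArea n : ℂ)⁻¹ / (2 - n))
  rw [integral_norm_zpow_mul_lap_cutoff hn] at h2
  have hs : (sphereArea n : ℂ) ≠ 0 := by exact_mod_cast (sphereArea_pos hn).ne'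
  have hn2 : (2 - n : ℂ) ≠ 0 := by
    rw [sub_ne_zero]; norm_cast; omega
  rwa [show (sphereArea n : ℂ)⁻¹ / (2 - n) * ((2 - n) * sphereArea n) = 1 by field_simp] at h2

end Flux

/-! ### The limit for every y, and its behaviour as y → 0. -/

section SingularSource

variable {n : ℕ}

lemma integrable_regularizedPotential_mul (hn : 3 ≤ n) {ε : ℝ} (hε : 0 < ε)
    (y : EuclideanSpace ℝ (Fin n)) {R : ℝ} {u : EuclideanSpace ℝ (Fin n) → ℂ}
    (hu : IsTestOn R u) : Integrable fun x => regularizedPotential ε (complexPoint x y) * u x := by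
  have h := (locallyIntegrable_regularizedPotential (by omega : 2 ≤ n) hε
    y).integrable_smul_left_of_hasCompactSupport hu.contDiff.continuous hu.hasCompactSupport
  simpa only [smul_eq_mul, mul_comm] using h

lemma potentialPairing_lap_add (hn : 3 ≤ n) {ε : ℝ} (hε : 0 < ε) (y : EuclideanSpace ℝ (Fin n))
    {R R' : ℝ} {f g : EuclideanSpace ℝ (Fin n) → ℂ} (hf : IsTestOn R f) (hg : IsTestOn R' g) :
    potentialPairing ε y (lap fun x => f x + g x) =
      potentialPairing ε y (lap f) + potentialPairing ε y (lap g) := by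
  simp only [potentialPairing, lap_add hf.contDiff hg.contDiff, mul_add]
  exact integral_add (integrable_regularizedPotential_mul hn hε y hf.lap)
    (integrable_regularizedPotential_mul hn hε y hg.lap)

lemma potentialPairing_lap_const_mul (ε : ℝ) (y : EuclideanSpace ℝ (Fin n))
    {f : EuclideanSpace ℝ (Fin n) → ℂ} (hf : ContDiff ℝ ∞ f) (c : ℂ) :
    potentialPairing ε y (lap fun x => c * f x) = c * potentialPairing ε y (lap f) := by
  simp only [potentialPairing, lap_const_mul hf]
  rw [← integral_const_mul]
  refine integral_congr_ae (Eventually.of_forall fun x => ?_)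
  dsimp only
  ring

lemma exists_limit_lap_unit (hn : 3 ≤ n) {R : ℝ} (hR : 0 ≤ R) :
    ∃ (C : ℝ) (N : ℕ), 0 ≤ C ∧ ∀ y : EuclideanSpace ℝ (Fin n), ‖y‖ = 1 ∨ y = 0 →
      ∀ f, IsTestOn R f → ∀ M, DerivBound N R M f → ∃ L, Tendsto
        (fun ε => potentialPairing ε y (lap f)) (𝓝[>] 0) (𝓝 L) ∧ ‖L‖ ≤ C * M := by
  obtain ⟨C1, N, hC1, h1⟩ := exists_limit_potentialPairing hn hR
  obtain ⟨C2, hC2, h2⟩ := exists_limit_potentialPairing_zero hn R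
  refine ⟨(C1 + C2) * n, N + 2, by positivity, fun y hy f hf M hM => ?_⟩
  have hl := hM.lap hf.contDiff
  have hM0 := hl.nonneg hR
  rcases hy with hy | rfl
  · obtain ⟨L, ht, hL⟩ := h1 y hy _ hf.lap _ hl
    exact ⟨L, ht, hL.trans (by nlinarith)⟩
  · obtain ⟨L, ht, hL⟩ := h2 _ hf.lap _ (hl.mono (Nat.zero_le _) le_rfl le_rfl) hM0
    exact ⟨L, ht, hL.trans (by nlinarith)⟩

lemma tendsto_div_nhdsGT_zero {a : ℝ} (ha : 0 < a) :
    Tendsto (fun ε : ℝ => ε / a) (𝓝[>] 0) (𝓝[>] 0) := by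
  refine tendsto_nhdsWithin_iff.2 ⟨?_, ?_⟩
  · have : Tendsto (fun ε : ℝ => ε / a) (𝓝 0) (𝓝 (0 / a)) := tendsto_id.div_const a
    rw [zero_div] at this
    exact this.mono_left nhdsWithin_le_nhds
  · filter_upwards [self_mem_nhdsWithin] with ε hε
    exact div_pos hε ha

lemma IsTestOn.comp_smul {R : ℝ} {f : EuclideanSpace ℝ (Fin n) → ℂ} (hf : IsTestOn R f) {a : ℝ}
    (ha : 0 < a) : IsTestOn (R / a) fun x => f (a • x) :=
  ⟨hf.contDiff.comp (contDiff_const_smul a), fun x hx => hf.eq_zero _ (by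
    rw [norm_smul, Real.norm_eq_abs, abs_of_pos ha]
    rwa [div_lt_iff₀' ha] at hx)⟩

lemma iteratedFDeriv_comp_smul {f : EuclideanSpace ℝ (Fin n) → ℂ} (hf : ContDiff ℝ ∞ f) (a : ℝ)
    (j : ℕ) (x : EuclideanSpace ℝ (Fin n)) :
    ‖iteratedFDeriv ℝ j (fun x => f (a • x)) x‖ = |a| ^ j * ‖iteratedFDeriv ℝ j f (a • x)‖ := by
  rw [iteratedFDeriv_comp_const_smul a (hf.of_le (mod_cast le_top)), norm_smul, norm_pow,
    Real.norm_eq_abs]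

lemma DerivBound.comp_smul {N : ℕ} {R M : ℝ} {f : EuclideanSpace ℝ (Fin n) → ℂ}
    (h : DerivBound N R M f) (hf : ContDiff ℝ ∞ f) {a : ℝ} (ha : 0 < a) :
    DerivBound N (R / a) ((max 1 a) ^ N * M) fun x => f (a • x) := by
  intro j hj x hx
  rw [iteratedFDeriv_comp_smul hf, abs_of_pos ha]
  have hx' : ‖a • x‖ ≤ R := by
    rw [norm_smul, Real.norm_eq_abs, abs_of_pos ha]
    rwa [le_div_iff₀' ha] at hx
  have h1 := h j hj _ hx'
  have h2 : a ^ j ≤ (max 1 a) ^ N :=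
    (pow_le_pow_left₀ ha.le (le_max_right 1 a) j).trans
      (pow_le_pow_right₀ (le_max_left 1 a) hj)
  gcongr

/-- Rescaling to a unit vector makes the constants depend on y, which is harmless for continuity of
the distribution at a fixed y. -/
lemma exists_limit_lap (hn : 3 ≤ n) {R : ℝ} (hR : 0 ≤ R) (y : EuclideanSpace ℝ (Fin n)) :
    ∃ (C : ℝ) (N : ℕ), 0 ≤ C ∧
      ∀ f, IsTestOn R f → ∀ M, DerivBound N R M f → ∃ L, Tendsto
        (fun ε => potentialPairing ε y (lap f)) (𝓝[>] 0) (𝓝 L) ∧ ‖L‖ ≤ C * M := by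
  by_cases hy : y = 0
  · obtain ⟨C, N, hC, h⟩ := exists_limit_lap_unit hn hR
    exact ⟨C, N, hC, h y (Or.inr hy)⟩
  · have ha : 0 < ‖y‖ := norm_pos_iff.2 hy
    obtain ⟨C, N, hC, h⟩ := exists_limit_lap_unit hn (div_nonneg hR ha.le)
    refine ⟨C * (max 1 ‖y‖) ^ N, N, by positivity, fun f hf M hM => ?_⟩
    obtain ⟨L, ht, hL⟩ := h (‖y‖⁻¹ • y) (Or.inl (by
      rw [norm_smul, norm_inv, norm_norm, inv_mul_cancel₀ ha.ne'])) _ (hf.comp_smul ha) _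
      (hM.comp_smul hf.contDiff ha)
    refine ⟨L, (ht.comp (tendsto_div_nhdsGT_zero ha)).congr fun ε => ?_, by rwa [mul_assoc]⟩
    simp only [Function.comp_apply]
    rw [← potentialPairing_smul ha ε _ hf.contDiff, smul_smul, mul_inv_cancel₀ ha.ne', one_smul]

/-- The difference of f and g vanishes on the ball of radius 2, hence pairs to zero by harmonicity
as soon as ε < 1. -/
lemma tendsto_potentialPairing_lap_congr (hn : 3 ≤ n) {y : EuclideanSpace ℝ (Fin n)}
    (hy : ‖y‖ ≤ 1) {R R' : ℝ} {f g : EuclideanSpace ℝ (Fin n) → ℂ} (hf : IsTestOn R f)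
    (hg : IsTestOn R' g) (h : ∀ x, ‖x‖ < 2 → f x = g x) {L : ℂ}
    (ht : Tendsto (fun ε => potentialPairing ε y (lap f)) (𝓝[>] 0) (𝓝 L)) :
    Tendsto (fun ε => potentialPairing ε y (lap g)) (𝓝[>] 0) (𝓝 L) := by
  have hd : IsTestOn (max R R') fun x => g x + (-1) * f x :=
    (hg.mono (le_max_right _ _)).add ((hf.mono (le_max_left _ _)).const_mul _)
  refine ht.congr' ?_
  filter_upwards [self_mem_nhdsWithin, nhdsWithin_le_nhds (Iio_mem_nhds one_pos)] with ε hε hε1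
  have h0 := potentialPairing_lap_eq_zero hd (fun x hx => by rw [h x hx]; ring) hy hε1
  have h1 := potentialPairing_lap_add hn hε y hf hd
  rw [h0, add_zero] at h1
  rw [← h1]
  congr 2
  ext x
  ring

lemma tendsto_potentialPairing_smul {y : EuclideanSpace ℝ (Fin n)} {a : ℝ} (ha : 0 < a)
    {f : EuclideanSpace ℝ (Fin n) → ℂ} (hf : ContDiff ℝ ∞ f) {L : ℂ}
    (ht : Tendsto (fun ε => potentialPairing ε y (lap fun x => f (a • x))) (𝓝[>] 0) (𝓝 L)) :
    Tendsto (fun ε => potentialPairing ε (a • y) (lap f)) (𝓝[>] 0) (𝓝 L) :=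
  (ht.comp (tendsto_div_nhdsGT_zero ha)).congr fun ε => (potentialPairing_smul ha ε y hf).symm

/-- The cutoff and its dilate by a ≤ 1 agree for ‖x‖ < 2, so by scaling the limit L at y is also the
limit at a y. There the pairing does not depend on ε < 1 and is the flux integral, which tends to 1
as a → 0; hence L = 1. -/
lemma tendsto_potentialPairing_cutoff (hn : 3 ≤ n) {y : EuclideanSpace ℝ (Fin n)}
    (hy : ‖y‖ ≤ 1) (hy' : ‖y‖ = 1 ∨ y = 0) :
    Tendsto (fun ε => potentialPairing ε y (lap cutoff)) (𝓝[>] 0) (𝓝 1) := by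
  obtain ⟨C, N, -, h⟩ := exists_limit_lap_unit hn (by norm_num : (0 : ℝ) ≤ 3)
  obtain ⟨M, -, hM⟩ := exists_derivBound (isTestOn_cutoff (n := n)).contDiff N 3
  obtain ⟨L, ht, -⟩ := h y hy' _ isTestOn_cutoff M hM
  have hconst : ∀ a : ℝ, 0 < a → a ≤ 1 → (sphereArea n : ℂ)⁻¹ / (2 - n) *
      ∫ x, gam (a • y) x ^ (2 - n : ℤ) * lap cutoff x = L := by
    intro a ha ha1
    have h1 := tendsto_potentialPairing_lap_congr hn hy isTestOn_cutoff
      (isTestOn_cutoff.comp_smul ha) (fun x hx => by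
        rw [cutoff_eq_one hx, cutoff_eq_one]
        rw [norm_smul, Real.norm_eq_abs, abs_of_pos ha]
        nlinarith [norm_nonneg x]) ht
    have h2 := tendsto_potentialPairing_smul ha isTestOn_cutoff.contDiff h1
    refine tendsto_nhds_unique (tendsto_const_nhds.congr' ?_) h2
    filter_upwards [nhdsWithin_le_nhds (Iio_mem_nhds one_pos)] with ε hε
    refine (potentialPairing_lap_of_const (fun x hx => cutoff_eq_one hx) ?_ hε).symm
    rw [norm_smul, Real.norm_eq_abs, abs_of_pos ha]
    nlinarith [norm_nonneg y]
  have hlim : Tendsto (fun a : ℝ => a • y) (𝓝[>] 0) (𝓝 0) := by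
    have : Tendsto (fun a : ℝ => a • y) (𝓝 0) (𝓝 ((0 : ℝ) • y)) := tendsto_id.smul_const y
    rw [zero_smul] at this
    exact this.mono_left nhdsWithin_le_nhds
  have h3 := (tendsto_flux hn).comp hlim
  have h4 : L = 1 := by
    refine tendsto_nhds_unique (tendsto_const_nhds.congr' ?_) h3
    filter_upwards [self_mem_nhdsWithin, nhdsWithin_le_nhds (Iio_mem_nhds one_pos)] with a ha ha1
    exact (hconst a ha (le_of_lt ha1)).symm
  rwa [h4] at ht

/-- Order zero is the mean value inequality on ‖a x‖ ≤ 3a, which explains the bound on one extra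
derivative when N = 0; for order j ≥ 1 the chain rule gives a^j ≤ a. -/
lemma derivBound_comp_smul_sub {N : ℕ} {M : ℝ} {f : EuclideanSpace ℝ (Fin n) → ℂ}
    (hf : ContDiff ℝ ∞ f) (h : DerivBound (N + 1) 3 M f) {a : ℝ} (ha : 0 < a) (ha1 : a ≤ 1) :
    DerivBound N 3 (3 * M * a) fun x => f (a • x) + -f 0 := by
  have hM := h.nonneg (by norm_num)
  intro j hj x hx
  have hax : ‖a • x‖ ≤ 3 * a := by
    rw [norm_smul, Real.norm_eq_abs, abs_of_pos ha]; nlinarith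
  have hax3 : ‖a • x‖ ≤ 3 := hax.trans (by linarith)
  rcases j with _ | j
  · rw [norm_iteratedFDeriv_zero]
    have hmv := (convex_closedBall (0 : EuclideanSpace ℝ (Fin n)) 3).norm_image_sub_le_of_norm_fderiv_le
      (𝕜 := ℝ) (f := f) (C := M) (x := 0) (y := a • x)
      (fun z _ => hf.differentiable (by simp) z) (fun z hz => by
        have := h 1 (by omega) z (by simpa using hz)
        rwa [← norm_iteratedFDeriv_fderiv, norm_iteratedFDeriv_zero] at this)
      (by simp) (by simpa using hax3)
    rw [sub_zero, sub_eq_add_neg] at hmv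
    calc _ ≤ M * ‖a • x‖ := hmv
      _ ≤ M * (3 * a) := by gcongr
      _ = _ := by ring
  · have hadd := iteratedFDeriv_add_apply (𝕜 := ℝ) (i := j + 1) (x := x)
      (f := fun x => f (a • x)) (g := fun _ => -f 0)
      ((hf.comp (contDiff_const_smul a)).of_le (mod_cast le_top)).contDiffAt
      contDiff_const.contDiffAt
    change ‖iteratedFDeriv ℝ (j + 1) ((fun x => f (a • x)) + fun _ => -f 0) x‖ ≤ _
    rw [hadd, iteratedFDeriv_const_of_ne (by omega), Pi.zero_apply, add_zero,
      iteratedFDeriv_comp_smul hf, abs_of_pos ha]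
    have h1 := h (j + 1) (by omega) _ hax3
    have h2 : a ^ (j + 1) ≤ a := by
      simpa using pow_le_pow_of_le_one ha.le ha1 (show 1 ≤ j + 1 by omega)
    calc _ ≤ a * M := by gcongr
      _ ≤ _ := by nlinarith

/-- On the ball of radius 2, f(a x) equals f(0) χ + (f(a x) - f(0)) χ with χ the cutoff. The first
term contributes exactly f(0), the second O(a) by the derivative bound, with a constant independent
of y. -/
lemma exists_limit_lap_near (hn : 3 ≤ n) {R : ℝ} {f : EuclideanSpace ℝ (Fin n) → ℂ}
    (hf : IsTestOn R f) :
    ∃ C, ∀ y : EuclideanSpace ℝ (Fin n), ‖y‖ = 1 ∨ y = 0 → ∀ a : ℝ, 0 < a → a ≤ 1 →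
      ∃ L, Tendsto (fun ε => potentialPairing ε (a • y) (lap f)) (𝓝[>] 0) (𝓝 L) ∧
        ‖L - f 0‖ ≤ C * a := by
  obtain ⟨C, N, hC, h⟩ := exists_limit_lap_unit hn (by norm_num : (0 : ℝ) ≤ 3)
  obtain ⟨M, hM0, hM⟩ := exists_derivBound (isTestOn_cutoff (n := n)).contDiff N 3
  obtain ⟨M', hM0', hM'⟩ := exists_derivBound hf.contDiff (N + 1) 3
  refine ⟨C * (2 ^ N * (3 * M' * M)), fun y hy' a ha ha1 => ?_⟩
  have hy : ‖y‖ ≤ 1 := by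
    rcases hy' with h | rfl
    · exact h.le
    · simp
  have hs : ContDiff ℝ ∞ fun x => f (a • x) + -f 0 :=
    (hf.contDiff.comp (contDiff_const_smul a)).add contDiff_const
  have hg : IsTestOn 3 fun x => (f (a • x) + -f 0) * cutoff x := isTestOn_cutoff.mul_left hs
  obtain ⟨L, ht, hL⟩ := h y hy' _ hg _
    (DerivBound.mul (derivBound_comp_smul_sub hf.contDiff hM' ha ha1) hM hs
      isTestOn_cutoff.contDiff (by norm_num))
  have hc := (tendsto_potentialPairing_cutoff hn hy hy').const_mul (f 0)
  have hsum := hc.add ht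
  refine ⟨f 0 * 1 + L, ?_, ?_⟩
  · refine tendsto_potentialPairing_smul ha hf.contDiff ?_
    refine tendsto_potentialPairing_lap_congr hn hy
      ((isTestOn_cutoff.const_mul (f 0)).add hg) (hf.comp_smul ha) (fun x hx => ?_)
      (hsum.congr' ?_)
    · rw [cutoff_eq_one hx]; ring
    · filter_upwards [self_mem_nhdsWithin] with ε hε
      rw [potentialPairing_lap_add hn hε y (isTestOn_cutoff.const_mul (f 0)) hg,
        potentialPairing_lap_const_mul ε y isTestOn_cutoff.contDiff]
  · rw [mul_one, add_sub_cancel_left]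
    exact hL.trans (le_of_eq (by ring))

end SingularSource

/-! ### Translation to Mathlib distributions and the theorem. -/

section Distributions

variable {n : ℕ}

lemma functionDistribution_apply {g : EuclideanSpace ℝ (Fin n) → ℂ} (hg : LocallyIntegrable g)
    (f : 𝓓((⊤ : TopologicalSpace.Opens (EuclideanSpace ℝ (Fin n))), ℝ)) :
    functionDistribution g f = ∫ x, g x * (f x : ℂ) := by
  change (TestFunction.integralAgainstBilinCLM (ContinuousLinearMap.lsmul ℝ ℝ) volume g) f = _
  rw [TestFunction.integralAgainstBilinCLM_eq_integral (hg.locallyIntegrableOn _)]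
  refine integral_congr_ae (Eventually.of_forall fun x => ?_)
  simp [mul_comm]

lemma lineDerivOp_ofReal (f : 𝓓((⊤ : TopologicalSpace.Opens (EuclideanSpace ℝ (Fin n))), ℝ))
    (v x : EuclideanSpace ℝ (Fin n)) :
    ((LineDeriv.lineDerivOp v f x : ℝ) : ℂ) = dirDeriv v (fun x => (f x : ℂ)) x := by
  have hd : DifferentiableAt ℝ f x := (f.contDiff.differentiable (by simp)) x
  have h1 : LineDeriv.lineDerivOp v f x = fderiv ℝ f x v := by
    rw [← hd.lineDeriv_eq_fderiv]
    exact TestFunction.lineDerivCLM_apply_of_le (by simp)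
  rw [h1]
  have := Complex.ofRealCLM.hasFDerivAt.comp x hd.hasFDerivAt
  exact (congrArg (fun L => L v) this.fderiv).symm

lemma exists_isTestOn (f : 𝓓((⊤ : TopologicalSpace.Opens (EuclideanSpace ℝ (Fin n))), ℝ)) :
    ∃ R, 0 ≤ R ∧ IsTestOn R fun x => (f x : ℂ) := by
  obtain ⟨R, hR⟩ := f.hasCompactSupport.isBounded.subset_closedBall 0
  refine ⟨max R 0, le_max_right _ _, Complex.ofRealCLM.contDiff.comp f.contDiff, fun x hx => ?_⟩
  have : f x = 0 := image_eq_zero_of_notMem_tsupport fun h => by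
    have h2 := hR h
    simp only [mem_closedBall_zero_iff] at h2
    exact absurd (h2.trans (le_max_left R 0)) (not_le.2 hx)
  simp [this]

lemma regularizedSource_apply (hn : 3 ≤ n) {ε : ℝ} (hε : 0 < ε) (y : EuclideanSpace ℝ (Fin n))
    (f : 𝓓((⊤ : TopologicalSpace.Opens (EuclideanSpace ℝ (Fin n))), ℝ)) :
    regularizedSource ε y f = potentialPairing ε y (lap fun x => (f x : ℂ)) := by
  obtain ⟨R, -, hf⟩ := exists_isTestOn f
  have hli := locallyIntegrable_regularizedPotential (by omega : 2 ≤ n) hε y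
  rw [regularizedSource, LineDeriv.laplacianCLM_eq_sum (EuclideanSpace.basisFun (Fin n) ℝ)]
  have hsum : ∀ T : Fin n → 𝓓'((⊤ : TopologicalSpace.Opens (EuclideanSpace ℝ (Fin n))), ℂ),
      (∑ i, T i) f = ∑ i, T i f := fun T => by simp
  rw [hsum]
  simp only [potentialPairing, lap, Finset.mul_sum]
  rw [integral_finsetSum]
  · refine Finset.sum_congr rfl fun i _ => ?_
    rw [Distribution.lineDerivOp_apply_apply, map_neg, Distribution.lineDerivOp_apply_apply,
      map_neg, neg_neg, functionDistribution_apply hli]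
    refine integral_congr_ae (Eventually.of_forall fun x => ?_)
    dsimp only
    rw [lineDerivOp_ofReal]
    congr 3
    ext z
    exact lineDerivOp_ofReal f _ z
  · intro i _
    exact integrable_regularizedPotential_mul hn hε y ((hf.dirDeriv _).dirDeriv _)

lemma exists_tendsto_regularizedSource (hn : 3 ≤ n) (y : EuclideanSpace ℝ (Fin n))
    (f : 𝓓((⊤ : TopologicalSpace.Opens (EuclideanSpace ℝ (Fin n))), ℝ)) :
    ∃ L, Tendsto (fun ε : ℝ => regularizedSource ε y f) (𝓝[>] 0) (𝓝 L) := by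
  obtain ⟨R, hR, hf⟩ := exists_isTestOn f
  obtain ⟨C, N, -, h⟩ := exists_limit_lap hn hR y
  obtain ⟨M, -, hM⟩ := exists_derivBound hf.contDiff N R
  obtain ⟨L, ht, -⟩ := h _ hf M hM
  refine ⟨L, ht.congr' ?_⟩
  filter_upwards [self_mem_nhdsWithin] with ε hε
  exact (regularizedSource_apply hn hε y f).symm

lemma norm_iteratedFDeriv_ofReal (f : 𝓓((⊤ : TopologicalSpace.Opens (EuclideanSpace ℝ (Fin n))), ℝ))
    (j : ℕ) (x : EuclideanSpace ℝ (Fin n)) :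
    ‖iteratedFDeriv ℝ j (fun x => (f x : ℂ)) x‖ = ‖iteratedFDeriv ℝ j f x‖ :=
  Complex.ofRealLI.norm_iteratedFDeriv_comp_left
    ((f.contDiff.of_le (mod_cast le_top)).contDiffAt (x := x)) le_rfl

/-- Linearity passes to the pointwise limit. Continuity on functions supported in a compact K is the
estimate of `exists_limit_lap`, with M taken to be the maximum of the seminorms of order at most N.
-/
lemma exists_singularSource (hn : 3 ≤ n) (y : EuclideanSpace ℝ (Fin n)) :
    ∃ T : 𝓓'((⊤ : TopologicalSpace.Opens (EuclideanSpace ℝ (Fin n))), ℂ),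
      IsSingularSource y T := by
  choose T hT using exists_tendsto_regularizedSource hn y
  have hadd : ∀ f g, T (f + g) = T f + T g := fun f g =>
    tendsto_nhds_unique (hT (f + g)) (((hT f).add (hT g)).congr fun ε => by rw [map_add])
  have hsmul : ∀ (c : ℝ) f, T (c • f) = c • T f := fun c f =>
    tendsto_nhds_unique (hT (c • f)) (((hT f).const_smul c).congr fun ε => by rw [map_smul])
  refine ⟨(TestFunction.mkCLM ℝ T hadd hsmul fun K hK => ?_ :
    𝓓((⊤ : TopologicalSpace.Opens (EuclideanSpace ℝ (Fin n))), ℝ) →L[ℝ] ℂ), hT⟩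
  obtain ⟨R', hR'⟩ := K.isCompact.isBounded.subset_closedBall 0
  set R := max R' 0
  obtain ⟨C, N, hC, h⟩ := exists_limit_lap hn (le_max_right R' 0) y
  refine (ContDiffMapSupportedIn.mkCLMtoNormedSpace ℝ
    (T ∘ TestFunction.ofSupportedIn hK)
    (fun f g => hadd (TestFunction.ofSupportedIn hK f) (TestFunction.ofSupportedIn hK g))
    (fun c f => hsmul c (TestFunction.ofSupportedIn hK f))
    ⟨Finset.range (N + 1), C, hC, fun f => ?_⟩).continuous
  set F := TestFunction.ofSupportedIn hK f
  have hF : IsTestOn R fun x => (F x : ℂ) :=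
    ⟨Complex.ofRealCLM.contDiff.comp F.contDiff, fun x hx => by
      have : F x = 0 := f.zero_on_compl fun hxK => by
        have h2 := hR' hxK
        simp only [mem_closedBall_zero_iff] at h2
        exact absurd (h2.trans (le_max_left R' 0)) (not_le.2 hx)
      simp [this]⟩
  obtain ⟨L, ht, hL⟩ := h _ hF (((Finset.range (N + 1)).sup fun i =>
      ContDiffMapSupportedIn.seminorm ℝ (EuclideanSpace ℝ (Fin n)) ℝ ⊤ K i) f) (fun j hj x _ => by
    rw [norm_iteratedFDeriv_ofReal]
    refine (ContDiffMapSupportedIn.norm_iteratedFDeriv_apply_le_seminorm_top ℝ (f := f)).trans ?_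
    exact Seminorm.le_def.1 (Finset.le_sup (f := fun i => ContDiffMapSupportedIn.seminorm ℝ
      (EuclideanSpace ℝ (Fin n)) ℝ ⊤ K i) (Finset.mem_range.2 (by omega))) f)
  have hTL : T F = L := by
    refine tendsto_nhds_unique (hT F) (ht.congr' ?_)
    filter_upwards [self_mem_nhdsWithin] with ε hε
    exact (regularizedSource_apply hn hε y F).symm
  rw [Function.comp_apply, hTL]
  exact hL

end Distributions

theorem theorem1 (n : ℕ) (hn : 3 ≤ n) :
    ∃ singularSource : EuclideanSpace ℝ (Fin n) →
        𝓓'((⊤ : TopologicalSpace.Opens (EuclideanSpace ℝ (Fin n))), ℂ),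
      (∀ y, IsSingularSource y (singularSource y)) ∧
      ∀ f : 𝓓((⊤ : TopologicalSpace.Opens (EuclideanSpace ℝ (Fin n))), ℝ),
        Tendsto (fun y => singularSource y f) (𝓝 0) (𝓝 (pointSource n f)) := by
  choose T hT using exists_singularSource (n := n) hn
  refine ⟨T, hT, fun f => ?_⟩
  obtain ⟨R, -, hf⟩ := exists_isTestOn f
  obtain ⟨C, hC⟩ := exists_limit_lap_near hn hf
  have hval : ∀ y L, Tendsto (fun ε => potentialPairing ε y (lap fun x => (f x : ℂ))) (𝓝[>] 0)
      (𝓝 L) → T y f = L := fun y L hL => by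
    refine tendsto_nhds_unique (hT y f) (hL.congr' ?_)
    filter_upwards [self_mem_nhdsWithin] with ε hε
    exact (regularizedSource_apply hn hε y f).symm
  have hps : pointSource n f = (f 0 : ℂ) := by
    simp [pointSource]
  have hbound : ∀ y a, ‖y‖ = 1 ∨ y = 0 → 0 < a → a ≤ 1 →
      ‖T (a • y) f - (f 0 : ℂ)‖ ≤ C * a := fun y a hy ha ha1 => by
    obtain ⟨L, ht, hL⟩ := hC y hy a ha ha1
    rwa [hval _ _ ht]
  -- The limit is over full neighbourhoods of 0, so the value at y = 0 is needed; since a • 0 = 0,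
  -- the bound C a holds there for all small a.
  have hzero : T 0 f = (f 0 : ℂ) := by
    rw [← sub_eq_zero, ← norm_le_zero_iff]
    have hlim : Tendsto (fun a : ℝ => C * a) (𝓝[>] 0) (𝓝 0) := by
      have : Tendsto (fun a : ℝ => C * a) (𝓝 0) (𝓝 (C * 0)) := tendsto_id.const_mul C
      rw [mul_zero] at this
      exact this.mono_left nhdsWithin_le_nhds
    refine ge_of_tendsto hlim ?_
    filter_upwards [self_mem_nhdsWithin, nhdsWithin_le_nhds (Iio_mem_nhds one_pos)] with a ha ha1
    have := hbound 0 a (Or.inr rfl) ha (le_of_lt ha1)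
    rwa [smul_zero] at this
  rw [hps, tendsto_iff_norm_sub_tendsto_zero]
  have hlim : Tendsto (fun y : EuclideanSpace ℝ (Fin n) => C * ‖y‖) (𝓝 0) (𝓝 0) := by
    have : Tendsto (fun y : EuclideanSpace ℝ (Fin n) => C * ‖y‖) (𝓝 0) (𝓝 (C * ‖(0 :
      EuclideanSpace ℝ (Fin n))‖)) := (continuous_const.mul continuous_norm).tendsto 0
    rwa [norm_zero, mul_zero] at this
  refine tendsto_of_tendsto_of_tendsto_of_le_of_le' tendsto_const_nhds hlim
    (Eventually.of_forall fun y => norm_nonneg _) ?_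
  filter_upwards [Metric.closedBall_mem_nhds (0 : EuclideanSpace ℝ (Fin n)) one_pos] with y hy
  by_cases hy0 : y = 0
  · rw [hy0, hzero]; simp
  · have ha : 0 < ‖y‖ := norm_pos_iff.2 hy0
    have := hbound (‖y‖⁻¹ • y) ‖y‖ (Or.inl (by
      rw [norm_smul, norm_inv, norm_norm, inv_mul_cancel₀ ha.ne'])) ha (by simpa using hy)
    rwa [smul_smul, mul_inv_cancel₀ ha.ne', one_smul] at this
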